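/- Let $M=G/H$ be a simply connected homogeneous Riemannian manifold, i.e. a simply connected smooth Riemannian manifold on which a (finite-dimensional, second countable) Lie group $G$ acts smoothly, transitively and by isometries. Let $\nabla$ be its Levi-Civita connection, $R$ its curvature tensor, and let $$\nu_p=\{v\in T_pM : R_{x,y}v=0 \text{ for all } x,y\in T_pM\},\qquad \nu^{(1)}_p=\nu_p+\operatorname{span}\{\nabla_wX : w\in T_pM,\ X \text{ a smooth vector field on } M \text{ with } X_q\in\nu_q \text{ for all } q\in M\}$$ be the nullity and its first osculating distribution. Assume that $M$ has no Euclidean de Rham factor (it is not isometric to a Riemannian product $N\times\mathbb R^k$ with $k\ge 1$) and that the nullity is non-trivial, i.e. $\nu$ is neither $\{0\}$ nor a parallel distribution. Let $\mathcal K^G(M)$ be the Lie algebra of Killing fields of $M$ induced by the elements of the Lie algebra of $G$ and, for $p\in M$, put $$\mathfrak u^p_{00}=\{Z\in\mathcal K^G(M) : \nabla_vZ=0 \text{ for all } v\in\nu^{(1)}_p\},\qquad \mathfrak{tr}^p=\{X\in\mathcal K^G(M) : (\nabla X)_p=0,\ X_p\in\nu^{(1)}_p\}.$$ Then $\mathfrak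 u^p_{00}$ is an ideal of $\mathcal K^G(M)$ that does not depend on $p\in M$; denote it by $\mathfrak u_{00}$. Moreover, for every $p\in M$, $\mathfrak{tr}^p$ is contained in the center of $\mathfrak u_{00}$. -/

import Mathlib

open Bundle
open scoped Manifold ContDiff

noncomputable section

namespace HomNullity

universe u

section VectorFields

variable (E : Type*) [NormedAddCommGroup E] [NormedSpace ℝ E]
  (M : Type*) [TopologicalSpace M] [ChartedSpace E M]

/-- (Not necessarily smooth) vector fields on the manifold `M` modelled on `E`. -/
abbrev VField : Type _ := (p : M) → TangentSpace 𝓘(ℝ, E) p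

variable {E M}

/-- A vector field is smooth if it is smooth as a map into the tangent bundle. -/
def IsSmoothField [IsManifold 𝓘(ℝ, E) ∞ M] (X : VField E M) : Prop :=
  ContMDiff 𝓘(ℝ, E) 𝓘(ℝ, E).tangent ∞ (fun p => (⟨p, X p⟩ : TangentBundle 𝓘(ℝ, E) M))

/-- `𝔲` is an ideal of the Lie algebra `𝔤` of vector fields: a linear subspace of `𝔤` with
`[𝔤, 𝔲] ⊆ 𝔲`. -/
structure IsIdealOf (𝔲 𝔤 : Submodule ℝ (VField E M)) : Prop where
  le : 𝔲 ≤ 𝔤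
  bracket_mem : ∀ Z ∈ 𝔤, ∀ U ∈ 𝔲, VectorField.mlieBracket 𝓘(ℝ, E) Z U ∈ 𝔲

/-- The center of a space `𝔲` of vector fields: the fields in `𝔲` that commute with `𝔲`. -/
def center (𝔲 : Submodule ℝ (VField E M)) : Set (VField E M) :=
  {X | X ∈ 𝔲 ∧ ∀ U ∈ 𝔲, VectorField.mlieBracket 𝓘(ℝ, E) X U = 0}

end VectorFields

section Connection

variable {E : Type*} [NormedAddCommGroup E] [NormedSpace ℝ E]
  {M : Type*} [TopologicalSpace M] [ChartedSpace E M] [IsManifold 𝓘(ℝ, E) ∞ M]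

/-- A connection on the tangent bundle of a Riemannian manifold is its Levi-Civita connection if it
is torsion free and compatible with the metric. -/
def IsLeviCivita [FiniteDimensional ℝ E]
    [RiemannianBundle (fun p : M => TangentSpace 𝓘(ℝ, E) p)]
    [IsContMDiffRiemannianBundle 𝓘(ℝ, E) ∞ E (fun p : M => TangentSpace 𝓘(ℝ, E) p)]
    (D : CovariantDerivative 𝓘(ℝ, E) E (fun p : M => TangentSpace 𝓘(ℝ, E) p)) : Prop :=
  haveI : CompleteSpace E := FiniteDimensional.complete ℝ E
  D.torsion = 0 ∧ D.IsMetricCompatible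

variable (D : CovariantDerivative 𝓘(ℝ, E) E (fun p : M => TangentSpace 𝓘(ℝ, E) p))

/-- `D_X Y` for vector fields `X`, `Y`. Mathlib's `D Y p v` is the derivative of the field `Y` at
`p` in the direction `v`. -/
def nabla (X Y : VField E M) : VField E M := fun p => D Y p (X p)

/-- The curvature `R(X, Y) Z = D_X D_Y Z - D_Y D_X Z - D_[X, Y] Z`. -/
def curvature (X Y Z : VField E M) : VField E M :=
  nabla D X (nabla D Y Z) - nabla D Y (nabla D X Z) -
    nabla D (VectorField.mlieBracket 𝓘(ℝ, E) X Y) Z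

/-- The nullity subspace `ν_p = {v | R(x, y) v = 0 for all x, y}` of `T_p M`. The curvature being a
tensor, it is evaluated on arbitrary smooth extensions of `x`, `y` and `v` to `M`. -/
def nullity (p : M) : Set (TangentSpace 𝓘(ℝ, E) p) :=
  {v | ∀ X Y V : VField E M, IsSmoothField X → IsSmoothField Y → IsSmoothField V →
    V p = v → curvature D X Y V p = 0}

/-- The values at `q` of the derivatives `D_w X`, where `w ∈ T_q M` and `X` is a smooth field lying
in the distribution `𝒟`. -/
def derivValues (𝒟 : (p : M) → Set (TangentSpace 𝓘(ℝ, E) p)) (q : M) :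
    Set (TangentSpace 𝓘(ℝ, E) q) :=
  {y | ∃ (X : VField E M) (w : TangentSpace 𝓘(ℝ, E) q),
    IsSmoothField X ∧ (∀ p, X p ∈ 𝒟 p) ∧ D X q w = y}

/-- The osculating distribution `𝒟_q + span {D_w X : X ∈ C^∞(𝒟), w ∈ T_q M}` of `𝒟`. -/
def osculating (𝒟 : (p : M) → Set (TangentSpace 𝓘(ℝ, E) p)) (q : M) :
    Submodule ℝ (TangentSpace 𝓘(ℝ, E) q) :=
  Submodule.span ℝ (𝒟 q) ⊔ Submodule.span ℝ (derivValues D 𝒟 q)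

/-- A distribution is parallel if covariant derivatives of its smooth sections stay in it. -/
def IsParallel (𝒟 : (p : M) → Set (TangentSpace 𝓘(ℝ, E) p)) : Prop :=
  ∀ q, derivValues D 𝒟 q ⊆ 𝒟 q

/-- The nullity is non-trivial if it is neither zero nor a parallel distribution. -/
def HasNontrivialNullity : Prop :=
  ¬ (∀ p, nullity D p = {0}) ∧ ¬ IsParallel D (nullity D)

end Connection

section Product

variable (E : Type*) [NormedAddCommGroup E] [NormedSpace ℝ E]
  (M : Type u) [TopologicalSpace M] [ChartedSpace E M]
  [RiemannianBundle (fun p : M => TangentSpace 𝓘(ℝ, E) p)]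

/-- `M` has a Euclidean de Rham factor: it is isometric to a Riemannian product `N × ℝᵏ` of a smooth
Riemannian manifold `(N, h)` and the Euclidean space of some dimension `k ≥ 1`. (`N` may be a
point.) -/
def HasEuclideanFactor : Prop :=
  ∃ (m k : ℕ) (N : Type u) (_ : TopologicalSpace N)
    (_ : ChartedSpace (EuclideanSpace ℝ (Fin m)) N)
    (_ : IsManifold 𝓘(ℝ, EuclideanSpace ℝ (Fin m)) ∞ N)
    (h : ContMDiffRiemannianMetric 𝓘(ℝ, EuclideanSpace ℝ (Fin m)) ∞ (EuclideanSpace ℝ (Fin m))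
      (fun x : N => TangentSpace 𝓘(ℝ, EuclideanSpace ℝ (Fin m)) x))
    (Φ : Diffeomorph
      (𝓘(ℝ, EuclideanSpace ℝ (Fin m)).prod 𝓘(ℝ, EuclideanSpace ℝ (Fin k))) 𝓘(ℝ, E)
      (N × EuclideanSpace ℝ (Fin k)) M ∞),
    1 ≤ k ∧
    ∀ (x : N) (t : EuclideanSpace ℝ (Fin k))
      (a a' : TangentSpace 𝓘(ℝ, EuclideanSpace ℝ (Fin m)) x) (b b' : EuclideanSpace ℝ (Fin k)),
      inner ℝ
        (mfderiv (𝓘(ℝ, EuclideanSpace ℝ (Fin m)).prod 𝓘(ℝ, EuclideanSpace ℝ (Fin k))) 𝓘(ℝ, E)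
          Φ (x, t) (a, b))
        (mfderiv (𝓘(ℝ, EuclideanSpace ℝ (Fin m)).prod 𝓘(ℝ, EuclideanSpace ℝ (Fin k))) 𝓘(ℝ, E)
          Φ (x, t) (a', b'))
      = h.inner x a a' + inner ℝ b b'

end Product

section Action

variable {E : Type*} [NormedAddCommGroup E] [NormedSpace ℝ E]
  {M : Type*} [TopologicalSpace M] [ChartedSpace E M]
  {F : Type*} [NormedAddCommGroup F] [NormedSpace ℝ F]
  (G : Type*) [TopologicalSpace G] [ChartedSpace F G] [Group G] [MulAction G M]

variable (E M) in
/-- `G` acts on the Riemannian manifold `M` by isometries: all differentials of all maps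
`p ↦ g • p` preserve the inner products. -/
def ActsByIsometries [RiemannianBundle (fun p : M => TangentSpace 𝓘(ℝ, E) p)] : Prop :=
  ∀ (g : G) (p : M) (v w : TangentSpace 𝓘(ℝ, E) p),
    inner ℝ (mfderiv 𝓘(ℝ, E) 𝓘(ℝ, E) (fun q : M => g • q) p v)
      (mfderiv 𝓘(ℝ, E) 𝓘(ℝ, E) (fun q : M => g • q) p w) = inner ℝ v w

variable {G}

/-- The vector field on `M` induced by `u ∈ Lie(G)`: its value at `p` is the image of `u` under the
differential at `1` of the orbit map `g ↦ g • p`, that is `d/dt (exp(tu) • p)` at `t = 0`. (The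
differential takes values in the tangent space at `1 • p = p`.) -/
def inducedField (u : GroupLieAlgebra 𝓘(ℝ, F) G) : VField E M := fun p =>
  (mfderiv 𝓘(ℝ, F) 𝓘(ℝ, E) (fun g : G => g • p) 1 u : TangentSpace 𝓘(ℝ, E) ((1 : G) • p))

variable (E M F G) in
/-- `𝒦^G(M)`: the fields on `M` induced by the elements of the Lie algebra of `G`. When `G` acts by
isometries these are Killing fields. -/
def killingG : Submodule ℝ (VField E M) where
  carrier := Set.range (inducedField : GroupLieAlgebra 𝓘(ℝ, F) G → VField E M)
  zero_mem' := ⟨0, by funext p; exact map_zero _⟩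
  add_mem' := by
    rintro _ _ ⟨u, rfl⟩ ⟨w, rfl⟩
    exact ⟨u + w, by funext p; exact map_add _ _ _⟩
  smul_mem' := by
    rintro c _ ⟨u, rfl⟩
    exact ⟨c • u, by funext p; exact map_smul _ _ _⟩

variable [IsManifold 𝓘(ℝ, E) ∞ M]
  (D : CovariantDerivative 𝓘(ℝ, E) E (fun p : M => TangentSpace 𝓘(ℝ, E) p))

variable (F G) in
/-- `𝔲₀₀^p = {Z ∈ 𝒦^G(M) : D_v Z = 0 for all v ∈ ν^(1)_p}`. -/
def u00 (p : M) : Set (VField E M) :=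
  {Z | Z ∈ killingG E M F G ∧ ∀ v ∈ osculating D (nullity D) p, D Z p v = 0}

variable (F G) in
/-- `𝔱𝔯^p`: the `X ∈ 𝒦^G(M)` that are transvections at `p`, i.e. `(D X)_p = 0`, and satisfy
`X_p ∈ ν^(1)_p`. -/
def transvections (p : M) : Set (VField E M) :=
  {X | X ∈ killingG E M F G ∧ (∀ v, D X p v = 0) ∧ X p ∈ osculating D (nullity D) p}

end Action

end HomNullity

end

/-! Fix a point `p`. A field `X` in `𝒦^G(M)` is recorded there by its value and by the skew
endomorphism `A_X = (∇X)_p`, with `[X, Y]_p = A_Y X_p - A_X Y_p` and `A_[X,Y] = R(X, Y) - [A_X,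
A_Y]`. `KillingModel` axiomatises these data. By `ActsByIsometries.osculating_nullity_eq` the first
osculating space is `ν + span {A_X v : v ∈ ν}`, so the bracket computations at `p` become linear
algebra.

The decisive fact concerns the conullity operators `C_v w = (A_W v)^⊥`, where `W_p = w`. Homogeneity
turns their Riccati equation into `[S, C_u] = C_{Tu} - C_u C_v` with `S`, `T` skew, and this alone
forces `C_u C_v = 0` (`IsRiccati.mul_eq_zero`). The traces of all powers of `C_v` vanish, so `C_v`
is nilpotent. The equation also makes every Taylor coefficient of positive order of the squared norm
of `C` vanish, and then the last surviving power of `C_v` has norm zero.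

Let `A_Z` vanish on `ν^(1)`. For `v ∈ ν` the vector `T = A_[X,Z] A_W v` equals `A_[W,[X,Z]] v`, so
it lies in `ν^(1)`. The Bianchi identities together with `C_u C_v = 0` show `T ⟂ ν^(1)`. Hence `T =
0`, which is the ideal property (`KillingModel.br_mem_of_A_osc`). If `X` is a transvection in
`𝔱𝔯^p`, then `E = [X, Z]` vanishes at `p` and `A_E = R(X, Z)`. Iterating the ideal property gives
`A_E² = 0`, and a skew endomorphism of square zero is zero (`KillingModel.br_transvection`).

Two facts lead from `p` to `M`. The orbit maps are submersions (`inducedField_surjective`), by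
constant rank and Baire, so `𝒦^G(M)` spans each tangent space. An equivariant family of ideals of
`𝒦^G(M)` is constant (`ideal_eq_of_equivariant`), because an ideal is preserved by group elements
near the identity. The latter is used twice: for `𝔲₀₀^p`, and for the fields vanishing to first
order at `p`. In the second case it shows that such fields vanish identically, so the bracket of a
transvection with `𝔲₀₀` is zero and not only zero to first order. -/

set_option linter.unusedSectionVars false

noncomputable section

namespace HomNullity

/-! ### Powers in a noncommutative ring, and a trace criterion for nilpotency. -/

section PowerDerivative

/-- The derivative of `x ↦ x ^ k` at `c` in the direction `h`, in a noncommutative ring. -/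
def powDeriv {A : Type*} [Ring A] (c h : A) : ℕ → A
  | 0 => 0
  | k + 1 => powDeriv c h k * c + c ^ k * h

variable {A : Type*} [Ring A]

/-- Bracketing with `S` is a derivation, so it acts on powers as the formal derivative does. -/
lemma commutator_pow (S c : A) (k : ℕ) :
    S * c ^ k - c ^ k * S = powDeriv c (S * c - c * S) k := by
  induction k with
  | zero => simp [powDeriv]
  | succ k ih =>
    rw [powDeriv, ← ih, pow_succ]
    noncomm_ring

lemma powDeriv_sub (c h h' : A) (k : ℕ) :
    powDeriv c (h - h') k = powDeriv c h k - powDeriv c h' k := by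
  induction k with
  | zero => simp [powDeriv]
  | succ k ih => rw [powDeriv, powDeriv, powDeriv, ih]; noncomm_ring

lemma powDeriv_sq (c : A) (k : ℕ) : powDeriv c (c * c) k = (k : A) * c ^ (k + 1) := by
  induction k with
  | zero => simp [powDeriv]
  | succ k ih =>
    rw [powDeriv, ih]
    push_cast
    rw [add_mul, one_mul, mul_assoc, ← pow_succ, ← mul_assoc (c ^ k), ← pow_succ, ← pow_succ]

lemma hasDerivAt_pow_add_smul {A : Type*} [NormedRing A] [NormedAlgebra ℝ A] (c h : A) (k : ℕ) :
    HasDerivAt (fun t : ℝ => (c + t • h) ^ k) (powDeriv c h k) 0 := by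
  have h1 : HasDerivAt (fun t : ℝ => c + t • h) h 0 := by
    simpa using ((hasDerivAt_id (0 : ℝ)).smul_const h).const_add c
  induction k with
  | zero => simpa [powDeriv] using hasDerivAt_const (0 : ℝ) (1 : A)
  | succ k ih =>
    have := ih.mul h1
    simp only [zero_smul, add_zero] at this
    exact this.congr_of_eventuallyEq (Filter.Eventually.of_forall fun t => pow_succ _ _)

end PowerDerivative

/-- The Fitting projection onto the part where `c` is invertible is a polynomial in `c` divisible by
a positive power of `c`. Its trace is therefore zero by hypothesis, and an idempotent of trace zero
vanishes in characteristic zero. No eigenvalues are needed. -/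
lemma isNilpotent_of_trace_pow_eq_zero {V : Type*} [AddCommGroup V] [Module ℝ V]
    [FiniteDimensional ℝ V] (c : Module.End ℝ V)
    (h : ∀ k, LinearMap.trace ℝ V (c ^ (k + 1)) = 0) : IsNilpotent c := by
  classical
  obtain ⟨n, q, hpq, hq⟩ : ∃ (n : ℕ) (q : Polynomial ℝ), c.charpoly = Polynomial.X ^ n * q ∧
      q.coeff 0 ≠ 0 := by
    obtain ⟨q, hq1, hq2⟩ := Polynomial.exists_eq_pow_rootMultiplicity_mul_and_not_dvd
      c.charpoly c.charpoly_monic.ne_zero 0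
    refine ⟨c.charpoly.rootMultiplicity 0, q, by simpa using hq1, fun h0 => hq2 ?_⟩
    simpa using Polynomial.X_dvd_iff.2 h0
  have hcop : IsCoprime ((Polynomial.X : Polynomial ℝ) ^ (n + 1)) q := by
    apply IsCoprime.pow_left
    rw [Polynomial.prime_X.irreducible.coprime_iff_not_dvd, Polynomial.X_dvd_iff]
    exact hq
  obtain ⟨a, b, hab⟩ := hcop
  have hc : c ^ (n + 1) * Polynomial.aeval c q = 0 := by
    have h0 := c.aeval_self_charpoly
    rw [hpq, map_mul, map_pow, Polynomial.aeval_X] at h0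
    rw [pow_succ', mul_assoc, h0, mul_zero]
  have hab' : Polynomial.aeval c a * c ^ (n + 1) +
      Polynomial.aeval c b * Polynomial.aeval c q = 1 := by
    have := congrArg (Polynomial.aeval c) hab
    simpa using this
  have hco : ∀ p : Polynomial ℝ, Polynomial.aeval c p * c ^ (n + 1) =
      c ^ (n + 1) * Polynomial.aeval c p := fun p => by
    have := congrArg (Polynomial.aeval c) (mul_comm p (Polynomial.X ^ (n + 1)))
    simpa using this
  have hcq : ∀ p p' : Polynomial ℝ, Polynomial.aeval c p * Polynomial.aeval c p' =
      Polynomial.aeval c p' * Polynomial.aeval c p := fun p p' => by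
    rw [← map_mul, mul_comm, map_mul]
  set e := Polynomial.aeval c a * c ^ (n + 1) with he
  have hker : e * (Polynomial.aeval c b * Polynomial.aeval c q) = 0 := by
    rw [he, hcq b q, mul_assoc, ← mul_assoc (c ^ (n + 1)), hc, zero_mul, mul_zero]
  have hid : IsIdempotentElem e := by
    have : e * (e + Polynomial.aeval c b * Polynomial.aeval c q) = e * 1 := by rw [hab']
    rwa [mul_add, hker, add_zero, mul_one] at this
  have htr : LinearMap.trace ℝ V e = 0 := by
    rw [he, Polynomial.aeval_eq_sum_range, Finset.sum_mul, map_sum]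
    refine Finset.sum_eq_zero fun i _ => ?_
    rw [smul_mul_assoc, map_smul, ← pow_add, ← add_assoc, h, smul_zero]
  have he0 : e = 0 := LinearMap.IsIdempotentElem.eq_zero_of_trace_eq_zero hid htr
  refine ⟨n + 1, ?_⟩
  rw [he0, zero_add] at hab'
  calc c ^ (n + 1) = c ^ (n + 1) * (Polynomial.aeval c b * Polynomial.aeval c q) := by
        rw [hab', mul_one]
    _ = 0 := by rw [hcq b q, ← mul_assoc, hc, zero_mul]

/-! ### The algebraic Riccati equation forces all products to vanish. -/

section Riccati

open Finset

local notation "⟪" x "," y "⟫" => inner ℝ x y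

variable {V U : Type*} [NormedAddCommGroup V] [InnerProductSpace ℝ V] [FiniteDimensional ℝ V]
  [NormedAddCommGroup U] [InnerProductSpace ℝ U] [FiniteDimensional ℝ U]

/-- Invariance of the contraction of a bilinear form under a skew-symmetric endomorphism. -/
lemma sum_apply_skew_eq_zero {ι : Type*} [Fintype ι] (b : OrthonormalBasis ι ℝ U) (S : U → U)
    (hS : ∀ x y, ⟪S x, y⟫ = -⟪x, S y⟫) (B : U →ₗ[ℝ] U →ₗ[ℝ] ℝ) :
    ∑ i, (B (S (b i)) (b i) + B (b i) (S (b i))) = 0 := by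
  have hexp : ∀ i, S (b i) = ∑ k, ⟪b k, S (b i)⟫ • b k := fun i => (b.sum_repr' _).symm
  have h1 : ∑ i, B (S (b i)) (b i) = ∑ i, ∑ k, ⟪b k, S (b i)⟫ * B (b k) (b i) := by
    refine sum_congr rfl fun i _ => ?_
    conv_lhs => rw [hexp i]
    simp [LinearMap.sum_apply]
  have h2 : ∑ i, B (b i) (S (b i)) = ∑ i, ∑ k, ⟪b k, S (b i)⟫ * B (b i) (b k) := by
    refine sum_congr rfl fun i _ => ?_
    conv_lhs => rw [hexp i]
    simp
  rw [sum_add_distrib, h1, h2, sum_comm, ← sum_add_distrib]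
  refine sum_eq_zero fun i _ => ?_
  rw [← sum_add_distrib]
  refine sum_eq_zero fun k _ => ?_
  have : ⟪b i, S (b k)⟫ = -⟪b k, S (b i)⟫ := by
    rw [real_inner_comm, hS, real_inner_comm]
  rw [this]; ring

/-- The Hilbert–Schmidt inner product of endomorphisms. -/
def hsInner (X Y : V →L[ℝ] V) : ℝ :=
  ∑ a, ⟪X (stdOrthonormalBasis ℝ V a), Y (stdOrthonormalBasis ℝ V a)⟫

lemma eq_zero_of_hsInner_self {X : V →L[ℝ] V} (h : hsInner X X = 0) : X = 0 := by
  have h' := (sum_eq_zero_iff_of_nonneg (fun a _ => real_inner_self_nonneg)).1 h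
  apply ContinuousLinearMap.coe_injective
  refine (stdOrthonormalBasis ℝ V).toBasis.ext fun a => ?_
  simpa using h' a (mem_univ a)

lemma hsInner_self_nonneg (X : V →L[ℝ] V) : 0 ≤ hsInner X X :=
  sum_nonneg fun _ _ => real_inner_self_nonneg

lemma hsInner_add_left (X X' Y : V →L[ℝ] V) :
    hsInner (X + X') Y = hsInner X Y + hsInner X' Y := by
  simp [hsInner, inner_add_left, sum_add_distrib]

lemma hsInner_add_right (X Y Y' : V →L[ℝ] V) :
    hsInner X (Y + Y') = hsInner X Y + hsInner X Y' := by
  simp [hsInner, inner_add_right, sum_add_distrib]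

lemma hsInner_smul_left (r : ℝ) (X Y : V →L[ℝ] V) : hsInner (r • X) Y = r * hsInner X Y := by
  simp [hsInner, inner_smul_left, mul_sum]

lemma hsInner_smul_right (r : ℝ) (X Y : V →L[ℝ] V) : hsInner X (r • Y) = r * hsInner X Y := by
  simp [hsInner, inner_smul_right, mul_sum]

/-- Infinitesimal form of the invariance of the Hilbert–Schmidt product under orthogonal
conjugation. -/
lemma hsInner_commutator (S : V →L[ℝ] V) (hS : ∀ x y, ⟪S x, y⟫ = -⟪x, S y⟫) (X Y : V →L[ℝ] V) :
    hsInner (S * X - X * S) Y + hsInner X (S * Y - Y * S) = 0 := by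
  have h := sum_apply_skew_eq_zero (stdOrthonormalBasis ℝ V) S hS
    (((innerₗ V).comp X.toLinearMap).compl₂ Y.toLinearMap)
  rw [hsInner, hsInner, ← sum_add_distrib, ← neg_eq_zero, ← h, ← sum_neg_distrib]
  refine sum_congr rfl fun a _ => ?_
  simp [inner_sub_left, inner_sub_right, hS]
  ring

lemma hasDerivAt_hsInner {f g : ℝ → V →L[ℝ] V} {f' g' : V →L[ℝ] V} {t : ℝ}
    (hf : HasDerivAt f f' t) (hg : HasDerivAt g g' t) :
    HasDerivAt (fun t => hsInner (f t) (g t)) (hsInner f' (g t) + hsInner (f t) g') t := by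
  unfold hsInner
  rw [← sum_add_distrib]
  refine HasDerivAt.fun_sum fun a _ => ?_
  have h1 := (hf.clm_apply (hasDerivAt_const t (stdOrthonormalBasis ℝ V a)))
  have h2 := (hg.clm_apply (hasDerivAt_const t (stdOrthonormalBasis ℝ V a)))
  have := h1.inner ℝ h2
  simp only [map_zero, add_zero] at this
  rw [add_comm]
  exact this

/-- The trace of a continuous endomorphism. -/
def traceCLM : (V →L[ℝ] V) →ₗ[ℝ] ℝ := (LinearMap.trace ℝ V).comp (ContinuousLinearMap.coeLM ℝ)

lemma traceCLM_mul_comm (X Y : V →L[ℝ] V) : traceCLM (X * Y) = traceCLM (Y * X) :=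
  LinearMap.trace_mul_comm ℝ (X : V →ₗ[ℝ] V) (Y : V →ₗ[ℝ] V)

lemma isNilpotent_of_traceCLM {c : V →L[ℝ] V} (h : ∀ k, traceCLM (c ^ (k + 1)) = 0) :
    IsNilpotent c := by
  have hpow : ∀ k, ((c ^ k : V →L[ℝ] V) : V →ₗ[ℝ] V) = (c : V →ₗ[ℝ] V) ^ k := fun k =>
    map_pow (ContinuousLinearMap.toLinearMapRingHom : (V →L[ℝ] V) →+* (V →ₗ[ℝ] V)) c k
  obtain ⟨n, hn⟩ := isNilpotent_of_trace_pow_eq_zero (c : V →ₗ[ℝ] V) fun k => by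
    rw [← hpow]; exact h k
  exact ⟨n, ContinuousLinearMap.coe_injective (by rw [hpow, hn]; rfl)⟩

lemma traceCLM_eq_zero_of_isNilpotent {c : V →L[ℝ] V} (h : IsNilpotent c) : traceCLM c = 0 := by
  have : IsNilpotent (c : V →ₗ[ℝ] V) :=
    h.map (ContinuousLinearMap.toLinearMapRingHom : (V →L[ℝ] V) →+* (V →ₗ[ℝ] V))
  exact (LinearMap.isNilpotent_trace_of_isNilpotent this).eq_zero

/-- The Riccati equation satisfied by the conullity operators `C u` of a homogeneous space: the
derivative of `C u` in the direction `v` is `-C u * C v`, and it is induced by skew-symmetric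
endomorphisms. -/
def IsRiccati (C : U →ₗ[ℝ] (V →L[ℝ] V)) : Prop :=
  ∀ v, ∃ (S : V →L[ℝ] V) (T : U →ₗ[ℝ] U), (∀ x y, ⟪S x, y⟫ = -⟪x, S y⟫) ∧
    (∀ x y, ⟪T x, y⟫ = -⟪x, T y⟫) ∧ ∀ u, S * C u - C u * S = C (T u) - C u * C v

variable {C : U →ₗ[ℝ] (V →L[ℝ] V)}

/-- The functional `tr ∘ C` is represented by a vector `w`, so it suffices that `tr (C w) = |w|²`
vanishes. The Riccati equation in direction `w` itself turns out to have no rotation term at `w`,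
which makes `C w` nilpotent. -/
lemma IsRiccati.traceCLM_eq_zero (hC : IsRiccati C) (u : U) : traceCLM (C u) = 0 := by
  set f : U →ₗ[ℝ] ℝ := traceCLM.comp C with hf
  set w : U := (InnerProductSpace.toDual ℝ U).symm (LinearMap.toContinuousLinearMap f) with hw
  have hwf : ∀ x, ⟪w, x⟫ = traceCLM (C x) := fun x => by
    rw [hw, InnerProductSpace.toDual_symm_apply]; rfl
  have htr : ∀ v (S : V →L[ℝ] V) (T : U →ₗ[ℝ] U) (x : U),
      S * C x - C x * S = C (T x) - C x * C v → ⟪w, T x⟫ = traceCLM (C x * C v) := by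
    intro v S T x h
    have := congrArg traceCLM h
    rw [map_sub, map_sub, traceCLM_mul_comm, sub_self] at this
    rw [hwf]; linarith
  obtain ⟨S, T, hS, hT, h⟩ := hC w
  -- `|T w|² = -⟪w, T (T w)⟫ = -tr (C (T w) * C w)`. By symmetry of the trace this is also `-⟪w, T'
  -- w⟫`, where `T'` belongs to the direction `T w`, and that vanishes by skewness.
  have hTw : T w = 0 := by
    rw [← inner_self_eq_zero (𝕜 := ℝ), hT, neg_eq_zero]
    have h1 : ⟪w, T (T w)⟫ = traceCLM (C (T w) * C w) := htr w S T _ (h _)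
    rw [h1, traceCLM_mul_comm]
    obtain ⟨S', T', -, hT', h'⟩ := hC (T w)
    rw [← htr _ S' T' w (h' w)]
    have := hT' w w
    rw [real_inner_comm] at this
    linarith
  have hcomm : S * C w - C w * S = -(C w * C w) := by rw [h, hTw, map_zero, zero_sub]
  -- `(C w)²` is a commutator of `C w` with `S`, and `C w ^ k` times such a commutator is traceless.
  have hpow : ∀ k, traceCLM (C w ^ (k + 2)) = 0 := by
    intro k
    have h1 : C w ^ (k + 2) = C w ^ k * (C w * S - S * C w) := by
      rw [← neg_sub, hcomm, neg_neg, pow_add, sq]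
    have h2 : traceCLM (C w ^ k * (S * C w)) = traceCLM (C w ^ k * (C w * S)) := by
      rw [← mul_assoc, traceCLM_mul_comm, ← mul_assoc, ← mul_assoc, ← pow_succ', ← pow_succ]
    rw [h1, mul_sub, map_sub, h2, sub_self]
  -- The trace of `C w` itself is still unknown, so the criterion is applied to the square, whose
  -- powers only involve exponents at least two.
  have hnil2 : IsNilpotent (C w ^ 2) := by
    refine isNilpotent_of_traceCLM fun k => ?_
    rw [← pow_mul]
    exact hpow (2 * k)
  have hnil : IsNilpotent (C w) := by
    obtain ⟨n, hn⟩ := hnil2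
    exact ⟨2 * n, by rw [pow_mul, hn]⟩
  have hw0 : w = 0 := by
    rw [← inner_self_eq_zero (𝕜 := ℝ), hwf, traceCLM_eq_zero_of_isNilpotent hnil]
  rw [← hwf, hw0, inner_zero_left]

lemma traceCLM_powDeriv_eq_zero {k : ℕ} (h : ∀ v, traceCLM (C v ^ k) = 0) (u v : U) :
    traceCLM (powDeriv (C v) (C u) k) = 0 := by
  have h1 := ((LinearMap.toContinuousLinearMap
    (traceCLM (V := V))).hasFDerivAt.comp_hasDerivAt (0 : ℝ)
      (hasDerivAt_pow_add_smul (C v) (C u) k))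
  have h2 : (⇑(LinearMap.toContinuousLinearMap (traceCLM (V := V))) ∘
      fun t : ℝ => (C v + t • C u) ^ k) = fun _ => 0 := by
    funext t
    simpa using h (v + t • u)
  rw [h2] at h1
  exact h1.unique (hasDerivAt_const _ _)

/-- The trace of `[S, (C v)^(k+1)]` is zero. Expanded by the Riccati equation it is a polarised
trace of order `k + 1`, zero by induction, minus `(k + 1) tr (C v)^(k+2)`. -/
lemma IsRiccati.traceCLM_pow (hC : IsRiccati C) (k : ℕ) (v : U) :
    traceCLM (C v ^ (k + 1)) = 0 := by
  induction k generalizing v with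
  | zero => simpa using hC.traceCLM_eq_zero v
  | succ k ih =>
    obtain ⟨S, T, -, -, h⟩ := hC v
    have h1 := congrArg traceCLM (commutator_pow S (C v) (k + 1))
    rw [map_sub, traceCLM_mul_comm, sub_self, h, powDeriv_sub, map_sub,
      traceCLM_powDeriv_eq_zero (fun v => ih v), powDeriv_sq, ← nsmul_eq_mul, map_nsmul,
      zero_sub, eq_comm, neg_eq_zero, smul_eq_zero] at h1
    exact h1.resolve_left (Nat.succ_ne_zero k)

lemma IsRiccati.isNilpotent (hC : IsRiccati C) (v : U) : IsNilpotent (C v) :=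
  isNilpotent_of_traceCLM fun k => hC.traceCLM_pow k v

variable (C) in
/-- The Taylor coefficient of order `n` of the squared norm of the family `C` along a geodesic of
the nullity with initial velocity `v`. -/
def normCoeff (n : ℕ) (v : U) : ℝ :=
  ∑ p ∈ antidiagonal n, ∑ i, hsInner (C (stdOrthonormalBasis ℝ U i) * C v ^ p.1)
    (C (stdOrthonormalBasis ℝ U i) * C v ^ p.2)

lemma normCoeff_deriv_eq_zero {n : ℕ} {r : ℝ} (h : ∀ v, normCoeff C n v = r) (u v : U) :
    ∑ p ∈ antidiagonal n, ∑ i,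
      (hsInner (C (stdOrthonormalBasis ℝ U i) * powDeriv (C v) (C u) p.1)
        (C (stdOrthonormalBasis ℝ U i) * C v ^ p.2) +
      hsInner (C (stdOrthonormalBasis ℝ U i) * C v ^ p.1)
        (C (stdOrthonormalBasis ℝ U i) * powDeriv (C v) (C u) p.2)) = 0 := by
  have h1 : HasDerivAt (fun t : ℝ => normCoeff C n (v + t • u)) (∑ p ∈ antidiagonal n, ∑ i,
      (hsInner (C (stdOrthonormalBasis ℝ U i) * powDeriv (C v) (C u) p.1)
        (C (stdOrthonormalBasis ℝ U i) * C v ^ p.2) +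
      hsInner (C (stdOrthonormalBasis ℝ U i) * C v ^ p.1)
        (C (stdOrthonormalBasis ℝ U i) * powDeriv (C v) (C u) p.2))) 0 := by
    unfold normCoeff
    refine HasDerivAt.fun_sum fun p _ => HasDerivAt.fun_sum fun i _ => ?_
    have hd := fun k => (hasDerivAt_pow_add_smul (C v) (C u) k).const_mul
      (C (stdOrthonormalBasis ℝ U i))
    have := hasDerivAt_hsInner (hd p.1) (hd p.2)
    simpa using this
  have h2 : (fun t : ℝ => normCoeff C n (v + t • u)) = fun _ => r := funext fun t => h _
  rw [h2] at h1
  exact h1.unique (hasDerivAt_const _ _)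

lemma IsRiccati.commutator_mul_pow {S : V →L[ℝ] V} {T : U →ₗ[ℝ] U} {v : U}
    (h : ∀ u, S * C u - C u * S = C (T u) - C u * C v) (u : U) (k : ℕ) :
    S * (C u * C v ^ k) - C u * C v ^ k * S = C (T u) * C v ^ k +
      C u * powDeriv (C v) (C (T v)) k + (-(k + 1 : ℝ)) • (C u * C v ^ (k + 1)) := by
  have h1 : S * (C u * C v ^ k) - C u * C v ^ k * S =
      (S * C u - C u * S) * C v ^ k + C u * (S * C v ^ k - C v ^ k * S) := by noncomm_ring
  rw [h1, commutator_pow, h u, h v, powDeriv_sub, powDeriv_sq, ← nsmul_eq_mul, sub_mul, mul_assoc,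
    ← pow_succ', mul_sub, mul_smul_comm, ← Nat.cast_smul_eq_nsmul ℝ]
  module

/-- The skew maps `S` and `T` preserve the contractions defining `normCoeff`. Applying them to the
coefficient of order `n` therefore leaves only its derivative at `v` in direction `T v`, zero by
constancy, and `n + 1` times the next coefficient. -/
lemma IsRiccati.normCoeff_succ (hC : IsRiccati C) {n : ℕ} {r : ℝ}
    (h : ∀ v, normCoeff C n v = r) (v : U) : normCoeff C (n + 1) v = 0 := by
  obtain ⟨S, T, hS, hT, hST⟩ := hC v
  set e := stdOrthonormalBasis ℝ U with he
  have key : ∀ p : ℕ × ℕ,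
      ∑ i, ((hsInner (C (e i) * powDeriv (C v) (C (T v)) p.1) (C (e i) * C v ^ p.2) +
        hsInner (C (e i) * C v ^ p.1) (C (e i) * powDeriv (C v) (C (T v)) p.2)) -
      (((p.1 : ℝ) + 1) * hsInner (C (e i) * C v ^ (p.1 + 1)) (C (e i) * C v ^ p.2) +
        ((p.2 : ℝ) + 1) * hsInner (C (e i) * C v ^ p.1) (C (e i) * C v ^ (p.2 + 1)))) = 0 := by
    intro p
    let B : U →ₗ[ℝ] U →ₗ[ℝ] ℝ := LinearMap.mk₂ ℝ
      (fun x y => hsInner (C x * C v ^ p.1) (C y * C v ^ p.2))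
      (fun x x' y => by rw [map_add, add_mul, hsInner_add_left])
      (fun r x y => by rw [map_smul, smul_mul_assoc, hsInner_smul_left, smul_eq_mul])
      (fun x y y' => by rw [map_add, add_mul, hsInner_add_right])
      (fun r x y => by rw [map_smul, smul_mul_assoc, hsInner_smul_right, smul_eq_mul])
    rw [← neg_zero, ← sum_apply_skew_eq_zero e T hT B, ← sub_eq_zero, sub_neg_eq_add,
      ← sum_add_distrib]
    refine sum_eq_zero fun i _ => ?_
    have h1 := hsInner_commutator S hS (C (e i) * C v ^ p.1) (C (e i) * C v ^ p.2)
    rw [IsRiccati.commutator_mul_pow hST, IsRiccati.commutator_mul_pow hST] at h1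
    simp only [hsInner_add_left, hsInner_add_right, hsInner_smul_left, hsInner_smul_right] at h1
    simp only [B, LinearMap.mk₂_apply]
    linarith
  have h0 := sum_eq_zero (s := antidiagonal n) fun p _ => key p
  simp only [sum_sub_distrib] at h0
  rw [normCoeff_deriv_eq_zero h (T v) v, zero_sub, neg_eq_zero] at h0
  -- Shifting either index carries the antidiagonal of `n` to that of `n + 1`. The weights become
  -- `p.1` and `p.2`, with sum `n + 1`; the added boundary terms have weight zero.
  have hcount : ∑ p ∈ antidiagonal n, ∑ i,
      (((p.1 : ℝ) + 1) * hsInner (C (e i) * C v ^ (p.1 + 1)) (C (e i) * C v ^ p.2) +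
        ((p.2 : ℝ) + 1) * hsInner (C (e i) * C v ^ p.1) (C (e i) * C v ^ (p.2 + 1))) =
      (n + 1 : ℝ) * normCoeff C (n + 1) v := by
    have hg : ∀ p : ℕ × ℕ, p ∈ antidiagonal (n + 1) →
        (n + 1 : ℝ) * ∑ i, hsInner (C (e i) * C v ^ p.1) (C (e i) * C v ^ p.2) =
        (p.1 : ℝ) * ∑ i, hsInner (C (e i) * C v ^ p.1) (C (e i) * C v ^ p.2) +
        (p.2 : ℝ) * ∑ i, hsInner (C (e i) * C v ^ p.1) (C (e i) * C v ^ p.2) := by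
      intro p hp
      have : (p.1 : ℝ) + p.2 = n + 1 := by exact_mod_cast HasAntidiagonal.mem_antidiagonal.1 hp
      rw [← add_mul, this]
    rw [normCoeff, mul_sum, sum_congr rfl hg, sum_add_distrib]
    rw [Nat.antidiagonal_succ, sum_cons, ← Nat.antidiagonal_succ, Nat.antidiagonal_succ', sum_cons]
    simp only [sum_map, Function.Embedding.prodMap, Function.Embedding.coeFn_mk, Prod.map,
      Function.Embedding.refl_apply, Nat.cast_zero, zero_mul, mul_sum]
    simp only [sum_const_zero, zero_add, ← sum_add_distrib, Nat.cast_succ, Nat.succ_eq_add_one]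
  rw [hcount, mul_eq_zero] at h0
  exact h0.resolve_left (by positivity)

/-- A family of endomorphisms satisfying the Riccati equation multiplies to zero. -/
theorem IsRiccati.mul_eq_zero (hC : IsRiccati C) (u v : U) : C u * C v = 0 := by
  have hcoeff : ∀ n v, normCoeff C (n + 1) v = 0 := by
    intro n
    induction n with
    | zero =>
      -- The order-zero coefficient is the squared norm of `C`. It need not vanish, but it is
      -- independent of `v`, which is all the recursion needs.
      refine hC.normCoeff_succ (r := normCoeff C 0 0) fun v => ?_
      simp [normCoeff]
    | succ n ih => exact hC.normCoeff_succ ih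
  set e := stdOrthonormalBasis ℝ U with he
  have hdesc : ∀ m, (∀ i, C (e i) * C v ^ (m + 1) = 0) → ∀ i, C (e i) * C v ^ 1 = 0 := by
    intro m
    induction m with
    | zero => exact fun h => h
    | succ m ih =>
      intro h
      refine ih fun i => eq_zero_of_hsInner_self ?_
      have hbig : ∀ k, m + 2 ≤ k → ∀ i, C (e i) * C v ^ k = 0 := by
        intro k hk i
        obtain ⟨l, rfl⟩ := Nat.exists_eq_add_of_le hk
        rw [pow_add, ← mul_assoc, h, zero_mul]
      have h1 := hcoeff (2 * m + 1) v
      -- In order `2m + 2` every off-diagonal term has an exponent at least `m + 2`, so the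
      -- vanishing coefficient reduces to a sum of squares.
      rw [normCoeff, sum_eq_single_of_mem (m + 1, m + 1)
        (HasAntidiagonal.mem_antidiagonal.2 (by ring))] at h1
      · exact (sum_eq_zero_iff_of_nonneg fun i _ => hsInner_self_nonneg _).1 h1 i (mem_univ i)
      · intro p hp hne
        refine sum_eq_zero fun i _ => ?_
        have hp' := HasAntidiagonal.mem_antidiagonal.1 hp
        rcases lt_trichotomy p.1 (m + 1) with hlt | heq | hgt
        · rw [hbig p.2 (by omega)]; simp [hsInner]
        · exact absurd (Prod.ext heq (by simp; omega)) hne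
        · rw [hbig p.1 (by omega)]; simp [hsInner]
  obtain ⟨n, hn⟩ := hC.isNilpotent v
  have h1 := hdesc n fun i => by rw [pow_succ, hn, zero_mul, mul_zero]
  have h2 : (LinearMap.mulRight ℝ (C v)).comp C = 0 :=
    e.toBasis.ext fun i => by simpa using h1 i
  exact LinearMap.congr_fun h2 u

end Riccati

/-! ### Killing fields at one point: the conullity operators and the ideal property. -/

section KillingModel

local notation "⟪" x "," y "⟫" => inner ℝ x y

/-- The infinitesimal model at a point of a homogeneous Riemannian manifold: the curvature tensor
`R` on the tangent space `V`, and a transitive Lie algebra `𝔤` of Killing fields, each given by its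
value `ev X` and its covariant derivative `A X`. -/
structure KillingModel (V 𝔤 : Type*) [NormedAddCommGroup V] [InnerProductSpace ℝ V]
    [AddCommGroup 𝔤] [Module ℝ 𝔤] where
  /-- the curvature tensor -/
  R : V → V → V → V
  /-- the value of a Killing field -/
  ev : 𝔤 →ₗ[ℝ] V
  /-- the covariant derivative of a Killing field -/
  A : 𝔤 →ₗ[ℝ] V →ₗ[ℝ] V
  /-- the Lie bracket -/
  br : 𝔤 → 𝔤 → 𝔤
  ev_surjective : Function.Surjective ev
  R_add (x y v w) : R x y (v + w) = R x y v + R x y w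
  R_smul (x y) (r : ℝ) (v) : R x y (r • v) = r • R x y v
  R_swap (x y v) : R x y v = -R y x v
  R_skew (x y v w) : ⟪R x y v, w⟫ = -⟪v, R x y w⟫
  R_bianchi (x y z) : R x y z + R y z x + R z x y = 0
  A_skew (X v w) : ⟪A X v, w⟫ = -⟪v, A X w⟫
  ev_br (X Y) : ev (br X Y) = A Y (ev X) - A X (ev Y)
  A_br (X Y v) : A (br X Y) v = R (ev X) (ev Y) v - A X (A Y v) + A Y (A X v)
  A_jacobi (X Y Z) : A (br (br X Y) Z) + A (br (br Y Z) X) + A (br (br Z X) Y) = 0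

namespace KillingModel

variable {V 𝔤 : Type*} [NormedAddCommGroup V] [InnerProductSpace ℝ V]
    [AddCommGroup 𝔤] [Module ℝ 𝔤] (K : KillingModel V 𝔤)

/-- The nullity. -/
def nul : Submodule ℝ V where
  carrier := {v | ∀ x y, K.R x y v = 0}
  zero_mem' x y := by simpa using K.R_smul x y 0 0
  add_mem' {v w} hv hw x y := by rw [K.R_add, hv, hw, add_zero]
  smul_mem' r v hv x y := by rw [K.R_smul, hv, smul_zero]

/-- The first osculating space of the nullity. -/
def osc : Submodule ℝ V := K.nul ⊔ Submodule.span ℝ {y | ∃ X, ∃ v ∈ K.nul, K.A X v = y}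

variable {K}

/-- The usual octahedron argument: four instances of the first Bianchi identity, combined by the two
skew symmetries. -/
lemma R_pair (x y z w : V) : ⟪K.R x y z, w⟫ = ⟪K.R z w x, y⟫ := by
  have b : ∀ x y z w, ⟪K.R x y z, w⟫ + ⟪K.R y z x, w⟫ + ⟪K.R z x y, w⟫ = 0 := fun x y z w => by
    rw [← inner_add_left, ← inner_add_left, K.R_bianchi, inner_zero_left]
  have s : ∀ x y z w, ⟪K.R x y z, w⟫ = -⟪K.R y x z, w⟫ := fun x y z w => by
    rw [K.R_swap, inner_neg_left]
  have t : ∀ x y z w, ⟪K.R x y z, w⟫ = -⟪K.R x y w, z⟫ := fun x y z w => by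
    rw [K.R_skew, real_inner_comm]
  linarith [b x y z w, b y z w x, b z w x y, b w x y z, s x y z w, t x y z w, s y z x w, t y z x w,
    s z x y w, t z x y w, s y z w x, t y z w x, s z w y x, t z w y x, s w y z x, t w y z x,
    s z w x y, t z w x y, s w x z y, t w x z y, s x z w y, t x z w y, s w x y z, t w x y z,
    s x y w z, t x y w z, s y w x z, t y w x z]

lemma R_nul_right {n : V} (hn : n ∈ K.nul) (x y : V) : K.R x n y = 0 := by
  refine ext_inner_right ℝ fun w => ?_
  rw [R_pair, K.R_skew, hn, inner_zero_right, neg_zero, inner_zero_left]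

lemma R_nul_left {n : V} (hn : n ∈ K.nul) (x y : V) : K.R n x y = 0 := by
  rw [K.R_swap, R_nul_right hn, neg_zero]

lemma A_mem_osc (X : 𝔤) {v : V} (hv : v ∈ K.nul) : K.A X v ∈ K.osc :=
  Submodule.mem_sup_right (Submodule.subset_span ⟨X, v, hv, rfl⟩)

lemma nul_le_osc : K.nul ≤ K.osc := le_sup_left

lemma forall_osc {B : V →ₗ[ℝ] V} (h0 : ∀ v ∈ K.nul, B v = 0)
    (h1 : ∀ X, ∀ v ∈ K.nul, B (K.A X v) = 0) : ∀ v ∈ K.osc, B v = 0 := by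
  have : K.osc ≤ LinearMap.ker B := by
    refine sup_le (fun v hv => h0 v hv) (Submodule.span_le.2 ?_)
    rintro _ ⟨X, v, hv, rfl⟩
    exact h1 X v hv
  exact fun v hv => this hv

/-- The second Bianchi identity, applied to the nullity. -/
lemma R_A_cyclic (X Y Z : 𝔤) {v : V} (hv : v ∈ K.nul) :
    K.R (K.ev X) (K.ev Y) (K.A Z v) + K.R (K.ev Y) (K.ev Z) (K.A X v) +
      K.R (K.ev Z) (K.ev X) (K.A Y v) = 0 := by
  have h := LinearMap.congr_fun (K.A_jacobi X Y Z) v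
  simp only [LinearMap.add_apply, K.A_br, LinearMap.zero_apply, hv _ _, map_sub, map_add,
    map_zero] at h
  rw [← neg_eq_zero, ← h]
  abel

/-- In the second Bianchi identity with `X` in the nullity, two of the three terms have a nullity
vector in one of the first two slots of `R`. -/
lemma A_mem_nul {X : 𝔤} (hX : K.ev X ∈ K.nul) {v : V} (hv : v ∈ K.nul) : K.A X v ∈ K.nul := by
  intro x y
  obtain ⟨Y, rfl⟩ := K.ev_surjective x
  obtain ⟨Z, rfl⟩ := K.ev_surjective y
  have := R_A_cyclic Y Z X hv
  rwa [R_nul_right hX, R_nul_left hX, add_zero, add_zero] at this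

section Conullity

variable [FiniteDimensional ℝ V]

variable (K) in
/-- A linear choice of Killing fields with prescribed values. -/
def lift : V →ₗ[ℝ] 𝔤 :=
  (K.ev.exists_rightInverse_of_surjective (LinearMap.range_eq_top.2 K.ev_surjective)).choose

@[simp] lemma ev_lift (v : V) : K.ev (K.lift v) = v :=
  LinearMap.congr_fun (K.ev.exists_rightInverse_of_surjective
    (LinearMap.range_eq_top.2 K.ev_surjective)).choose_spec v

variable (K) in
/-- The conullity operators `w ↦ (D_w v)^⊥`. -/
def conullity : K.nul →ₗ[ℝ] (V →L[ℝ] V) :=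
  LinearMap.toContinuousLinearMap.toLinearMap ∘ₗ
    ((K.A ∘ₗ K.lift).flip.compr₂ (K.nulᗮ.starProjection : V →ₗ[ℝ] V)).domRestrict K.nul

lemma conullity_apply (u : K.nul) (w : V) :
    K.conullity u w = K.nulᗮ.starProjection (K.A (K.lift w) u) := rfl

lemma starProjection_eq_zero {v : V} : K.nulᗮ.starProjection v = 0 ↔ v ∈ K.nul := by
  rw [Submodule.starProjection_apply_eq_zero_iff, Submodule.orthogonal_orthogonal]

lemma sub_starProjection_mem (v : V) : v - K.nulᗮ.starProjection v ∈ K.nul := by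
  rw [← starProjection_eq_zero, map_sub, sub_eq_zero, eq_comm,
    Submodule.starProjection_eq_self_iff]
  exact Submodule.starProjection_apply_mem _ v

/-- The choice made by `lift` is immaterial: two fields with the same value differ by one with value
zero, which maps the nullity to itself by `A_mem_nul`. -/
lemma conullity_ev (u : K.nul) (X : 𝔤) :
    K.conullity u (K.ev X) = K.nulᗮ.starProjection (K.A X u) := by
  rw [conullity_apply, ← sub_eq_zero, ← map_sub, starProjection_eq_zero, ← LinearMap.sub_apply,
    ← map_sub]
  exact A_mem_nul (by simp) u.2

lemma conullity_nul (u : K.nul) {n : V} (hn : n ∈ K.nul) : K.conullity u n = 0 := by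
  rw [conullity_apply, starProjection_eq_zero]
  exact A_mem_nul (by simpa using hn) u.2

lemma conullity_starProjection (u : K.nul) (w : V) :
    K.conullity u (K.nulᗮ.starProjection w) = K.conullity u w := by
  rw [← sub_eq_zero, ← map_sub, ← neg_sub, map_neg, conullity_nul u (sub_starProjection_mem w),
    neg_zero]

/-- Since `A X` is skew and preserves the nullity, it preserves the orthogonal complement too, hence
commutes with the projection. -/
lemma starProjection_A {X : 𝔤} (hX : K.ev X ∈ K.nul) (w : V) :
    K.nulᗮ.starProjection (K.A X w) = K.A X (K.nulᗮ.starProjection w) := by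
  have h1 : K.A X (K.nulᗮ.starProjection w) ∈ K.nulᗮ := by
    intro n hn
    rw [real_inner_comm, K.A_skew, neg_eq_zero]
    exact (Submodule.mem_orthogonal' _ _).1 (Submodule.starProjection_apply_mem _ w) _
      (A_mem_nul hX hn)
  rw [← Submodule.starProjection_eq_self_iff.2 h1, ← sub_eq_zero, ← map_sub, ← map_sub,
    starProjection_eq_zero]
  exact A_mem_nul hX (sub_starProjection_mem w)

/-- For a field `S` with value `v`, the skew maps are `A S` and its restriction to the nullity. The
equation is the formula for `A` of the bracket of `S` with a field `W`, projected to the complement;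
its curvature term vanishes because `v` is a nullity vector. -/
lemma isRiccati_conullity : IsRiccati K.conullity := by
  intro v
  set S := K.lift v with hS
  have hSv : K.ev S ∈ K.nul := by rw [hS, ev_lift]; exact v.2
  refine ⟨LinearMap.toContinuousLinearMap (K.A S),
    (K.A S).restrict fun n hn => A_mem_nul hSv hn, K.A_skew S, fun x y => K.A_skew S x y,
    fun u => ?_⟩
  ext w
  set W := K.lift w with hW
  have h1 := conullity_ev u (K.br S W)
  rw [K.ev_br, K.A_br, R_nul_left hSv, map_sub, map_add, map_sub, map_zero, hS, ev_lift, hW,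
    ev_lift] at h1
  rw [← hS, starProjection_A hSv] at h1
  have h2 : K.conullity u (K.A (K.lift w) v) = K.conullity u (K.conullity v w) := by
    rw [conullity_apply v, conullity_starProjection]
  rw [h2] at h1
  have h3 : K.conullity ((K.A S).restrict (fun n hn => A_mem_nul hSv hn) u) w =
    K.nulᗮ.starProjection (K.A (K.lift w) (K.A S u)) := rfl
  simp only [sub_apply, mul_apply_eq_comp, h3,
    LinearMap.coe_toContinuousLinearMap']
  rw [conullity_apply u w]
  rw [zero_sub] at h1
  rw [← sub_eq_zero] at h1 ⊢
  rw [← h1]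
  abel

/-- This is `C_u C_v = 0` in terms of Killing fields: `X` has value `A W v`, and modulo the nullity
`A X u` is `C_u` applied to that value. -/
lemma A_mem_nul_of_ev_eq {u v : V} (hu : u ∈ K.nul) (hv : v ∈ K.nul) {W X : 𝔤}
    (h : K.ev X = K.A W v) : K.A X u ∈ K.nul := by
  have h1 := isRiccati_conullity.mul_eq_zero (⟨u, hu⟩ : K.nul) ⟨v, hv⟩
  rw [← starProjection_eq_zero]
  have h2 := conullity_ev ⟨u, hu⟩ X
  rw [h, ← conullity_starProjection] at h2
  have h3 := conullity_ev ⟨v, hv⟩ W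
  simp only at h2 h3
  rw [← h2, ← h3]
  exact congrArg (fun f : V →L[ℝ] V => f (K.ev W)) h1

/-- The Killing fields whose covariant derivative vanishes on the first osculating space of the
nullity form an ideal. -/
theorem br_mem_of_A_osc {Z : 𝔤} (hZ : ∀ v ∈ K.osc, K.A Z v = 0) (X : 𝔤) :
    ∀ v ∈ K.osc, K.A (K.br X Z) v = 0 := by
  -- Second Bianchi identity with `A Z v = 0`: the term carrying `A Z` drops out.
  have hsymm : ∀ X W v, v ∈ K.nul →
      K.R (K.ev X) (K.ev Z) (K.A W v) = K.R (K.ev W) (K.ev Z) (K.A X v) := by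
    intro X W v hv
    have h := R_A_cyclic X W Z hv
    rw [hZ v (nul_le_osc hv), (by simpa using K.R_smul (K.ev X) (K.ev W) 0 0 :
      K.R (K.ev X) (K.ev W) 0 = 0), zero_add, K.R_swap (K.ev Z), ← sub_eq_add_neg,
      sub_eq_zero] at h
    exact h.symm
  have hnul : ∀ X v, v ∈ K.nul → K.A (K.br X Z) v = 0 := by
    intro X v hv
    rw [K.A_br, hv, hZ v (nul_le_osc hv), hZ _ (A_mem_osc X hv), map_zero, sub_zero, add_zero]
  refine forall_osc (hnul X) fun W v hv => ?_
  set T := K.A (K.br X Z) (K.A W v) with hT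
  have hT1 : T = K.R (K.ev X) (K.ev Z) (K.A W v) + K.A Z (K.A X (K.A W v)) := by
    rw [hT, K.A_br, hZ _ (A_mem_osc W hv), map_zero, sub_zero]
  -- Since `v` and `A (br X Z) v` contribute nothing, `T` is the image of `v` under `A (br W (br X
  -- Z))`.
  have hT2 : T ∈ K.osc := by
    have h := K.A_br W (K.br X Z) v
    rw [hv, hnul X v hv, map_zero, sub_zero, zero_add] at h
    rw [hT, ← h]
    exact A_mem_osc _ hv
  -- The `A Z` part of `T` is moved onto `A Y u` and dies. For the curvature part, `hsymm` trades `A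
  -- Y u` for `A X₁ u` with `X₁` of value `A W v`, which is in the nullity by the Riccati result.
  -- First Bianchi then gives `R (A W v) (A Y u) Z = 0`, and pair symmetry concludes.
  have hT3 : ∀ Y u, u ∈ K.nul → ⟪T, K.A Y u⟫ = 0 := by
    intro Y u hu
    obtain ⟨X₁, h₁⟩ := K.ev_surjective (K.A W v)
    obtain ⟨X₂, h₂⟩ := K.ev_surjective (K.A Y u)
    have e1 : K.R (K.ev X₁) (K.ev Z) (K.A Y u) = 0 := by
      rw [hsymm _ _ _ hu]
      exact A_mem_nul_of_ev_eq hu hv h₁ _ _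
    have e2 : K.R (K.ev X₂) (K.ev Z) (K.A W v) = 0 := by
      rw [hsymm _ _ _ hv]
      exact A_mem_nul_of_ev_eq hv hu h₂ _ _
    rw [hT1, inner_add_left, K.A_skew Z, hZ _ (A_mem_osc Y hu), inner_zero_right, neg_zero,
      add_zero]
    rw [h₁] at e1
    rw [h₂] at e2
    have e3 := K.R_bianchi (K.A W v) (K.A Y u) (K.ev Z)
    rw [e2, K.R_swap (K.ev Z), e1, neg_zero, add_zero, add_zero] at e3
    rw [R_pair, K.R_skew, e3, inner_zero_right, neg_zero]
  have hmem : K.osc ≤ (Submodule.span ℝ {T})ᗮ := by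
    refine sup_le (fun n hn => ?_) (Submodule.span_le.2 ?_)
    · rw [Submodule.mem_orthogonal_singleton_iff_inner_right, hT, K.A_skew, hnul X n hn,
        inner_zero_right, neg_zero]
    · rintro _ ⟨Y, u, hu, rfl⟩
      exact Submodule.mem_orthogonal_singleton_iff_inner_right.2 (hT3 Y u hu)
  exact inner_self_eq_zero.1 (Submodule.mem_orthogonal_singleton_iff_inner_right.1 (hmem hT2))

/-- A transvection in the direction of the first osculating space of the nullity commutes, up to
first order, with the ideal of `br_mem_of_A_osc`. -/
theorem br_transvection {X Z : 𝔤} (hX : K.A X = 0) (hXo : K.ev X ∈ K.osc)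
    (hZ : ∀ v ∈ K.osc, K.A Z v = 0) : K.ev (K.br X Z) = 0 ∧ K.A (K.br X Z) = 0 := by
  set E := K.br X Z with hE
  have hev : K.ev E = 0 := by
    rw [hE, K.ev_br, hZ _ hXo, hX, LinearMap.zero_apply, sub_zero]
  have hAE : ∀ w, K.A E w = K.R (K.ev X) (K.ev Z) w := fun w => by
    rw [hE, K.A_br, hX]; simp
  have hEo := br_mem_of_A_osc hZ X
  refine ⟨hev, ?_⟩
  -- The field `br Y E` has value `A E y`. Bracketing it with `Z` and evaluating `A` on the value of
  -- `X` gives zero by the ideal property, and only the curvature term survives.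
  have hR : ∀ y, K.R (K.A E y) (K.ev Z) (K.ev X) = 0 := by
    intro y
    obtain ⟨Y, rfl⟩ := K.ev_surjective y
    have h1 : K.ev (K.br Y E) = K.A E (K.ev Y) := by rw [K.ev_br, hev, map_zero, sub_zero]
    have h2 := br_mem_of_A_osc hZ (K.br Y E) _ hXo
    rw [K.A_br, h1, hZ _ hXo, map_zero, sub_zero, br_mem_of_A_osc hEo Y _ hXo, map_zero,
      add_zero] at h2
    exact h2
  -- First Bianchi for the values of `X`, `Z` and the vector `A E y`, paired with `A E y'`; the two
  -- other terms vanish by `hR`, one of them after pair symmetry. The choice `y' = A E y` then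
  -- yields `A E ∘ A E = 0`.
  have hskew : ∀ y y', ⟪K.A E (K.A E y), K.A E y'⟫ = 0 := by
    intro y y'
    have h1 := congrArg (fun a => ⟪a, K.A E y'⟫) (K.R_bianchi (K.ev X) (K.ev Z) (K.A E y))
    simp only [inner_add_left, inner_zero_left] at h1
    have h2 : ⟪K.R (K.A E y) (K.ev X) (K.ev Z), K.A E y'⟫ = 0 := by
      rw [R_pair, K.R_skew, K.R_swap, hR, neg_zero, inner_zero_right, neg_zero]
    rw [K.R_swap (K.ev Z), hR, neg_zero, inner_zero_left, h2, add_zero, add_zero, ← hAE] at h1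
    exact h1
  have hsq : ∀ y, K.A E (K.A E y) = 0 := fun y => by
    rw [← inner_self_eq_zero (𝕜 := ℝ)]; exact hskew y _
  ext y
  rw [LinearMap.zero_apply, ← inner_self_eq_zero (𝕜 := ℝ), K.A_skew, hsq, inner_zero_right,
    neg_zero]

end Conullity

end KillingModel

end KillingModel

/-! ### Images of maps of deficient constant rank. -/

section ConstantRank

open Set Topology Module

variable {F E : Type*} [NormedAddCommGroup F] [NormedSpace ℝ F] [FiniteDimensional ℝ F]
  [NormedAddCommGroup E] [NormedSpace ℝ E] [FiniteDimensional ℝ E]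

/-- A map of constant rank smaller than the dimension of the target is locally not dense. -/
theorem exists_dense_compl_image_of_finrank_range_le {f : F → E} {U : Set F} (hU : IsOpen U)
    {s₀ : F} (hs₀ : s₀ ∈ U) (hf : ContDiffOn ℝ 1 f U)
    (hr : ∀ s ∈ U, finrank ℝ (fderiv ℝ f s).range ≤ finrank ℝ (fderiv ℝ f s₀).range)
    (hlt : finrank ℝ (fderiv ℝ f s₀).range < finrank ℝ E) :
    ∃ V ∈ 𝓝 s₀, Dense (f '' V)ᶜ := by
  have : CompleteSpace F := FiniteDimensional.complete ℝ F
  set L := fderiv ℝ f s₀ with hL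
  set R : Submodule ℝ E := L.range with hR
  obtain ⟨pr, hpr⟩ : ∃ pr : E →L[ℝ] R, ∀ x : R, pr x = x :=
    Submodule.ClosedComplemented.of_finiteDimensional R
  set T : F →L[ℝ] R := pr.comp L with hT
  have hTsurj : T.range = ⊤ := by
    rw [LinearMap.range_eq_top]
    rintro ⟨y, x, rfl⟩
    exact ⟨x, hpr ⟨L x, x, rfl⟩⟩
  obtain ⟨q, hq⟩ : ∃ q : F →L[ℝ] T.ker, ∀ x : T.ker, q x = x :=
    Submodule.ClosedComplemented.of_finiteDimensional T.ker
  have hqsurj : q.range = ⊤ := by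
    rw [LinearMap.range_eq_top]
    exact fun x => ⟨x, hq x⟩
  set e : F ≃L[ℝ] R × T.ker := T.equivProdOfSurjectiveOfIsCompl q hTsurj hqsurj
    (LinearMap.isCompl_of_proj (f := (q : F →ₗ[ℝ] T.ker)) hq) with he
  -- Coordinates adapted to `f` at `s₀`: its component along the range of the differential,
  -- completed by a kernel coordinate.
  set Φ : F → R × T.ker := fun s => (pr (f s), q s) with hΦ
  have hfd : ∀ s ∈ U, HasFDerivAt f (fderiv ℝ f s) s := fun s hs =>
    ((hf.contDiffAt (hU.mem_nhds hs)).differentiableAt one_ne_zero).hasFDerivAt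
  have hΦd : HasFDerivAt Φ (e : F →L[ℝ] R × T.ker) s₀ :=
    ((pr.hasFDerivAt.comp s₀ (hfd s₀ hs₀)).prodMk q.hasFDerivAt).congr_fderiv (by ext x <;> rfl)
  have hΦc : ContDiffAt ℝ 1 Φ s₀ :=
    (pr.contDiff.contDiffAt.comp s₀ (hf.contDiffAt (hU.mem_nhds hs₀))).prodMk
      q.contDiff.contDiffAt
  set H := hΦc.toOpenPartialHomeomorph Φ hΦd one_ne_zero with hH
  have hHc : ∀ s, H s = Φ s := fun s => rfl
  have hs₀H : s₀ ∈ H.source := hΦc.mem_toOpenPartialHomeomorph_source hΦd one_ne_zero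
  have hψc : ContDiffAt ℝ 1 H.symm (Φ s₀) := hΦc.to_localInverse hΦd one_ne_zero
  have hψ0 : H.symm (Φ s₀) = s₀ := H.left_inv hs₀H
  have hev : ∀ᶠ y in 𝓝 (Φ s₀), ContDiffAt ℝ 1 H.symm y ∧ H.symm y ∈ U ∧ y ∈ H.target := by
    refine (hψc.eventually (by simp)).and (Filter.Eventually.and ?_ ?_)
    · exact hψc.continuousAt.preimage_mem_nhds (by rw [hψ0]; exact hU.mem_nhds hs₀)
    · exact H.open_target.mem_nhds (H.map_source hs₀H)
  obtain ⟨ε, hε, hball⟩ := Metric.eventually_nhds_iff_ball.1 hev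
  have hprod : ∀ r ∈ Metric.ball (Φ s₀).1 ε, ∀ k ∈ Metric.ball (Φ s₀).2 ε,
      (r, k) ∈ Metric.ball (Φ s₀) ε := fun r hr k hk => by
    rw [← ball_prod_same]; exact ⟨hr, hk⟩
  have hgc : ∀ y ∈ Metric.ball (Φ s₀) ε, ContDiffAt ℝ 1 (f ∘ H.symm) y := fun y hy =>
    (hf.contDiffAt (hU.mem_nhds (hball y hy).2.1)).comp y (hball y hy).1
  have hprg : ∀ y ∈ H.target, Φ (H.symm y) = y := fun y hy => H.right_inv hy
  -- In these coordinates `pr ∘ f` is the first projection, so the rank at nearby points is at least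
  -- that at `s₀`. The upper bound `hr` makes it equal, hence `pr` is injective on the range of the
  -- differential there, and it kills the kernel directions.
  have hzero : ∀ y ∈ Metric.ball (Φ s₀) ε, ∀ k, fderiv ℝ (f ∘ H.symm) y (0, k) = 0 := by
    intro y hy k
    set g' := fderiv ℝ (f ∘ H.symm) y with hg'
    have hgd : HasFDerivAt (f ∘ H.symm) g' y :=
      ((hgc y hy).differentiableAt one_ne_zero).hasFDerivAt
    have hfst : ∀ z, pr (g' z) = z.1 := by
      have h1 : HasFDerivAt (fun y => pr ((f ∘ H.symm) y)) (pr.comp g') y :=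
        pr.hasFDerivAt.comp y hgd
      have h2 : HasFDerivAt (fun y => pr ((f ∘ H.symm) y)) (ContinuousLinearMap.fst ℝ R T.ker) y :=
        hasFDerivAt_fst.congr_of_eventuallyEq (by
          filter_upwards [H.open_target.mem_nhds (hball y hy).2.2] with y' hy'
          exact congrArg Prod.fst (hprg y' hy'))
      exact fun z => congrArg (fun l : R × T.ker →L[ℝ] R => l z) (h1.unique h2)
    set L' := fderiv ℝ f (H.symm y) with hL'
    have hcomp : g' = L'.comp (fderiv ℝ H.symm y) :=
      hgd.unique ((hfd _ (hball y hy).2.1).comp y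
        ((hball y hy).1.differentiableAt one_ne_zero).hasFDerivAt)
    have hmem : ∀ z, g' z ∈ L'.range := fun z => by rw [hcomp]; exact ⟨_, rfl⟩
    let p : L'.range →ₗ[ℝ] R := (pr : E →ₗ[ℝ] R).domRestrict L'.range
    have hpsurj : Function.Surjective p := fun r => ⟨⟨g' (r, 0), hmem _⟩, hfst (r, 0)⟩
    have hfin : finrank ℝ L'.range = finrank ℝ R :=
      le_antisymm (hr _ (hball y hy).2.1) (LinearMap.finrank_le_finrank_of_surjective hpsurj)
    have hinj : Function.Injective p :=
      (LinearMap.injective_iff_surjective_of_finrank_eq_finrank hfin).2 hpsurj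
    have : (⟨g' (0, k), hmem _⟩ : L'.range) = 0 := hinj (by
      rw [map_zero]; exact hfst (0, k))
    exact congrArg Subtype.val this
  have hconst : ∀ r ∈ Metric.ball (Φ s₀).1 ε, ∀ k ∈ Metric.ball (Φ s₀).2 ε,
      f (H.symm (r, k)) = f (H.symm (r, (Φ s₀).2)) := by
    intro r hr' k hk
    have hd : ∀ k ∈ Metric.ball (Φ s₀).2 ε,
        HasFDerivAt (fun k => (f ∘ H.symm) (r, k)) (0 : T.ker →L[ℝ] E) k := by
      intro k hk
      have h1 := ((hgc _ (hprod r hr' k hk)).differentiableAt one_ne_zero).hasFDerivAt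
      have h2 := h1.comp k (hasFDerivAt_prodMk_right r k)
      refine h2.congr_fderiv ?_
      ext k'
      exact hzero _ (hprod r hr' k hk) k'
    exact (convex_ball (Φ s₀).2 ε).is_const_of_fderivWithin_eq_zero (𝕜 := ℝ)
      (f := fun k : T.ker => (f ∘ H.symm) (r, k))
      (fun k hk => (hd k hk).differentiableAt.differentiableWithinAt)
      (fun k hk => ((hd k hk).hasFDerivWithinAt).fderivWithin
        (Metric.isOpen_ball.uniqueDiffWithinAt hk)) hk (Metric.mem_ball_self hε)
  refine ⟨H.source ∩ H ⁻¹' (Metric.ball (Φ s₀) ε), Filter.inter_mem (H.open_source.mem_nhds hs₀H)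
    ((H.continuousAt hs₀H).preimage_mem_nhds (Metric.ball_mem_nhds _ hε)), ?_⟩
  have hsub : f '' (H.source ∩ H ⁻¹' (Metric.ball (Φ s₀) ε)) ⊆
      (fun r => (f ∘ H.symm) (r, (Φ s₀).2)) '' Metric.ball (Φ s₀).1 ε := by
    rintro _ ⟨s, ⟨hs, hsb⟩, rfl⟩
    rw [mem_preimage, ← ball_prod_same] at hsb
    refine ⟨(H s).1, hsb.1, ?_⟩
    have := hconst (H s).1 hsb.1 (H s).2 hsb.2
    rw [Prod.mk.eta, H.left_inv hs] at this
    exact this.symm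
  refine Dense.mono (compl_subset_compl.2 hsub) ?_
  have hcd : ContDiffOn ℝ 1 (fun r => (f ∘ H.symm) (r, (Φ s₀).2)) (Metric.ball (Φ s₀).1 ε) := by
    intro r hr'
    exact ((hgc _ (hprod r hr' _ (Metric.mem_ball_self hε))).comp r
      (contDiff_prodMk_left _).contDiffAt).contDiffWithinAt
  -- The local image is a `C¹` image of a ball in `R`, whose Hausdorff dimension is below that of
  -- the target.
  refine hcd.dense_compl_image_of_dimH_lt_finrank (convex_ball _ _) Subset.rfl ?_
  calc dimH (Metric.ball (Φ s₀).1 ε) ≤ dimH (univ : Set R) := dimH_mono (subset_univ _)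
    _ = finrank ℝ R := Real.dimH_univ_eq_finrank R
    _ < finrank ℝ E := by exact_mod_cast hlt

end ConstantRank

/-! ### Orbit maps of a transitive action are submersions. -/

section Orbit

open Set Topology Module

variable {E : Type*} [NormedAddCommGroup E] [NormedSpace ℝ E]
  {M : Type*} [TopologicalSpace M] [ChartedSpace E M] [IsManifold 𝓘(ℝ, E) ∞ M]
  {F : Type*} [NormedAddCommGroup F] [NormedSpace ℝ F]
  {G : Type*} [TopologicalSpace G] [ChartedSpace F G] [Group G] [LieGroup 𝓘(ℝ, F) ∞ G]
  [MulAction G M] [ContMDiffSMul 𝓘(ℝ, F) 𝓘(ℝ, E) ∞ G M]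

lemma contMDiff_smul_left {E : Type*} [NormedAddCommGroup E] [NormedSpace ℝ E]
    {M : Type*} [TopologicalSpace M] [ChartedSpace E M] (F : Type*) [NormedAddCommGroup F]
    [NormedSpace ℝ F] {G : Type*} [TopologicalSpace G] [ChartedSpace F G] [Group G] [MulAction G M]
    [ContMDiffSMul 𝓘(ℝ, F) 𝓘(ℝ, E) ∞ G M] (g : G) :
    ContMDiff 𝓘(ℝ, E) 𝓘(ℝ, E) ∞ (fun x : M => g • x) :=
  ContMDiffSMul.contMDiff_const_smul (I := 𝓘(ℝ, F)) g

lemma contMDiff_orbit (p : M) : ContMDiff 𝓘(ℝ, F) 𝓘(ℝ, E) ∞ (fun g : G => g • p) :=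
  contMDiff_id.smul contMDiff_const

lemma _root_.HasFDerivWithinAt.apply_eq_fderiv {E F : Type*} [NormedAddCommGroup E]
    [NormedSpace ℝ E] [NormedAddCommGroup F] [NormedSpace ℝ F] {f : F → E} {L : F →L[ℝ] E}
    {s : Set F} {x : F} (h : HasFDerivWithinAt f L s x) (hs : s ∈ 𝓝 x) (u : F) :
    L u = fderiv ℝ f x u := by
  rw [(h.hasFDerivAt hs).fderiv]

/-- A map between manifolds without boundary, read in charts, is smooth. -/
lemma contDiffAt_extChartAt_comp {E E' M M' : Type*} [NormedAddCommGroup E] [NormedSpace ℝ E]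
    [TopologicalSpace M] [ChartedSpace E M] [IsManifold 𝓘(ℝ, E) ∞ M] [NormedAddCommGroup E']
    [NormedSpace ℝ E'] [TopologicalSpace M'] [ChartedSpace E' M'] [IsManifold 𝓘(ℝ, E') ∞ M']
    {f : M → M'} (hf : ContMDiff 𝓘(ℝ, E) 𝓘(ℝ, E') ∞ f) {x : M} {p : M'}
    {s : E} (hs : s ∈ (extChartAt 𝓘(ℝ, E) x).target)
    (hp : f ((extChartAt 𝓘(ℝ, E) x).symm s) ∈ (extChartAt 𝓘(ℝ, E') p).source) :
    ContDiffAt ℝ ∞ (fun s => extChartAt 𝓘(ℝ, E') p (f ((extChartAt 𝓘(ℝ, E) x).symm s))) s := by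
  rw [← contMDiffAt_iff_contDiffAt]
  have h1 : ContMDiffAt 𝓘(ℝ, E) 𝓘(ℝ, E) ∞ (extChartAt 𝓘(ℝ, E) x).symm s :=
    (contMDiffOn_extChartAt_symm x).contMDiffAt ((isOpen_extChartAt_target x).mem_nhds hs)
  exact ((contMDiffAt_extChartAt' (by simpa using hp)).comp _ hf.contMDiffAt).comp s h1

variable (E F G) in
/-- The orbit map of `p`, read in the charts at `1` and `p`. -/
def orbitInCharts (p : M) (s : F) : E :=
  extChartAt 𝓘(ℝ, E) p ((extChartAt 𝓘(ℝ, F) (1 : G)).symm s • p)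

variable (E F G) in
/-- The domain of `orbitInCharts`. -/
def orbitDomain (p : M) : Set F :=
  (extChartAt 𝓘(ℝ, F) (1 : G)).target ∩
    (extChartAt 𝓘(ℝ, F) (1 : G)).symm ⁻¹' {g | g • p ∈ (extChartAt 𝓘(ℝ, E) p).source}

lemma isOpen_orbitDomain (p : M) : IsOpen (orbitDomain E F G p) :=
  (continuousOn_extChartAt_symm (1 : G)).isOpen_inter_preimage (isOpen_extChartAt_target _)
    ((isOpen_extChartAt_source p).preimage (contMDiff_orbit (F := F) (E := E) p).continuous)

lemma mem_orbitDomain (p : M) : extChartAt 𝓘(ℝ, F) (1 : G) 1 ∈ orbitDomain E F G p :=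
  ⟨mem_extChartAt_target _, by
    rw [mem_preimage, extChartAt_to_inv]
    simp only [mem_ofPred_eq, one_smul]
    exact mem_extChartAt_source p⟩

lemma contDiffAt_orbitInCharts {p : M} {s : F} (hs : s ∈ orbitDomain E F G p) :
    ContDiffAt ℝ ∞ (orbitInCharts E F G p) s :=
  contDiffAt_extChartAt_comp (contMDiff_orbit p) hs.1 hs.2

lemma orbitInCharts_one (p : M) :
    orbitInCharts E F G p (extChartAt 𝓘(ℝ, F) (1 : G) 1) = extChartAt 𝓘(ℝ, E) p p := by
  rw [orbitInCharts, extChartAt_to_inv, one_smul]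

lemma inducedField_eq_fderiv (u : GroupLieAlgebra 𝓘(ℝ, F) G) (p : M) :
    (inducedField u p : E) =
      fderiv ℝ (orbitInCharts E F G p) (extChartAt 𝓘(ℝ, F) (1 : G) 1) u := by
  have h : MDifferentiableAt 𝓘(ℝ, F) 𝓘(ℝ, E) (fun g : G => g • p) 1 :=
    (contMDiff_orbit p).mdifferentiableAt (by simp)
  have h2 : writtenInExtChartAt 𝓘(ℝ, F) 𝓘(ℝ, E) 1 (fun g : G => g • p) =
      orbitInCharts E F G p := by
    funext s
    simp only [writtenInExtChartAt, one_smul, orbitInCharts, Function.comp_apply]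
  have h3 : HasFDerivWithinAt (orbitInCharts E F G p)
      (mfderiv 𝓘(ℝ, F) 𝓘(ℝ, E) (fun g : G => g • p) 1 : F →L[ℝ] E) (range 𝓘(ℝ, F))
      (extChartAt 𝓘(ℝ, F) (1 : G) 1) := h2 ▸ h.hasMFDerivAt.2
  exact h3.apply_eq_fderiv (by simp) u

variable [FiniteDimensional ℝ E] [FiniteDimensional ℝ F]

/-- By equivariance the orbit map near `g` is translation by `g⁻¹`, then the orbit map near `1`,
then the action of `g`, so its rank at `g` cannot exceed that at `1`. -/
lemma finrank_range_fderiv_orbitInCharts_le (p : M) {s : F} (hs : s ∈ orbitDomain E F G p) :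
    finrank ℝ (fderiv ℝ (orbitInCharts E F G p) s).range ≤
      finrank ℝ (fderiv ℝ (orbitInCharts E F G p) (extChartAt 𝓘(ℝ, F) (1 : G) 1)).range := by
  have : ContinuousMul G := (topologicalGroup_of_lieGroup 𝓘(ℝ, F) (G := G) ∞).toContinuousMul
  set g := (extChartAt 𝓘(ℝ, F) (1 : G)).symm s with hg
  set φ := extChartAt 𝓘(ℝ, F) (1 : G) with hφ
  set χ := extChartAt 𝓘(ℝ, E) p with hχ
  set A : E → E := fun x => χ (g • χ.symm x) with hA
  set C : F → F := fun s' => φ (g⁻¹ * φ.symm s') with hC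
  have hCs : C s = φ 1 := by simp [hC, ← hg]
  have hCd : DifferentiableAt ℝ C s :=
    (contDiffAt_extChartAt_comp (contMDiff_mul_left (I := 𝓘(ℝ, F)) (n := ∞) (a := g⁻¹)) hs.1
      (by rw [← hg, inv_mul_cancel]; exact mem_extChartAt_source _)).differentiableAt (by simp)
  have hAd : DifferentiableAt ℝ A (χ p) :=
    (contDiffAt_extChartAt_comp (contMDiff_smul_left F g) (mem_extChartAt_target p)
      (by rw [extChartAt_to_inv]; exact hs.2)).differentiableAt (by simp)
  have hfd : DifferentiableAt ℝ (orbitInCharts E F G p) (φ 1) :=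
    (contDiffAt_orbitInCharts (mem_orbitDomain p)).differentiableAt (by simp)
  have hev : orbitInCharts E F G p =ᶠ[𝓝 s] fun s' => A (orbitInCharts E F G p (C s')) := by
    have hcont : ContinuousAt (fun s' => g⁻¹ * φ.symm s') s :=
      (continuous_const_mul _).continuousAt.comp (continuousAt_extChartAt_symm'' hs.1)
    have hval : g⁻¹ * φ.symm s = 1 := by rw [← hg, inv_mul_cancel]
    have h1 : ∀ᶠ s' in 𝓝 s, g⁻¹ * φ.symm s' ∈ φ.source :=
      hcont.preimage_mem_nhds (by rw [hval]; exact extChartAt_source_mem_nhds _)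
    have h2 : ∀ᶠ s' in 𝓝 s, (g⁻¹ * φ.symm s') • p ∈ χ.source := by
      refine hcont.preimage_mem_nhds (t := {g | g • p ∈ χ.source}) ?_
      rw [hval]
      refine ((isOpen_extChartAt_source p).preimage
        (contMDiff_orbit (F := F) (E := E) p).continuous).mem_nhds ?_
      simp only [mem_preimage, one_smul]
      exact mem_extChartAt_source p
    filter_upwards [h1, h2] with s' hs1 hs2
    simp only [hA, hC, orbitInCharts, ← hφ, ← hχ]
    rw [φ.left_inv hs1, χ.left_inv hs2, mul_smul, smul_inv_smul]
  have hder : HasFDerivAt (orbitInCharts E F G p) ((fderiv ℝ A (χ p)).comp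
      ((fderiv ℝ (orbitInCharts E F G p) (φ 1)).comp (fderiv ℝ C s))) s := by
    refine HasFDerivAt.congr_of_eventuallyEq ?_ hev
    have h1 : HasFDerivAt (orbitInCharts E F G p) (fderiv ℝ (orbitInCharts E F G p) (φ 1))
        (C s) := by
      rw [hCs]; exact hfd.hasFDerivAt
    have h2 : HasFDerivAt A (fderiv ℝ A (χ p)) (orbitInCharts E F G p (C s)) := by
      rw [hCs, orbitInCharts_one]; exact hAd.hasFDerivAt
    exact h2.comp s (h1.comp s hCd.hasFDerivAt)
  rw [hder.fderiv]
  refine le_trans (Submodule.finrank_mono (t := (fderiv ℝ (orbitInCharts E F G p) (φ 1)).range.map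
    (fderiv ℝ A (χ p) : E →ₗ[ℝ] E)) ?_) (Submodule.finrank_map_le _ _)
  rintro _ ⟨v, rfl⟩
  exact ⟨_, ⟨_, rfl⟩, rfl⟩

/-- If a second countable Lie group acts transitively, then its orbit maps are submersions. -/
theorem inducedField_surjective [T2Space M] [SecondCountableTopology G]
    [MulAction.IsPretransitive G M] (p : M) :
    Function.Surjective fun u : GroupLieAlgebra 𝓘(ℝ, F) G => (inducedField u p : E) := by
  by_contra hsurj
  have hlt : finrank ℝ (fderiv ℝ (orbitInCharts E F G p) (extChartAt 𝓘(ℝ, F) (1 : G) 1)).range <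
      finrank ℝ E := by
    refine Submodule.finrank_lt fun htop => hsurj fun v => ?_
    obtain ⟨u, hu⟩ := LinearMap.range_eq_top.1 htop v
    exact ⟨u, (inducedField_eq_fderiv u p).trans hu⟩
  obtain ⟨V, hV, hdense⟩ := exists_dense_compl_image_of_finrank_range_le (isOpen_orbitDomain p)
    (mem_orbitDomain p) (fun s hs => ((contDiffAt_orbitInCharts hs).of_le
      (by exact_mod_cast le_top)).contDiffWithinAt)
    (fun s hs => finrank_range_fderiv_orbitInCharts_le p hs) hlt
  have : ContinuousMul G := (topologicalGroup_of_lieGroup 𝓘(ℝ, F) (G := G) ∞).toContinuousMul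
  have : LocallyCompactSpace G := Manifold.locallyCompact_of_finiteDimensional 𝓘(ℝ, F)
  have : LocallyCompactSpace M := Manifold.locallyCompact_of_finiteDimensional 𝓘(ℝ, E)
  have hWn : (extChartAt 𝓘(ℝ, F) (1 : G)).source ∩
      extChartAt 𝓘(ℝ, F) (1 : G) ⁻¹' (V ∩ orbitDomain E F G p) ∈ 𝓝 (1 : G) :=
    Filter.inter_mem (extChartAt_source_mem_nhds _) ((continuousAt_extChartAt _).preimage_mem_nhds
      (Filter.inter_mem hV ((isOpen_orbitDomain p).mem_nhds (mem_orbitDomain p))))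
  obtain ⟨K, hK, hKW, hKc⟩ := local_compact_nhds hWn
  have hKp : ∀ g ∈ K, g • p ∈ (extChartAt 𝓘(ℝ, E) p).source ∧
      extChartAt 𝓘(ℝ, E) p (g • p) ∈ orbitInCharts E F G p '' V := by
    intro g hg
    obtain ⟨h1, h2, h3⟩ := hKW hg
    have h4 : (extChartAt 𝓘(ℝ, F) (1 : G)).symm (extChartAt 𝓘(ℝ, F) (1 : G) g) = g :=
      (extChartAt 𝓘(ℝ, F) (1 : G)).left_inv h1
    refine ⟨?_, _, h2, by rw [orbitInCharts, h4]⟩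
    have := h3.2
    rwa [mem_preimage, h4] at this
  -- Second countability: countably many translates of the compact neighbourhood `K` cover `G`, so
  -- by transitivity countably many translates of the compact set `K • p` cover `M`.
  obtain ⟨t, ht, hcover⟩ := TopologicalSpace.countable_cover_nhds (f := fun g : G => (g * ·) '' K)
    fun g => by
      have h := (Homeomorph.mulLeft g).isOpenMap.image_mem_nhds hK
      simpa using h
  have hcl : ∀ g : G, IsClosed ((fun x : M => g • x) '' ((fun g : G => g • p) '' K)) := fun g =>
    ((hKc.image (contMDiff_orbit (F := F) (E := E) p).continuous).image
      (contMDiff_smul_left (E := E) F g).continuous).isClosed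
  have : Nonempty M := ⟨p⟩
  have : Countable t := ht.to_subtype
  -- By Baire one translate has interior, hence so does `K • p`; but in the chart `K • p` lies in a
  -- set with dense complement.
  obtain ⟨⟨g, hg⟩, x, hx⟩ := nonempty_interior_of_iUnion_of_closed
    (f := fun g : t => (fun x : M => (g : G) • x) '' ((fun g : G => g • p) '' K))
    (fun g => hcl g) (by
      refine eq_univ_of_forall fun x => ?_
      obtain ⟨h, rfl⟩ := MulAction.exists_smul_eq G p x
      have hh : h ∈ ⋃ g ∈ t, (fun x => g * x) '' K := by rw [hcover]; trivial
      simp only [mem_iUnion] at hh ⊢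
      obtain ⟨g, hg, k, hk, rfl⟩ := hh
      exact ⟨⟨g, hg⟩, k • p, ⟨k, hk, rfl⟩, by simp [mul_smul]⟩)
  set O : Set M := (fun x : M => g • x) ⁻¹'
    interior ((fun x : M => g • x) '' ((fun g : G => g • p) '' K)) with hO
  have hOo : IsOpen O := isOpen_interior.preimage (contMDiff_smul_left (E := E) F g).continuous
  have hOK : O ⊆ (fun g : G => g • p) '' K := by
    intro y hy
    obtain ⟨z, hz, hzy⟩ := interior_subset hy
    rwa [← smul_left_cancel g hzy]
  have hOs : O ⊆ (chartAt E p).source := by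
    intro y hy
    obtain ⟨k, hk, rfl⟩ := hOK hy
    simpa using (hKp k hk).1
  have himg : IsOpen (chartAt E p '' O) := (chartAt E p).isOpen_image_of_subset_source hOo hOs
  obtain ⟨z, hz1, hz2⟩ := hdense.inter_open_nonempty _ himg
    ⟨_, g⁻¹ • x, by simpa [hO] using hx, rfl⟩
  obtain ⟨y, hy, rfl⟩ := hz1
  obtain ⟨k, hk, rfl⟩ := hOK hy
  exact hz2 (by simpa using (hKp k hk).2)

end Orbit

/-- A smooth manifold has the smoothness required by the Lie bracket. -/
lemma isManifold_minSmoothness_two {E : Type*} [NormedAddCommGroup E] [NormedSpace ℝ E]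
    {M : Type*} [TopologicalSpace M] [ChartedSpace E M] [IsManifold 𝓘(ℝ, E) ∞ M] :
    IsManifold 𝓘(ℝ, E) (minSmoothness ℝ 2) M := by
  rw [minSmoothness_of_isRCLikeNormedField]; infer_instance

/-- A smooth manifold has the smoothness required by the Jacobi identity. -/
lemma isManifold_minSmoothness_three {E : Type*} [NormedAddCommGroup E] [NormedSpace ℝ E]
    {M : Type*} [TopologicalSpace M] [ChartedSpace E M] [IsManifold 𝓘(ℝ, E) ∞ M] :
    IsManifold 𝓘(ℝ, E) (minSmoothness ℝ 3) M := by
  rw [minSmoothness_of_isRCLikeNormedField]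
  exact IsManifold.of_le (n := ∞) (WithTop.coe_le_coe.2 (le_top : (3 : ℕ∞) ≤ ⊤))

attribute [local instance] isManifold_minSmoothness_two isManifold_minSmoothness_three

/-! ### Calculus of smooth vector fields. -/

section Fields

open VectorField Filter Topology

variable {E : Type*} [NormedAddCommGroup E] [NormedSpace ℝ E] [FiniteDimensional ℝ E]
  {M : Type*} [TopologicalSpace M] [ChartedSpace E M] [IsManifold 𝓘(ℝ, E) ∞ M]

local notation "⟦" X "," Y "⟧" => mlieBracket 𝓘(ℝ, E) X Y

/-- The derivative of a function along a vector field. -/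
def der (X : VField E M) (f : M → ℝ) : M → ℝ := fun p => mvfderiv 𝓘(ℝ, E) f p (X p)

lemma IsSmoothField.mdifferentiableAt {X : VField E M} (hX : IsSmoothField X) (p : M) :
    MDifferentiableAt 𝓘(ℝ, E) 𝓘(ℝ, E).tangent (fun p => (⟨p, X p⟩ : TangentBundle 𝓘(ℝ, E) M)) p :=
  ContMDiff.mdifferentiableAt hX (by simp)

lemma IsSmoothField.add {X Y : VField E M} (hX : IsSmoothField X) (hY : IsSmoothField Y) :
    IsSmoothField (X + Y) :=
  ContMDiff.add_section hX hY

lemma isSmoothField_zero : IsSmoothField (0 : VField E M) :=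
  contMDiff_zeroSection _ _

lemma IsSmoothField.const_smul {X : VField E M} (hX : IsSmoothField X) (c : ℝ) :
    IsSmoothField (c • X) :=
  ContMDiff.const_smul_section hX

lemma IsSmoothField.smul {X : VField E M} (hX : IsSmoothField X) {f : M → ℝ}
    (hf : ContMDiff 𝓘(ℝ, E) 𝓘(ℝ, ℝ) ∞ f) : IsSmoothField (f • X) :=
  ContMDiff.smul_section hf hX

lemma IsSmoothField.mlieBracket {X Y : VField E M} (hX : IsSmoothField X) (hY : IsSmoothField Y) :
    IsSmoothField ⟦X, Y⟧ := by
  have : CompleteSpace E := FiniteDimensional.complete ℝ E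
  have : IsManifold 𝓘(ℝ, E) (((⊤ : ℕ∞) : ℕ∞ω) + 1) M := by
    simpa using (inferInstance : IsManifold 𝓘(ℝ, E) ∞ M)
  exact fun p => ContMDiffAt.mlieBracket_vectorField (m := ⊤) (n := ⊤) (hX p) (hY p) (by simp)

lemma contMDiff_der {X : VField E M} (hX : IsSmoothField X) {f : M → ℝ}
    (hf : ContMDiff 𝓘(ℝ, E) 𝓘(ℝ, ℝ) ∞ f) : ContMDiff 𝓘(ℝ, E) 𝓘(ℝ, ℝ) ∞ (der X f) := by
  have h1 : ContMDiff 𝓘(ℝ, E) 𝓘(ℝ, ℝ).tangent ∞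
      (fun p => tangentMap 𝓘(ℝ, E) 𝓘(ℝ, ℝ) f (⟨p, X p⟩ : TangentBundle 𝓘(ℝ, E) M)) :=
    (hf.contMDiff_tangentMap (by simp)).comp hX
  exact (contMDiff_snd_tangentBundle_modelSpace ℝ 𝓘(ℝ, ℝ)).comp h1

section der

variable {X Y Z : VField E M} {f g : M → ℝ}

lemma der_add (hf : ContMDiff 𝓘(ℝ, E) 𝓘(ℝ, ℝ) ∞ f) (hg : ContMDiff 𝓘(ℝ, E) 𝓘(ℝ, ℝ) ∞ g) :
    der X (f + g) = der X f + der X g := by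
  funext p
  simp [der, mvfderiv_add (hf.mdifferentiableAt (by simp)) (hg.mdifferentiableAt (by simp))]

lemma der_const (c : ℝ) : der X (fun _ => c) = 0 := by
  funext p
  simp [der, mvfderiv_const]

/-- Every field which is smooth near `p` agrees near `p` with a smooth field which is everywhere a
multiple of it. -/
lemma exists_isSmoothField_eventuallyEq [T2Space M] {X : VField E M} {U : Set M} {p : M}
    (hU : U ∈ 𝓝 p) (hX : ContMDiffOn 𝓘(ℝ, E) 𝓘(ℝ, E).tangent ∞
      (fun p => (⟨p, X p⟩ : TangentBundle 𝓘(ℝ, E) M)) U) :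
    ∃ Y : VField E M, IsSmoothField Y ∧ (∀ᶠ q in 𝓝 p, Y q = X q) ∧
      ∀ q, ∃ c : ℝ, Y q = c • X q ∧ (c ≠ 0 → q ∈ U) := by
  obtain ⟨f, -, hf⟩ := (SmoothBumpFunction.nhds_basis_tsupport (I := 𝓘(ℝ, E)) p).mem_iff.1
    (interior_mem_nhds.2 hU)
  refine ⟨(f : M → ℝ) • X, ?_, ?_, fun q =>
    ⟨f q, rfl, fun h => interior_subset (hf (subset_tsupport _ h))⟩⟩
  · exact ContMDiffOn.smul_section_of_tsupport (u := interior U) f.contMDiff.contMDiffOn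
      isOpen_interior hf (hX.mono interior_subset)
  · filter_upwards [f.eventuallyEq_one] with q hq
    simp [hq]

lemma exists_isSmoothField_eq [T2Space M] (p : M) (v : TangentSpace 𝓘(ℝ, E) p) :
    ∃ X : VField E M, IsSmoothField X ∧ X p = v := by
  obtain ⟨U, hU, hX⟩ := FiberBundle.exists_contMDiffOn_extend (k := ∞) 𝓘(ℝ, E) E v
  obtain ⟨Y, hY, hYX, -⟩ := exists_isSmoothField_eventuallyEq hU hX
  exact ⟨Y, hY, hYX.self_of_nhds.trans (by simp)⟩

lemma mlieBracket_smul (hY : IsSmoothField Y) (hf : ContMDiff 𝓘(ℝ, E) 𝓘(ℝ, ℝ) ∞ f) :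
    ⟦X, f • Y⟧ = der X f • Y + f • ⟦X, Y⟧ := by
  have : CompleteSpace E := FiniteDimensional.complete ℝ E
  funext p
  exact mlieBracket_smul_right (hf.mdifferentiableAt (by simp)) (hY.mdifferentiableAt p)

lemma mlieBracket_add (hf : IsSmoothField Y) (hZ : IsSmoothField Z) :
    ⟦X, Y + Z⟧ = ⟦X, Y⟧ + ⟦X, Z⟧ := by
  have : CompleteSpace E := FiniteDimensional.complete ℝ E
  funext p
  exact mlieBracket_add_right (hf.mdifferentiableAt p) (hZ.mdifferentiableAt p)

lemma mlieBracket_leibniz (hX : IsSmoothField X) (hY : IsSmoothField Y) (hZ : IsSmoothField Z) :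
    ⟦X, ⟦Y, Z⟧⟧ = ⟦⟦X, Y⟧, Z⟧ + ⟦Y, ⟦X, Z⟧⟧ := by
  have : CompleteSpace E := FiniteDimensional.complete ℝ E
  have h : minSmoothness ℝ 2 ≤ ∞ := by
    rw [minSmoothness_of_isRCLikeNormedField]; exact WithTop.coe_le_coe.2 (le_top : (2 : ℕ∞) ≤ ⊤)
  exact leibniz_identity_mlieBracket (ContMDiff.of_le hX h) (ContMDiff.of_le hY h)
    (ContMDiff.of_le hZ h)

/-- Expand the Jacobi identity for `X`, `Y`, `f • Z` by the Leibniz rule, with `Z` nonzero at the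
point. Everything cancels except the coefficient of `Z`, which is the difference of the two sides.
-/
lemma der_mlieBracket [T2Space M] (hX : IsSmoothField X) (hY : IsSmoothField Y)
    (hf : ContMDiff 𝓘(ℝ, E) 𝓘(ℝ, ℝ) ∞ f) :
    der ⟦X, Y⟧ f = der X (der Y f) - der Y (der X f) := by
  funext p
  by_cases h0 : ⟦X, Y⟧ p = 0 ∧ X p = 0 ∧ Y p = 0
  · simp [der, h0]
  obtain ⟨v, hv⟩ : ∃ v : TangentSpace 𝓘(ℝ, E) p, v ≠ 0 := by
    by_contra! h
    exact h0 ⟨h _, h _, h _⟩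
  obtain ⟨Z, hZ, rfl⟩ := exists_isSmoothField_eq p v
  have hXf := contMDiff_der hX hf
  have hYf := contMDiff_der hY hf
  have h := mlieBracket_leibniz hX hY (hZ.smul hf)
  rw [mlieBracket_smul hZ hf, mlieBracket_smul hZ hf, mlieBracket_smul hZ hf,
    mlieBracket_add (hZ.smul hYf) ((hY.mlieBracket hZ).smul hf),
    mlieBracket_add (hZ.smul hXf) ((hX.mlieBracket hZ).smul hf),
    mlieBracket_smul hZ hYf, mlieBracket_smul hZ hXf, mlieBracket_smul (hY.mlieBracket hZ) hf,
    mlieBracket_smul (hX.mlieBracket hZ) hf, mlieBracket_leibniz hX hY hZ] at h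
  have h2 := congrFun h p
  simp only [Pi.add_apply, Pi.smul_apply'] at h2
  have h3 : (der ⟦X, Y⟧ f p - (der X (der Y f) p - der Y (der X f) p)) • Z p = 0 := by
    linear_combination (norm := module) -h2
  exact sub_eq_zero.1 ((smul_eq_zero.1 h3).resolve_right hv)

end der
end Fields

/-! ### The Levi-Civita connection and Koszul's formula. -/

section LeviCivita

open VectorField Filter Topology

variable {E : Type*} [NormedAddCommGroup E] [NormedSpace ℝ E] [FiniteDimensional ℝ E]
  {M : Type*} [TopologicalSpace M] [ChartedSpace E M] [IsManifold 𝓘(ℝ, E) ∞ M]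
  [RiemannianBundle (fun p : M => TangentSpace 𝓘(ℝ, E) p)]
  [IsContMDiffRiemannianBundle 𝓘(ℝ, E) ∞ E (fun p : M => TangentSpace 𝓘(ℝ, E) p)]

local notation "⟦" X "," Y "⟧" => mlieBracket 𝓘(ℝ, E) X Y

/-- The pointwise inner product of two vector fields. -/
def inn (X Y : VField E M) : M → ℝ := fun p => inner ℝ (X p) (Y p)

lemma contMDiff_inn {X Y : VField E M} (hX : IsSmoothField X) (hY : IsSmoothField Y) :
    ContMDiff 𝓘(ℝ, E) 𝓘(ℝ, ℝ) ∞ (inn X Y) :=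
  ContMDiff.inner_bundle hX hY

lemma inn_comm (X Y : VField E M) : inn X Y = inn Y X := by
  funext p; exact real_inner_comm _ _

lemma inn_add_left (X Y Z : VField E M) : inn (X + Y) Z = inn X Z + inn Y Z := by
  funext p; exact inner_add_left _ _ _

lemma inn_sub_left (X Y Z : VField E M) : inn (X - Y) Z = inn X Z - inn Y Z := by
  funext p; exact inner_sub_left _ _ _

/-- A vector field is smooth if its inner products with smooth fields are. -/
lemma isSmoothField_of_inn [T2Space M] {X : VField E M}
    (h : ∀ Z, IsSmoothField Z → ContMDiff 𝓘(ℝ, E) 𝓘(ℝ, ℝ) ∞ (inn X Z)) : IsSmoothField X := by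
  intro p
  let e := trivializationAt E (fun p : M => TangentSpace 𝓘(ℝ, E) p) p
  let b := Module.finBasis ℝ E
  let ι := Fin (Module.finrank ℝ E)
  have hpe : p ∈ e.baseSet := FiberBundle.mem_baseSet_trivializationAt' p
  have hS : ∀ i, ∃ S : VField E M, IsSmoothField S ∧ ∀ᶠ q in 𝓝 p, S q = e.localFrame b i q := by
    intro i
    obtain ⟨S, h1, h2, -⟩ := exists_isSmoothField_eventuallyEq (X := e.localFrame b i)
      (e.open_baseSet.mem_nhds hpe)
      (e.contMDiffOn_localFrame_baseSet (I := 𝓘(ℝ, E)) ∞ b i)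
    exact ⟨S, h1, h2⟩
  choose S hSs hSe using hS
  -- The coefficients of `X` in a local frame solve a linear system whose matrix is the Gram matrix.
  -- They are smooth because the right-hand side is, and because inversion is smooth at an
  -- invertible operator.
  let Λ : (ι → ι → ℝ) →L[ℝ] ((ι → ℝ) →L[ℝ] (ι → ℝ)) := LinearMap.toContinuousLinearMap
    ((LinearMap.toContinuousLinearMap : ((ι → ℝ) →ₗ[ℝ] (ι → ℝ)) ≃ₗ[ℝ] _).toLinearMap ∘ₗ
      (Matrix.toLin' : Matrix ι ι ℝ ≃ₗ[ℝ] _).toLinearMap)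
  let T : M → ((ι → ℝ) →L[ℝ] (ι → ℝ)) := fun q => Λ fun i j => inn (S j) (S i) q
  have hTapp : ∀ q c i, T q c i = inner ℝ (∑ j, c j • S j q) (S i q) := by
    intro q c i
    rw [sum_inner]
    simp only [real_inner_smul_left]
    change (Matrix.mulVec (fun i j => inn (S j) (S i) q) c) i = _
    simp only [Matrix.mulVec, dotProduct, inn]
    exact Finset.sum_congr rfl fun j _ => mul_comm _ _
  have hTs : ContMDiff 𝓘(ℝ, E) 𝓘(ℝ, (ι → ℝ) →L[ℝ] (ι → ℝ)) ∞ T :=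
    Λ.contMDiff.comp (contMDiff_pi_space.2 fun i => contMDiff_pi_space.2 fun j =>
      contMDiff_inn (hSs j) (hSs i))
  have hbasis : ∀ᶠ q in 𝓝 p, LinearIndependent ℝ (fun i => S i q) ∧
      ∃ c : ι → ℝ, X q = ∑ j, c j • S j q := by
    filter_upwards [eventually_all.2 hSe, e.open_baseSet.mem_nhds hpe] with q hq hqe
    have : (fun i => S i q) = e.basisAt b hqe := by
      funext i
      rw [hq i, e.localFrame_apply_of_mem_baseSet b hqe]
    rw [this]
    refine ⟨(e.basisAt b hqe).linearIndependent, (e.basisAt b hqe).repr (X q), ?_⟩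
    exact ((e.basisAt b hqe).sum_repr (X q)).symm.trans
      (Finset.sum_congr rfl fun i _ => by rw [← this])
  have hinj : ∀ᶠ q in 𝓝 p, Function.Injective (T q) ∧
      ∃ c : ι → ℝ, X q = ∑ j, c j • S j q := by
    filter_upwards [hbasis] with q hq
    refine ⟨(injective_iff_map_eq_zero _).2 fun c hc => ?_, hq.2⟩
    have h1 : inner ℝ (∑ j, c j • S j q) (∑ i, c i • S i q) = (0 : ℝ) := by
      rw [inner_sum]
      refine Finset.sum_eq_zero fun i _ => ?_
      rw [real_inner_smul_right, ← hTapp, hc]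
      simp
    funext i
    exact Fintype.linearIndependent_iff.1 hq.1 c (inner_self_eq_zero.1 h1) i
  have heq : ∀ q, Function.Injective (T q) → ∃ f : (ι → ℝ) ≃L[ℝ] (ι → ℝ),
      (f : (ι → ℝ) →L[ℝ] (ι → ℝ)) = T q :=
    fun q hq => ⟨(LinearEquiv.ofInjectiveEndo (T q : (ι → ℝ) →ₗ[ℝ] (ι → ℝ)) hq).toContinuousLinearEquiv,
      by ext; rfl⟩
  let a : M → (ι → ℝ) := fun q i => inn X (S i) q
  have ha : ContMDiff 𝓘(ℝ, E) 𝓘(ℝ, ι → ℝ) ∞ a := contMDiff_pi_space.2 fun i => h _ (hSs i)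
  let c : M → (ι → ℝ) := fun q => (T q).inverse (a q)
  have hc : ContMDiffAt 𝓘(ℝ, E) 𝓘(ℝ, ι → ℝ) ∞ c p := by
    obtain ⟨f, hf⟩ := heq p hinj.self_of_nhds.1
    have h1 := contDiffAt_map_inverse (𝕜 := ℝ) (n := ∞) f
    rw [hf] at h1
    exact (h1.contMDiffAt.comp p (hTs p)).clm_apply (ha p)
  have hX : ∀ᶠ q in 𝓝 p, X q = ∑ j, c q j • S j q := by
    filter_upwards [hinj] with q ⟨hq, d, hd⟩
    have h1 : T q d = a q := by
      funext i
      rw [hTapp, ← hd]; rfl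
    obtain ⟨f, hf⟩ := heq q hq
    have h2 : c q = d := by
      simp only [c]
      rw [← h1, ← hf]
      simp
    rw [h2, hd]
  refine ContMDiffAt.congr_of_eventuallyEq
    (f := fun q => (⟨q, ∑ j, c q j • S j q⟩ : TangentBundle 𝓘(ℝ, E) M)) ?_
    (hX.mono fun q hq => congrArg (TotalSpace.mk q) hq)
  exact ContMDiffAt.sum_section fun j _ => ContMDiffAt.smul_section
    (contMDiffAt_pi_space.1 hc j) (hSs j p)

variable {D : CovariantDerivative 𝓘(ℝ, E) E (fun p : M => TangentSpace 𝓘(ℝ, E) p)}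

lemma nabla_add (X : VField E M) {Y Z : VField E M} (hY : IsSmoothField Y)
    (hZ : IsSmoothField Z) : nabla D X (Y + Z) = nabla D X Y + nabla D X Z := by
  funext p
  exact congrArg (fun L : TangentSpace 𝓘(ℝ, E) p →L[ℝ] TangentSpace 𝓘(ℝ, E) p => L (X p))
    (D.isCovariantDerivativeOn.add (hY.mdifferentiableAt p) (hZ.mdifferentiableAt p)
      (Set.mem_univ p))

lemma nabla_const_smul (X : VField E M) {Y : VField E M} (hY : IsSmoothField Y) (c : ℝ) :
    nabla D X (c • Y) = c • nabla D X Y := by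
  funext p
  exact congrArg (fun L : TangentSpace 𝓘(ℝ, E) p →L[ℝ] TangentSpace 𝓘(ℝ, E) p => L (X p))
    (D.isCovariantDerivativeOn.smul_const c (hY.mdifferentiableAt p) (Set.mem_univ p))

lemma nabla_sub (X : VField E M) {Y Z : VField E M} (hY : IsSmoothField Y)
    (hZ : IsSmoothField Z) : nabla D X (Y - Z) = nabla D X Y - nabla D X Z := by
  have : Y - Z = Y + (-1 : ℝ) • Z := by rw [neg_one_smul, sub_eq_add_neg]
  rw [this, nabla_add X hY (hZ.const_smul _), nabla_const_smul X hZ, neg_one_smul, sub_eq_add_neg]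

lemma nabla_sub_left (X Y Z : VField E M) : nabla D (X - Y) Z = nabla D X Z - nabla D Y Z := by
  funext p; exact map_sub _ _ _

lemma IsLeviCivita.der_inn (hD : IsLeviCivita D) {X Y Z : VField E M} (hY : IsSmoothField Y)
    (hZ : IsSmoothField Z) :
    der X (inn Y Z) = inn (nabla D X Y) Z + inn Y (nabla D X Z) := by
  funext p
  exact hD.2.mvfderiv_inner_eq X (hY.mdifferentiableAt p) (hZ.mdifferentiableAt p)

lemma IsLeviCivita.nabla_sub_nabla (hD : IsLeviCivita D) {X Y : VField E M} (hX : IsSmoothField X)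
    (hY : IsSmoothField Y) : nabla D X Y - nabla D Y X = ⟦X, Y⟧ := by
  have : CompleteSpace E := FiniteDimensional.complete ℝ E
  funext p
  exact D.torsion_eq_zero_iff.1 hD.1 (hX.mdifferentiableAt p) (hY.mdifferentiableAt p)

lemma IsLeviCivita.koszul (hD : IsLeviCivita D) {X Y Z : VField E M} (hX : IsSmoothField X)
    (hY : IsSmoothField Y) (hZ : IsSmoothField Z) :
    (2 : ℝ) • inn (nabla D X Y) Z = der X (inn Y Z) + der Y (inn X Z) - der Z (inn X Y) +
      inn ⟦X, Y⟧ Z - inn ⟦X, Z⟧ Y - inn ⟦Y, Z⟧ X := by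
  rw [hD.der_inn hY hZ, hD.der_inn hX hZ, hD.der_inn hX hY, ← hD.nabla_sub_nabla hX hY,
    ← hD.nabla_sub_nabla hX hZ, ← hD.nabla_sub_nabla hY hZ]
  simp only [inn_sub_left, inn_comm X, inn_comm Y]
  module

/-- Smoothness is not part of the connection data here; Koszul's formula supplies it by making all
inner products with smooth fields smooth. -/
lemma IsLeviCivita.isSmoothField_nabla [T2Space M] (hD : IsLeviCivita D) {X Y : VField E M}
    (hX : IsSmoothField X) (hY : IsSmoothField Y) : IsSmoothField (nabla D X Y) := by
  refine isSmoothField_of_inn fun Z hZ => ?_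
  have h := congrArg (fun f : M → ℝ => (1 / 2 : ℝ) • f) (hD.koszul hX hY hZ)
  simp only [smul_smul] at h
  norm_num at h
  rw [h]
  have h1 := ((contMDiff_der hX (contMDiff_inn hY hZ)).add
    (contMDiff_der hY (contMDiff_inn hX hZ))).sub (contMDiff_der hZ (contMDiff_inn hX hY))
  have h2 := ((h1.add (contMDiff_inn (hX.mlieBracket hY) hZ)).sub
    (contMDiff_inn (hX.mlieBracket hZ) hY)).sub (contMDiff_inn (hY.mlieBracket hZ) hX)
  exact (contMDiff_const (c := (1 / 2 : ℝ))).mul h2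

end LeviCivita

/-! ### Curvature identities, tensoriality, and second derivatives of Killing fields. -/

section Curvature

open VectorField Filter Topology

variable {E : Type*} [NormedAddCommGroup E] [NormedSpace ℝ E] [FiniteDimensional ℝ E]
  {M : Type*} [TopologicalSpace M] [T2Space M] [ChartedSpace E M] [IsManifold 𝓘(ℝ, E) ∞ M]
  [RiemannianBundle (fun p : M => TangentSpace 𝓘(ℝ, E) p)]
  [IsContMDiffRiemannianBundle 𝓘(ℝ, E) ∞ E (fun p : M => TangentSpace 𝓘(ℝ, E) p)]
  {D : CovariantDerivative 𝓘(ℝ, E) E (fun p : M => TangentSpace 𝓘(ℝ, E) p)}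
  {X Y Z W : VField E M}

local notation "⟦" X "," Y "⟧" => mlieBracket 𝓘(ℝ, E) X Y

lemma inn_eq_zero_iff {p : M} {v : TangentSpace 𝓘(ℝ, E) p} :
    v = 0 ↔ ∀ Z : VField E M, IsSmoothField Z → inner ℝ v (Z p) = (0 : ℝ) := by
  refine ⟨fun h Z _ => by rw [h]; exact inner_zero_left _, fun h => ?_⟩
  obtain ⟨Z, hZ, hZv⟩ := exists_isSmoothField_eq p v
  have h1 := h Z hZ
  rw [hZv] at h1
  exact inner_self_eq_zero.1 h1

lemma eq_of_inn_eq (h : ∀ Z, IsSmoothField Z → inn X Z = inn Y Z) : X = Y := by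
  funext p
  refine sub_eq_zero.1 (inn_eq_zero_iff.2 fun Z hZ => ?_)
  have := congrFun (h Z hZ) p
  rw [inner_sub_left, sub_eq_zero]
  exact this

lemma curvature_swap (X Y Z : VField E M) : curvature D X Y Z = -curvature D Y X Z := by
  simp only [curvature, mlieBracket_swap (V := X)]
  have : nabla D (-⟦Y, X⟧) Z = -nabla D ⟦Y, X⟧ Z := by funext p; exact map_neg _ _
  rw [this]
  abel

lemma IsLeviCivita.curvature_add (hD : IsLeviCivita D) (hX : IsSmoothField X)
    (hY : IsSmoothField Y) (hZ : IsSmoothField Z) (hW : IsSmoothField W) :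
    curvature D X Y (Z + W) = curvature D X Y Z + curvature D X Y W := by
  simp only [curvature]
  rw [nabla_add Y hZ hW, nabla_add X hZ hW, nabla_add _ hZ hW,
    nabla_add X (hD.isSmoothField_nabla hY hZ) (hD.isSmoothField_nabla hY hW),
    nabla_add Y (hD.isSmoothField_nabla hX hZ) (hD.isSmoothField_nabla hX hW)]
  abel

lemma IsLeviCivita.curvature_const_smul (hD : IsLeviCivita D) (hX : IsSmoothField X)
    (hY : IsSmoothField Y) (hZ : IsSmoothField Z) (c : ℝ) :
    curvature D X Y (c • Z) = c • curvature D X Y Z := by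
  simp only [curvature]
  rw [nabla_const_smul Y hZ, nabla_const_smul X hZ, nabla_const_smul _ hZ,
    nabla_const_smul X (hD.isSmoothField_nabla hY hZ),
    nabla_const_smul Y (hD.isSmoothField_nabla hX hZ)]
  module

/-- Vanishing torsion regroups the cyclic sum into double brackets, and Jacobi finishes. -/
lemma IsLeviCivita.curvature_bianchi (hD : IsLeviCivita D) (hX : IsSmoothField X)
    (hY : IsSmoothField Y) (hZ : IsSmoothField Z) :
    curvature D X Y Z + curvature D Y Z X + curvature D Z X Y = 0 := by
  have key : ∀ {X Y Z : VField E M}, IsSmoothField X → IsSmoothField Y → IsSmoothField Z →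
      nabla D X (nabla D Y Z) - nabla D X (nabla D Z Y) - nabla D ⟦Y, Z⟧ X = ⟦X, ⟦Y, Z⟧⟧ := by
    intro X Y Z hX hY hZ
    rw [← nabla_sub X (hD.isSmoothField_nabla hY hZ) (hD.isSmoothField_nabla hZ hY),
      hD.nabla_sub_nabla hY hZ, hD.nabla_sub_nabla hX (hY.mlieBracket hZ)]
  have h1 := key hX hY hZ
  have h2 := key hY hZ hX
  have h3 := key hZ hX hY
  have h4 := mlieBracket_leibniz hX hY hZ
  have h5 : ⟦⟦X, Y⟧, Z⟧ = -⟦Z, ⟦X, Y⟧⟧ := mlieBracket_swap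
  have h6 : ⟦X, Z⟧ = (-1 : ℝ) • ⟦Z, X⟧ := by rw [neg_one_smul]; exact mlieBracket_swap
  have h7 : ⟦Y, (-1 : ℝ) • ⟦Z, X⟧⟧ = (-1 : ℝ) • ⟦Y, ⟦Z, X⟧⟧ := by
    have : CompleteSpace E := FiniteDimensional.complete ℝ E
    funext p
    exact mlieBracket_const_smul_right ((hZ.mlieBracket hX).mdifferentiableAt p)
  rw [h5, h6, h7] at h4
  simp only [curvature]
  have : ∀ a b c : VField E M, a = -c + (-1 : ℝ) • b → a + b + c = 0 := by
    intro a b c h; rw [h]; module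
  rw [← this _ _ _ h4, ← h1, ← h2, ← h3]
  abel

/-- Differentiate `inn Z W` along `⟦X, Y⟧` and, twice, along `X` and `Y`. The mixed terms are
symmetric in `X`, `Y` and cancel. -/
lemma IsLeviCivita.inn_curvature_skew (hD : IsLeviCivita D) (hX : IsSmoothField X)
    (hY : IsSmoothField Y) (hZ : IsSmoothField Z) (hW : IsSmoothField W) :
    inn (curvature D X Y Z) W = -inn Z (curvature D X Y W) := by
  have key : ∀ {X Y : VField E M}, IsSmoothField X → IsSmoothField Y →
      der X (der Y (inn Z W)) = inn (nabla D X (nabla D Y Z)) W +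
        inn (nabla D Y Z) (nabla D X W) + (inn (nabla D X Z) (nabla D Y W) +
        inn Z (nabla D X (nabla D Y W))) := by
    intro X Y hX hY
    rw [hD.der_inn hZ hW, der_add (contMDiff_inn (hD.isSmoothField_nabla hY hZ) hW)
      (contMDiff_inn hZ (hD.isSmoothField_nabla hY hW)),
      hD.der_inn (hD.isSmoothField_nabla hY hZ) hW, hD.der_inn hZ (hD.isSmoothField_nabla hY hW)]
  have h := der_mlieBracket hX hY (contMDiff_inn hZ hW)
  rw [key hX hY, key hY hX, hD.der_inn hZ hW] at h
  simp only [curvature, inn_sub_left, inn_comm Z]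
  simp only [inn_comm Z] at h
  funext p
  have h' := congrFun h p
  simp only [Pi.add_apply, Pi.sub_apply, Pi.neg_apply] at h' ⊢
  linear_combination -h'

lemma IsLeviCivita.inn_curvature_pair (hD : IsLeviCivita D) (hX : IsSmoothField X)
    (hY : IsSmoothField Y) (hZ : IsSmoothField Z) (hW : IsSmoothField W) :
    inn (curvature D X Y Z) W = inn (curvature D Z W X) Y := by
  have sw : ∀ X Y Z W : VField E M, inn (curvature D X Y Z) W = -inn (curvature D Y X Z) W := by
    intro X Y Z W
    rw [curvature_swap X Y]
    funext p; exact inner_neg_left _ _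
  have sk : ∀ {X Y Z W : VField E M}, IsSmoothField X → IsSmoothField Y → IsSmoothField Z →
      IsSmoothField W → inn (curvature D X Y Z) W = -inn (curvature D X Y W) Z := by
    intro X Y Z W hX hY hZ hW
    rw [hD.inn_curvature_skew hX hY hZ hW, inn_comm]
  have bi : ∀ {X Y Z : VField E M} (W), IsSmoothField X → IsSmoothField Y → IsSmoothField Z →
      inn (curvature D X Y Z) W + inn (curvature D Y Z X) W + inn (curvature D Z X Y) W = 0 := by
    intro X Y Z W hX hY hZ
    rw [← inn_add_left, ← inn_add_left, hD.curvature_bianchi hX hY hZ]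
    funext p; exact inner_zero_left _
  funext p
  have e1 := congrFun (bi W hX hY hZ) p
  have e2 := congrFun (bi X hY hZ hW) p
  have e3 := congrFun (bi Y hZ hW hX) p
  have e4 := congrFun (bi Z hW hX hY) p
  have s1 := congrFun (sk hX hY hZ hW) p
  have s2 := congrFun (sk hY hZ hX hW) p
  have s3 := congrFun (sk hZ hX hY hW) p
  have s4 := congrFun (sk hZ hW hY hX) p
  have s5 := congrFun (sk hW hY hZ hX) p
  have s6 := congrFun (sk hW hX hZ hY) p
  have w1 := congrFun (sw X Z W Y) p
  have w2 := congrFun (sw W Y X Z) p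
  have w3 := congrFun (sw Y W Z X) p
  have w4 := congrFun (sw Z X Y W) p
  simp only [Pi.add_apply, Pi.neg_apply, Pi.zero_apply] at *
  linarith

/-- The value of the curvature at a point only depends on the values of the fields there. -/
lemma IsLeviCivita.curvature_congr (hD : IsLeviCivita D) {X' Y' Z' : VField E M}
    (hX : IsSmoothField X) (hY : IsSmoothField Y) (hZ : IsSmoothField Z) (hX' : IsSmoothField X')
    (hY' : IsSmoothField Y') (hZ' : IsSmoothField Z') {p : M} (hXp : X p = X' p)
    (hYp : Y p = Y' p) (hZp : Z p = Z' p) : curvature D X Y Z p = curvature D X' Y' Z' p := by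
  -- Skewness moves the third argument outside the derivatives; pair symmetry then does the same for
  -- the first.
  have h3 : ∀ {X Y Z Z' : VField E M}, IsSmoothField X → IsSmoothField Y → IsSmoothField Z →
      IsSmoothField Z' → Z p = Z' p → curvature D X Y Z p = curvature D X Y Z' p := by
    intro X Y Z Z' hX hY hZ hZ' h
    refine sub_eq_zero.1 (inn_eq_zero_iff.2 fun W hW => ?_)
    have h1 := congrFun (hD.inn_curvature_skew hX hY hZ hW) p
    have h2 := congrFun (hD.inn_curvature_skew hX hY hZ' hW) p
    simp only [inn, Pi.neg_apply] at h1 h2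
    rw [inner_sub_left, h1, h2, h, sub_self]
  have h1 : ∀ {X Y Z X' : VField E M}, IsSmoothField X → IsSmoothField Y → IsSmoothField Z →
      IsSmoothField X' → X p = X' p → curvature D X Y Z p = curvature D X' Y Z p := by
    intro X Y Z X' hX hY hZ hX' h
    refine sub_eq_zero.1 (inn_eq_zero_iff.2 fun W hW => ?_)
    have h1 := congrFun (hD.inn_curvature_pair hX hY hZ hW) p
    have h2 := congrFun (hD.inn_curvature_pair hX' hY hZ hW) p
    simp only [inn] at h1 h2
    rw [inner_sub_left, h1, h2, h3 hZ hW hX hX' h, sub_self]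
  rw [h3 hX hY hZ hZ' hZp, h1 hX hY hZ' hX' hXp, curvature_swap, curvature_swap X']
  exact congrArg Neg.neg (h1 hY hX' hZ' hY' hYp)

/-- A field whose covariant derivative is skew-symmetric satisfies `∇ ∇ W = R(·, W)`. -/
lemma IsLeviCivita.nabla_nabla_of_skew (hD : IsLeviCivita D) (hX : IsSmoothField X)
    (hY : IsSmoothField Y) (hW : IsSmoothField W)
    (hskew : ∀ {Y Z}, IsSmoothField Y → IsSmoothField Z →
      inn (nabla D Y W) Z + inn Y (nabla D Z W) = 0) :
    nabla D X (nabla D Y W) - nabla D (nabla D X Y) W = curvature D X W Y := by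
  -- The second covariant derivative of `W` is skew in `(Y, Z)` by `T1`, and its alternation in `(X,
  -- Y)` is curvature by `T2`. As in Koszul's formula, the two properties determine it.
  have T1 : ∀ {X Y Z}, IsSmoothField X → IsSmoothField Y → IsSmoothField Z →
      inn (nabla D X (nabla D Y W) - nabla D (nabla D X Y) W) Z +
      inn (nabla D X (nabla D Z W) - nabla D (nabla D X Z) W) Y = 0 := by
    intro X Y Z hX hY hZ
    have hYW := hD.isSmoothField_nabla hY hW
    have hZW := hD.isSmoothField_nabla hZ hW
    have h := congrArg (der X) (hskew hY hZ)
    rw [der_add (contMDiff_inn hYW hZ) (contMDiff_inn hY hZW), hD.der_inn hYW hZ,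
      hD.der_inn hY hZW, show (0 : M → ℝ) = fun _ => 0 from rfl, der_const] at h
    have h1 := hskew hY (hD.isSmoothField_nabla hX hZ)
    have h2 := hskew (hD.isSmoothField_nabla hX hY) hZ
    rw [inn_comm Y] at h h1
    simp only [inn_sub_left]
    linear_combination (norm := module) h - h1 - h2
  have T2 : ∀ {X Y : VField E M}, IsSmoothField X → IsSmoothField Y →
      (nabla D X (nabla D Y W) - nabla D (nabla D X Y) W) -
      (nabla D Y (nabla D X W) - nabla D (nabla D Y X) W) = curvature D X Y W := by
    intro X Y hX hY
    rw [curvature, ← hD.nabla_sub_nabla hX hY, nabla_sub_left]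
    abel
  have T3 : ∀ {X Y : VField E M} (Z), IsSmoothField X → IsSmoothField Y →
      inn (nabla D X (nabla D Y W) - nabla D (nabla D X Y) W) Z -
      inn (nabla D Y (nabla D X W) - nabla D (nabla D Y X) W) Z = inn (curvature D X Y W) Z := by
    intro X Y Z hX hY
    rw [← T2 hX hY, ← inn_sub_left]
  refine eq_of_inn_eq fun Z hZ => ?_
  have b := congrArg (fun V => inn V Z) (hD.curvature_bianchi hX hY hW)
  have hz : inn (0 : VField E M) Z = 0 := by funext p; exact inner_zero_left _
  simp only [inn_add_left, hz] at b
  have sw : ∀ X Y Z W : VField E M, inn (curvature D X Y Z) W = -inn (curvature D Y X Z) W := by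
    intro X Y Z W
    rw [curvature_swap X Y]
    funext p; exact inner_neg_left _ _
  have p1 := hD.inn_curvature_pair hY hW hX hZ
  have p2 := hD.inn_curvature_pair hY hZ hX hW
  have k1 := hD.inn_curvature_skew hY hZ hX hW
  have k2 := hD.inn_curvature_skew hX hZ hY hW
  rw [inn_comm X] at k1
  rw [inn_comm Y] at k2
  have s1 := sw W X Y Z
  have s2 := sw Z X W Y
  funext p
  have a1 := congrFun (T1 hX hY hZ) p
  have a2 := congrFun (T1 hY hX hZ) p
  have a3 := congrFun (T1 hZ hX hY) p
  have b1 := congrFun (T3 Z hX hY) p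
  have b2 := congrFun (T3 Y hZ hX) p
  have b3 := congrFun (T3 X hY hZ) p
  have b := congrFun b p
  have p1 := congrFun p1 p
  have p2 := congrFun p2 p
  have k1 := congrFun k1 p
  have k2 := congrFun k2 p
  have s1 := congrFun s1 p
  have s2 := congrFun s2 p
  simp only [Pi.add_apply, Pi.neg_apply, Pi.zero_apply, Pi.sub_apply] at *
  linarith

end Curvature

/-- The elements of `G` act on `M` by smooth maps. -/
class SmoothConstSMul (E : Type*) [NormedAddCommGroup E] [NormedSpace ℝ E] (M : Type*)
    [TopologicalSpace M] [ChartedSpace E M] (G : Type*) [Group G] [MulAction G M] : Prop where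
  contMDiff_smul : ∀ g : G, ContMDiff 𝓘(ℝ, E) 𝓘(ℝ, E) ∞ (fun q : M => g • q)

/-! ### Pullback of vector fields by group elements; invariance under isometries. -/

section Pull

open VectorField Filter Topology

variable {E : Type*} [NormedAddCommGroup E] [NormedSpace ℝ E] [FiniteDimensional ℝ E]
  {M : Type*} [TopologicalSpace M] [ChartedSpace E M] [IsManifold 𝓘(ℝ, E) ∞ M]
  {G : Type*} [TopologicalSpace G] [Group G] [MulAction G M] [SmoothConstSMul E M G]

local notation "⟦" X "," Y "⟧" => mlieBracket 𝓘(ℝ, E) X Y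

variable (E) in
/-- The differential of the action of `g`. -/
def dsmul (g : G) (p : M) : TangentSpace 𝓘(ℝ, E) p →L[ℝ] TangentSpace 𝓘(ℝ, E) (g • p) :=
  mfderiv 𝓘(ℝ, E) 𝓘(ℝ, E) (fun q : M => g • q) p

/-- The pullback of a vector field by the action of `g`. -/
def pull (g : G) (X : VField E M) : VField E M :=
  mpullback 𝓘(ℝ, E) 𝓘(ℝ, E) (fun q : M => g • q) X

lemma pull_apply (g : G) (X : VField E M) (p : M) :
    pull g X p = (dsmul E g p).inverse (X (g • p)) := rfl

lemma mdifferentiableAt_smul_left (g : G) (p : M) :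
    MDifferentiableAt 𝓘(ℝ, E) 𝓘(ℝ, E) (fun q : M => g • q) p :=
  (SmoothConstSMul.contMDiff_smul g).mdifferentiableAt (by simp)

lemma dsmul_mul (g h : G) (p : M) :
    (dsmul E (g * h) p : E →L[ℝ] E) =
      ContinuousLinearMap.comp (dsmul E g (h • p) : E →L[ℝ] E) (dsmul E h p : E →L[ℝ] E) := by
  have h1 : (fun q : M => (g * h) • q) = (fun q : M => g • q) ∘ (fun q : M => h • q) := by
    funext q; exact mul_smul g h q
  have h2 := mfderiv_comp (I := 𝓘(ℝ, E)) (I' := 𝓘(ℝ, E)) (I'' := 𝓘(ℝ, E)) p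
    (mdifferentiableAt_smul_left g (h • p)) (mdifferentiableAt_smul_left h p)
  rw [← h1] at h2
  exact h2

lemma dsmul_one (p : M) : (dsmul E (1 : G) p : E →L[ℝ] E) = ContinuousLinearMap.id ℝ E := by
  have h1 : (fun q : M => (1 : G) • q) = id := by funext q; exact one_smul G q
  have h2 := mfderiv_id (I := 𝓘(ℝ, E)) (x := p)
  rw [← h1] at h2
  exact h2

lemma dsmul_of_eq_one {g : G} (hg : g = 1) (p : M) :
    (dsmul E g p : E →L[ℝ] E) = ContinuousLinearMap.id ℝ E := by
  subst hg; exact dsmul_one p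

lemma isInvertible_dsmul (g : G) (p : M) : (dsmul E g p).IsInvertible := by
  have h : ∀ q, q = p → (dsmul E g q : E →L[ℝ] E) = dsmul E g p := by rintro _ rfl; rfl
  refine ContinuousLinearMap.IsInvertible.of_inverse (g := (dsmul E g⁻¹ (g • p) : E →L[ℝ] E)) ?_ ?_
  · have h1 := dsmul_mul (E := E) g g⁻¹ (g • p)
    rw [dsmul_of_eq_one (mul_inv_cancel g), h _ (inv_smul_smul g p)] at h1
    exact h1.symm
  · have h1 := dsmul_mul (E := E) g⁻¹ g p
    rw [dsmul_of_eq_one (inv_mul_cancel g)] at h1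
    exact h1.symm

lemma dsmul_pull (g : G) (X : VField E M) (p : M) : dsmul E g p (pull g X p) = X (g • p) := by
  rw [pull_apply]
  exact (isInvertible_dsmul g p).self_apply_inverse _

lemma pull_eq_iff (g : G) (X : VField E M) (p : M) (v : TangentSpace 𝓘(ℝ, E) p) :
    pull g X p = v ↔ X (g • p) = dsmul E g p v := by
  rw [← dsmul_pull g X p]
  obtain ⟨e, he⟩ := isInvertible_dsmul (E := E) g p
  rw [← he]
  exact e.injective.eq_iff.symm

lemma pull_pull (g h : G) (X : VField E M) : pull g (pull h X) = pull (h * g) X := by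
  funext p
  have hq : ∀ q, q = h • g • p → (X q : E) = X (h • g • p) := by rintro _ rfl; rfl
  refine (pull_eq_iff g _ p _).2 ((pull_eq_iff h _ (g • p) _).2 ?_)
  have h1 : (X ((h * g) • p) : E) = dsmul E (h * g) p (pull (h * g) X p) :=
    (dsmul_pull (h * g) X p).symm
  have h2 := congrArg (fun L : E →L[ℝ] E => L (pull (h * g) X p)) (dsmul_mul (E := E) h g p)
  exact (hq _ (mul_smul h g p)).symm.trans (h1.trans h2)

lemma pull_one (X : VField E M) : pull (1 : G) X = X := by
  have h1 : (fun q : M => (1 : G) • q) = id := by funext q; exact one_smul G q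
  rw [pull, h1, mpullback_id]

lemma pull_inv_pull (g : G) (X : VField E M) : pull g⁻¹ (pull g X) = X := by
  rw [pull_pull, mul_inv_cancel, pull_one]

lemma pull_pull_inv (g : G) (X : VField E M) : pull g (pull g⁻¹ X) = X := by
  rw [pull_pull, inv_mul_cancel, pull_one]

lemma pull_add (g : G) (X Y : VField E M) : pull g (X + Y) = pull g X + pull g Y :=
  mpullback_add

lemma pull_smul (g : G) (c : ℝ) (X : VField E M) : pull g (c • X) = c • pull g X :=
  mpullback_const_smul

lemma pull_sub (g : G) (X Y : VField E M) : pull g (X - Y) = pull g X - pull g Y := by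
  funext p; exact map_sub _ _ _

lemma IsSmoothField.pull {X : VField E M} (hX : IsSmoothField X) (g : G) :
    IsSmoothField (pull g X) := by
  have : CompleteSpace E := FiniteDimensional.complete ℝ E
  exact ContMDiff.mpullback_vectorField (n := ∞) (m := ∞) hX (SmoothConstSMul.contMDiff_smul g)
    (fun p => isInvertible_dsmul g p) (by simp)

lemma pull_mlieBracket {X Y : VField E M} (hX : IsSmoothField X) (hY : IsSmoothField Y) (g : G) :
    pull g ⟦X, Y⟧ = ⟦pull g X, pull g Y⟧ := by
  have : CompleteSpace E := FiniteDimensional.complete ℝ E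
  have h : minSmoothness ℝ 2 ≤ ∞ := by
    rw [minSmoothness_of_isRCLikeNormedField]; exact WithTop.coe_le_coe.2 (le_top : (2 : ℕ∞) ≤ ⊤)
  funext p
  exact mpullback_mlieBracket (n := ∞) (hX.mdifferentiableAt _) (hY.mdifferentiableAt _)
    (SmoothConstSMul.contMDiff_smul g p) h

lemma der_pull (g : G) (X : VField E M) {f : M → ℝ} (hf : ContMDiff 𝓘(ℝ, E) 𝓘(ℝ, ℝ) ∞ f) (p : M) :
    der (pull g X) (fun q => f (g • q)) p = der X f (g • p) := by
  have h := mvfderiv_comp_apply (I' := 𝓘(ℝ, E)) (I := 𝓘(ℝ, E)) (g := f) (f := fun q : M => g • q) p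
    (hf.mdifferentiableAt (by simp)) (mdifferentiableAt_smul_left g p) (pull g X p)
  exact h.trans (congrArg _ (dsmul_pull g X p))

section Isometry

variable [T2Space M] [RiemannianBundle (fun p : M => TangentSpace 𝓘(ℝ, E) p)]
  [IsContMDiffRiemannianBundle 𝓘(ℝ, E) ∞ E (fun p : M => TangentSpace 𝓘(ℝ, E) p)]
  {D : CovariantDerivative 𝓘(ℝ, E) E (fun p : M => TangentSpace 𝓘(ℝ, E) p)}
  {X Y Z W : VField E M}

lemma ActsByIsometries.inn_pull (hG : ActsByIsometries E M G) (g : G) (X Y : VField E M) (p : M) :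
    inn (pull g X) (pull g Y) p = inn X Y (g • p) := by
  rw [inn, ← hG g p]
  exact congrArg₂ _ (dsmul_pull g X p) (dsmul_pull g Y p)

/-- Every term of Koszul's formula is natural under isometries. Testing against pulled-back fields
suffices, since every smooth field is one. -/
lemma ActsByIsometries.pull_nabla (hG : ActsByIsometries E M G) (hD : IsLeviCivita D)
    (hX : IsSmoothField X) (hY : IsSmoothField Y) (g : G) :
    pull g (nabla D X Y) = nabla D (pull g X) (pull g Y) := by
  have key : ∀ Z, IsSmoothField Z →
      inn (pull g (nabla D X Y)) (pull g Z) = inn (nabla D (pull g X) (pull g Y)) (pull g Z) := by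
    intro Z hZ
    have h1 := hD.koszul hX hY hZ
    have h2 := hD.koszul (hX.pull g) (hY.pull g) (hZ.pull g)
    have hi : ∀ X Y : VField E M, inn (pull g X) (pull g Y) = fun q => inn X Y (g • q) :=
      fun X Y => funext fun q => hG.inn_pull g X Y q
    have hd : ∀ {X Y : VField E M} (Z : VField E M), IsSmoothField X → IsSmoothField Y →
        der (pull g Z) (inn (pull g X) (pull g Y)) = fun q => der Z (inn X Y) (g • q) := by
      intro X Y Z hX hY
      rw [hi]
      exact funext fun q => der_pull g Z (contMDiff_inn hX hY) q
    rw [hd X hY hZ, hd Y hX hZ, hd Z hX hY, ← pull_mlieBracket hX hY, ← pull_mlieBracket hX hZ,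
      ← pull_mlieBracket hY hZ, hi, hi, hi] at h2
    rw [hi]
    funext p
    have h1 := congrFun h1 (g • p)
    have h2 := congrFun h2 p
    simp only [Pi.smul_apply, smul_eq_mul, Pi.add_apply, Pi.sub_apply] at h1 h2
    linarith
  refine eq_of_inn_eq fun Z hZ => ?_
  have := key _ (hZ.pull g⁻¹)
  rwa [pull_pull_inv] at this

lemma ActsByIsometries.pull_curvature (hG : ActsByIsometries E M G) (hD : IsLeviCivita D)
    (hX : IsSmoothField X) (hY : IsSmoothField Y) (hZ : IsSmoothField Z) (g : G) :
    pull g (curvature D X Y Z) = curvature D (pull g X) (pull g Y) (pull g Z) := by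
  simp only [curvature, pull_sub]
  rw [hG.pull_nabla hD hX (hD.isSmoothField_nabla hY hZ),
    hG.pull_nabla hD hY (hD.isSmoothField_nabla hX hZ), hG.pull_nabla hD hY hZ,
    hG.pull_nabla hD hX hZ, hG.pull_nabla hD (hX.mlieBracket hY) hZ, pull_mlieBracket hX hY]

lemma IsLeviCivita.mem_nullity_iff (hD : IsLeviCivita D) (hZ : IsSmoothField Z) (p : M) :
    Z p ∈ nullity D p ↔
      ∀ X Y, IsSmoothField X → IsSmoothField Y → curvature D X Y Z p = 0 := by
  refine ⟨fun h X Y hX hY => h X Y Z hX hY hZ rfl, fun h X Y V hX hY hV hVZ => ?_⟩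
  rw [hD.curvature_congr hX hY hV hX hY hZ rfl rfl hVZ, h X Y hX hY]

lemma ActsByIsometries.pull_mem_nullity (hG : ActsByIsometries E M G) (hD : IsLeviCivita D)
    (hZ : IsSmoothField Z) (g : G) {p : M} (h : Z (g • p) ∈ nullity D (g • p)) :
    pull g Z p ∈ nullity D p := by
  rw [hD.mem_nullity_iff (hZ.pull g)]
  intro X Y hX hY
  have h1 := congrFun (hG.pull_curvature hD (hX.pull g⁻¹) (hY.pull g⁻¹) hZ g) p
  rw [pull_pull_inv, pull_pull_inv] at h1
  rw [← h1, pull_eq_iff, map_zero]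
  exact h _ _ _ (hX.pull g⁻¹) (hY.pull g⁻¹) hZ rfl

lemma ActsByIsometries.dsmul_mem_nullity (hG : ActsByIsometries E M G) (hD : IsLeviCivita D)
    (g : G) {p : M} {v : TangentSpace 𝓘(ℝ, E) p} (h : v ∈ nullity D p) :
    dsmul E g p v ∈ nullity D (g • p) := by
  obtain ⟨Z, hZ, hZv⟩ := exists_isSmoothField_eq (E := E) (g • p) (dsmul E g p v)
  have h1 : pull g Z p = v := (pull_eq_iff g Z p v).2 hZv
  rw [← hZv, hD.mem_nullity_iff hZ]
  intro X Y hX hY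
  have h2 := congrFun (hG.pull_curvature hD hX hY hZ g) p
  rw [h _ _ _ (hX.pull g) (hY.pull g) (hZ.pull g) h1, pull_eq_iff, map_zero] at h2
  exact h2

lemma ActsByIsometries.dsmul_pull_nabla (hG : ActsByIsometries E M G) (hD : IsLeviCivita D)
    (hY : IsSmoothField Y) (g : G) (p : M) (v : TangentSpace 𝓘(ℝ, E) p) :
    dsmul E g p (D (pull g Y) p v) = D Y (g • p) (dsmul E g p v) := by
  obtain ⟨Z, hZ, hZv⟩ := exists_isSmoothField_eq (E := E) (g • p) (dsmul E g p v)
  have h1 : pull g Z p = v := (pull_eq_iff g Z p v).2 hZv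
  have h2 := congrFun (hG.pull_nabla hD hZ hY g) p
  rw [pull_eq_iff] at h2
  simp only [nabla] at h2
  rw [h1, hZv] at h2
  exact h2.symm

lemma ActsByIsometries.dsmul_mem_osculating (hG : ActsByIsometries E M G) (hD : IsLeviCivita D)
    (g : G) {p : M} {v : TangentSpace 𝓘(ℝ, E) p} (h : v ∈ osculating D (nullity D) p) :
    dsmul E g p v ∈ osculating D (nullity D) (g • p) := by
  suffices osculating D (nullity D) p ≤ (osculating D (nullity D) (g • p)).comap
      (dsmul E g p : TangentSpace 𝓘(ℝ, E) p →ₗ[ℝ] TangentSpace 𝓘(ℝ, E) (g • p)) from this h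
  refine sup_le (Submodule.span_le.2 fun v hv => ?_) (Submodule.span_le.2 ?_)
  · exact Submodule.mem_sup_left (Submodule.subset_span (hG.dsmul_mem_nullity hD g hv))
  · rintro _ ⟨X, w, hX, hXν, rfl⟩
    refine Submodule.mem_sup_right (Submodule.subset_span
      ⟨pull g⁻¹ X, dsmul E g p w, hX.pull g⁻¹, fun q => hG.pull_mem_nullity hD hX _ (hXν _), ?_⟩)
    have h1 := hG.dsmul_pull_nabla hD (hX.pull g⁻¹) g p w
    rw [pull_pull_inv] at h1
    exact h1.symm

end Isometry
end Pull

/-! ### Differentiating pullbacks in a vector space. -/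

section Flow

open VectorField Filter Topology

/-- The derivative of the pullbacks of a vector field along a smooth family of local diffeomorphisms
through the identity is the Lie bracket with the velocity field of the family. -/
theorem hasFDerivAt_inverse_fderiv_apply {F E : Type*} [NormedAddCommGroup F] [NormedSpace ℝ F]
    [NormedAddCommGroup E] [NormedSpace ℝ E] [CompleteSpace E] {Φ : F × E → E} {s₀ : F} {x₀ : E}
    (hΦ : ContDiffAt ℝ ∞ Φ (s₀, x₀)) (hid : ∀ᶠ x in 𝓝 x₀, Φ (s₀, x) = x) {y : E → E}
    (hy : DifferentiableAt ℝ y x₀) :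
    ∃ L : F →L[ℝ] E, HasFDerivAt
      (fun s => (fderiv ℝ (fun x => Φ (s, x)) x₀).inverse (y (Φ (s, x₀)))) L s₀ ∧
      ∀ w, L w = lieBracket ℝ (fun x => fderiv ℝ (fun s => Φ (s, x)) s₀ w) y x₀ := by
  set A : F × E → (F × E →L[ℝ] E) := fderiv ℝ Φ with hA
  have hd : ∀ᶠ z in 𝓝 (s₀, x₀), DifferentiableAt ℝ Φ z := by
    filter_upwards [(hΦ.of_le (m := 1) (by exact_mod_cast le_top)).eventually (by simp)] with z hz
    exact hz.differentiableAt (by simp)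
  have hAd : HasFDerivAt A (fderiv ℝ A (s₀, x₀)) (s₀, x₀) :=
    ((hΦ.fderiv_right (m := 1)
      (WithTop.coe_le_coe.2 (le_top : (1 + 1 : ℕ∞) ≤ ⊤))).differentiableAt (by simp)).hasFDerivAt
  -- Symmetry of second derivatives identifies the parameter derivative of the Jacobian with the
  -- space derivative of the velocity field.
  have hsymm : ∀ a b, fderiv ℝ A (s₀, x₀) a b = fderiv ℝ A (s₀, x₀) b a :=
    hΦ.isSymmSndFDerivAt (by
      rw [minSmoothness_of_isRCLikeNormedField]
      exact WithTop.coe_le_coe.2 (le_top : (2 : ℕ∞) ≤ ⊤))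
  have hx : ∀ᶠ s in 𝓝 s₀, fderiv ℝ (fun x => Φ (s, x)) x₀ =
      (A (s, x₀)).comp (ContinuousLinearMap.inr ℝ F E) := by
    have : Tendsto (fun s => (s, x₀)) (𝓝 s₀) (𝓝 (s₀, x₀)) :=
      (Continuous.prodMk_left x₀).tendsto s₀
    filter_upwards [this.eventually hd] with s hs
    exact (hs.hasFDerivAt.comp x₀ (hasFDerivAt_prodMk_right s x₀)).fderiv
  have hs : ∀ᶠ x in 𝓝 x₀, fderiv ℝ (fun s => Φ (s, x)) s₀ =
      (A (s₀, x)).comp (ContinuousLinearMap.inl ℝ F E) := by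
    have : Tendsto (fun x => (s₀, x)) (𝓝 x₀) (𝓝 (s₀, x₀)) :=
      (Continuous.prodMk_right s₀).tendsto x₀
    filter_upwards [this.eventually hd] with x hx
    exact (hx.hasFDerivAt.comp s₀ (hasFDerivAt_prodMk_left s₀ x)).fderiv
  have hΦ₀ : Φ (s₀, x₀) = x₀ := hid.self_of_nhds
  set B : F → (E →L[ℝ] E) := fun s => (A (s, x₀)).comp (ContinuousLinearMap.inr ℝ F E) with hB
  have hB₀ : B s₀ = ContinuousLinearMap.id ℝ E := by
    rw [show B s₀ = _ from hx.self_of_nhds.symm,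
      Filter.EventuallyEq.fderiv_eq (f := fun x => x) hid]
    exact fderiv_fun_id
  have hBd : HasFDerivAt B (((ContinuousLinearMap.compL ℝ E (F × E) E).flip
      (ContinuousLinearMap.inr ℝ F E)).comp ((fderiv ℝ A (s₀, x₀)).comp
      (ContinuousLinearMap.inl ℝ F E))) s₀ :=
    ((ContinuousLinearMap.compL ℝ E (F × E) E).flip
      (ContinuousLinearMap.inr ℝ F E)).hasFDerivAt.comp s₀
      (hAd.comp s₀ (hasFDerivAt_prodMk_left s₀ x₀))
  -- At the base parameter the Jacobian is the identity, where inversion has derivative `-id`; this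
  -- gives the negative term of the Lie bracket.
  have hinv := hasFDerivAt_ringInverse (𝕜 := ℝ) (1 : (E →L[ℝ] E)ˣ)
  have hB₀' : B s₀ = ((1 : (E →L[ℝ] E)ˣ) : E →L[ℝ] E) := hB₀
  rw [← hB₀'] at hinv
  have hm := hinv.comp s₀ hBd
  have hv : HasFDerivAt (fun s => y (Φ (s, x₀))) ((fderiv ℝ y x₀).comp
      ((A (s₀, x₀)).comp (ContinuousLinearMap.inl ℝ F E))) s₀ := by
    have h1 : HasFDerivAt y (fderiv ℝ y x₀) (Φ (s₀, x₀)) := by rw [hΦ₀]; exact hy.hasFDerivAt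
    exact h1.comp s₀ (hd.self_of_nhds.hasFDerivAt.comp s₀ (hasFDerivAt_prodMk_left s₀ x₀))
  have hmv := hm.clm_apply hv
  refine ⟨_, hmv.congr_of_eventuallyEq ?_, fun w => ?_⟩
  · filter_upwards [hx] with s hs
    simp only [hs, Function.comp_apply]
    rw [ContinuousLinearMap.ringInverse_eq_inverse]
  · have h1 : HasFDerivAt (fun x => A (s₀, x) (w, 0)) ((ContinuousLinearMap.apply ℝ E
        ((w, 0) : F × E)).comp ((fderiv ℝ A (s₀, x₀)).comp (ContinuousLinearMap.inr ℝ F E))) x₀ :=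
      (ContinuousLinearMap.apply ℝ E ((w, 0) : F × E)).hasFDerivAt.comp x₀
        (hAd.comp x₀ (hasFDerivAt_prodMk_right s₀ x₀))
    have h2 : (fun x => fderiv ℝ (fun s => Φ (s, x)) s₀ w) =ᶠ[𝓝 x₀] fun x => A (s₀, x) (w, 0) := by
      filter_upwards [hs] with x hx
      rw [hx]; simp
    have h3 : fderiv ℝ (fun s => Φ (s, x₀)) s₀ w = A (s₀, x₀) (w, 0) := h2.self_of_nhds
    rw [lieBracket, h2.fderiv_eq, h3, h1.fderiv]
    change Ring.inverse (B s₀) (fderiv ℝ y x₀ (A (s₀, x₀) (w, 0))) +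
      (-((((1 : (E →L[ℝ] E)ˣ)⁻¹ : (E →L[ℝ] E)ˣ) : E →L[ℝ] E) *
        (fderiv ℝ A (s₀, x₀) (w, 0)).comp (ContinuousLinearMap.inr ℝ F E) *
        (((1 : (E →L[ℝ] E)ˣ)⁻¹ : (E →L[ℝ] E)ˣ) : E →L[ℝ] E))) (y (Φ (s₀, x₀))) =
      _ - fderiv ℝ A (s₀, x₀) (0, y x₀) (w, 0)
    rw [hsymm (0, y x₀), hB₀', inv_one, Units.val_one, Ring.inverse_one, hΦ₀, mul_one, one_mul,
      sub_eq_add_neg]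
    rfl

end Flow

/-! ### Smoothness of induced fields, and vector fields read in charts. -/

section Induced

open VectorField Filter Topology

variable {E : Type*} [NormedAddCommGroup E] [NormedSpace ℝ E] [FiniteDimensional ℝ E]
  {M : Type*} [TopologicalSpace M] [ChartedSpace E M] [IsManifold 𝓘(ℝ, E) ∞ M]
  {F : Type*} [NormedAddCommGroup F] [NormedSpace ℝ F]
  {G : Type*} [TopologicalSpace G] [ChartedSpace F G] [Group G] [LieGroup 𝓘(ℝ, F) ∞ G]
  [MulAction G M] [ContMDiffSMul 𝓘(ℝ, F) 𝓘(ℝ, E) ∞ G M]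

local notation "⟦" X "," Y "⟧" => mlieBracket 𝓘(ℝ, E) X Y

lemma smoothConstSMul_of_contMDiffSMul (E : Type*) [NormedAddCommGroup E] [NormedSpace ℝ E]
    (M : Type*) [TopologicalSpace M] [ChartedSpace E M] (F : Type*) [NormedAddCommGroup F]
    [NormedSpace ℝ F] (G : Type*) [TopologicalSpace G] [ChartedSpace F G] [Group G] [MulAction G M]
    [ContMDiffSMul 𝓘(ℝ, F) 𝓘(ℝ, E) ∞ G M] : SmoothConstSMul E M G :=
  ⟨contMDiff_smul_left F⟩

/-- The differential of the action map, applied to a smooth family of tangent vectors. -/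
lemma contMDiffOn_mfderiv_smul_add {E' N : Type*} [NormedAddCommGroup E'] [NormedSpace ℝ E']
    [TopologicalSpace N] [ChartedSpace E' N] {s : Set N} {α : N → TangentBundle 𝓘(ℝ, F) G}
    {β : N → TangentBundle 𝓘(ℝ, E) M} (hα : ContMDiffOn 𝓘(ℝ, E') 𝓘(ℝ, F).tangent ∞ α s)
    (hβ : ContMDiffOn 𝓘(ℝ, E') 𝓘(ℝ, E).tangent ∞ β s) :
    ContMDiffOn 𝓘(ℝ, E') 𝓘(ℝ, E).tangent ∞ (fun q => (⟨(α q).1 • (β q).1,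
      mfderiv 𝓘(ℝ, F) 𝓘(ℝ, E) (fun g : G => g • (β q).1) (α q).1 (α q).2 +
      dsmul E (α q).1 (β q).1 (β q).2⟩ : TangentBundle 𝓘(ℝ, E) M)) s := by
  have hact : ContMDiff (𝓘(ℝ, F).prod 𝓘(ℝ, E)) 𝓘(ℝ, E) ∞ (fun z : G × M => z.1 • z.2) :=
    ContMDiffSMul.contMDiff_smul
  have h3 : ContMDiff (𝓘(ℝ, F).prod 𝓘(ℝ, E)).tangent 𝓘(ℝ, E).tangent ∞
      (tangentMap (𝓘(ℝ, F).prod 𝓘(ℝ, E)) 𝓘(ℝ, E) (fun z : G × M => z.1 • z.2)) :=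
    hact.contMDiff_tangentMap (by simp)
  have h2 : ContMDiff (𝓘(ℝ, F).tangent.prod 𝓘(ℝ, E).tangent) (𝓘(ℝ, F).prod 𝓘(ℝ, E)).tangent ∞
      (equivTangentBundleProd 𝓘(ℝ, F) G 𝓘(ℝ, E) M).symm := contMDiff_equivTangentBundleProd_symm
  refine (((h3.comp h2).comp_contMDiffOn (hα.prodMk hβ))).congr fun q _ => ?_
  simp only [Function.comp_apply, tangentMap]
  have := mfderiv_prod_eq_add_apply (I := 𝓘(ℝ, F)) (I' := 𝓘(ℝ, E)) (I'' := 𝓘(ℝ, E))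
    (p := ((α q).1, (β q).1)) (v := ((α q).2, (β q).2))
    (hact.mdifferentiableAt (by simp))
  exact congrArg (TotalSpace.mk _) this.symm

lemma totalSpace_mk_congr {p q : M} (h : q = p) (v : E) :
    (TotalSpace.mk q v : TangentBundle 𝓘(ℝ, E) M) = TotalSpace.mk p v := by
  subst h; rfl

/-- The differential of the action map, restricted to the constant vector `u` at `1` and the zero
section of `M`. -/
lemma isSmoothField_inducedField (u : GroupLieAlgebra 𝓘(ℝ, F) G) :
    IsSmoothField (inducedField u : VField E M) := by
  have hα : ContMDiffOn 𝓘(ℝ, E) 𝓘(ℝ, F).tangent ∞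
      (fun _ : M => (⟨1, u⟩ : TangentBundle 𝓘(ℝ, F) G)) Set.univ := contMDiffOn_const
  have hβ : ContMDiffOn 𝓘(ℝ, E) 𝓘(ℝ, E).tangent ∞
      (fun q : M => (⟨q, 0⟩ : TangentBundle 𝓘(ℝ, E) M)) Set.univ :=
    (contMDiff_zeroSection _ _).contMDiffOn
  refine contMDiffOn_univ.1 ((contMDiffOn_mfderiv_smul_add hα hβ).congr fun q _ => ?_)
  rw [map_zero, add_zero]
  exact (totalSpace_mk_congr (E := E) (one_smul G q) (inducedField u q)).symm

lemma isSmoothField_of_mem_killingG {X : VField E M} (hX : X ∈ killingG E M F G) :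
    IsSmoothField X := by
  obtain ⟨u, rfl⟩ := hX
  exact isSmoothField_inducedField u

/-- The action, read in charts at `1` and `p`. -/
def actInCharts (E F : Type*) [NormedAddCommGroup E] [NormedSpace ℝ E] [NormedAddCommGroup F]
    [NormedSpace ℝ F] (G : Type*) [TopologicalSpace G] [ChartedSpace F G] [Group G] {M : Type*}
    [TopologicalSpace M] [ChartedSpace E M] [MulAction G M] (p : M) (z : F × E) : E :=
  extChartAt 𝓘(ℝ, E) p ((extChartAt 𝓘(ℝ, F) (1 : G)).symm z.1 •
    (extChartAt 𝓘(ℝ, E) p).symm z.2)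

lemma contDiffAt_actInCharts (p : M) :
    ContDiffAt ℝ ∞ (actInCharts E F G p)
      (extChartAt 𝓘(ℝ, F) (1 : G) 1, extChartAt 𝓘(ℝ, E) p p) := by
  rw [← contMDiffAt_iff_contDiffAt]
  have h1 : ContMDiffAt 𝓘(ℝ, F × E) 𝓘(ℝ, F) ∞
      (fun z : F × E => (extChartAt 𝓘(ℝ, F) (1 : G)).symm z.1)
      (extChartAt 𝓘(ℝ, F) (1 : G) 1, extChartAt 𝓘(ℝ, E) p p) :=
    ContMDiffAt.comp (I' := 𝓘(ℝ, F)) (g := (extChartAt 𝓘(ℝ, F) (1 : G)).symm) _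
      ((contMDiffOn_extChartAt_symm (1 : G)).contMDiffAt
        ((isOpen_extChartAt_target _).mem_nhds (mem_extChartAt_target _)))
      contDiff_fst.contMDiff.contMDiffAt
  have h2 : ContMDiffAt 𝓘(ℝ, F × E) 𝓘(ℝ, E) ∞
      (fun z : F × E => (extChartAt 𝓘(ℝ, E) p).symm z.2)
      (extChartAt 𝓘(ℝ, F) (1 : G) 1, extChartAt 𝓘(ℝ, E) p p) :=
    ContMDiffAt.comp (I' := 𝓘(ℝ, E)) (g := (extChartAt 𝓘(ℝ, E) p).symm) _
      ((contMDiffOn_extChartAt_symm p).contMDiffAt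
        ((isOpen_extChartAt_target _).mem_nhds (mem_extChartAt_target _)))
      contDiff_snd.contMDiff.contMDiffAt
  refine (contMDiffAt_extChartAt' ?_).comp _ (h1.smul h2)
  simp

lemma inverse_mfderivWithin_extChartAt_symm {p q : M} (hq : q ∈ (extChartAt 𝓘(ℝ, E) p).source) :
    (mfderivWithin 𝓘(ℝ, E) 𝓘(ℝ, E) (extChartAt 𝓘(ℝ, E) p).symm (Set.range 𝓘(ℝ, E))
      (extChartAt 𝓘(ℝ, E) p q)).inverse =
      (mfderiv 𝓘(ℝ, E) 𝓘(ℝ, E) (extChartAt 𝓘(ℝ, E) p) q : E →L[ℝ] E) := by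
  refine ContinuousLinearMap.inverse_eq
    (f := (mfderivWithin 𝓘(ℝ, E) 𝓘(ℝ, E) (extChartAt 𝓘(ℝ, E) p).symm (Set.range 𝓘(ℝ, E))
      (extChartAt 𝓘(ℝ, E) p q) : E →L[ℝ] E)) ?_ ?_
  · exact mfderivWithin_extChartAt_symm_comp_mfderiv_extChartAt' hq
  · exact mfderiv_extChartAt_comp_mfderivWithin_extChartAt_symm' hq

/-- A vector field read in the chart at `p`. -/
def inChart (p : M) (Y : VField E M) : E → E :=
  mpullbackWithin 𝓘(ℝ, E) 𝓘(ℝ, E) (extChartAt 𝓘(ℝ, E) p).symm Y (Set.range 𝓘(ℝ, E))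

lemma inChart_apply {p q : M} (Y : VField E M) (hq : q ∈ (extChartAt 𝓘(ℝ, E) p).source) :
    inChart p Y (extChartAt 𝓘(ℝ, E) p q) =
      (mfderiv 𝓘(ℝ, E) 𝓘(ℝ, E) (extChartAt 𝓘(ℝ, E) p) q : E →L[ℝ] E) (Y q) := by
  have h1 : ∀ q', q' = q → (Y q' : E) = Y q := by rintro _ rfl; rfl
  rw [← inverse_mfderivWithin_extChartAt_symm hq]
  have h2 := h1 ((extChartAt 𝓘(ℝ, E) p).symm (extChartAt 𝓘(ℝ, E) p q))
    ((extChartAt 𝓘(ℝ, E) p).left_inv hq)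
  exact congrArg _ h2

lemma mlieBracket_eq_lieBracket_inChart (X Y : VField E M) (p : M) :
    (⟦X, Y⟧ p : E) = lieBracket ℝ (inChart p X) (inChart p Y) (extChartAt 𝓘(ℝ, E) p p) := by
  have h0 : ContinuousLinearMap.inverse
      (mfderiv 𝓘(ℝ, E) 𝓘(ℝ, E) (extChartAt 𝓘(ℝ, E) p) p : E →L[ℝ] E) =
      ContinuousLinearMap.id ℝ E := by
    have h : (mfderiv 𝓘(ℝ, E) 𝓘(ℝ, E) (extChartAt 𝓘(ℝ, E) p) p : E →L[ℝ] E) =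
      ContinuousLinearMap.id ℝ E := mfderiv_extChartAt_self (I := 𝓘(ℝ, E)) (x := p)
    rw [h]
    exact ContinuousLinearMap.inverse_id
  have h2 : (extChartAt 𝓘(ℝ, E) p).symm ⁻¹' Set.univ ∩ Set.range 𝓘(ℝ, E) = Set.univ := by simp
  have h3 : lieBracketWithin ℝ (inChart p X) (inChart p Y)
      ((extChartAt 𝓘(ℝ, E) p).symm ⁻¹' Set.univ ∩ Set.range 𝓘(ℝ, E)) =
    lieBracket ℝ (inChart p X) (inChart p Y) := by rw [h2, lieBracketWithin_univ]
  rw [← h3]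
  exact congrArg (fun L : E →L[ℝ] E => L (lieBracketWithin ℝ (inChart p X) (inChart p Y)
    ((extChartAt 𝓘(ℝ, E) p).symm ⁻¹' Set.univ ∩ Set.range 𝓘(ℝ, E))
    (extChartAt 𝓘(ℝ, E) p p))) h0

lemma differentiableAt_inChart {Y : VField E M} (hY : IsSmoothField Y) (p : M) :
    DifferentiableAt ℝ (inChart p Y) (extChartAt 𝓘(ℝ, E) p p) := by
  have : CompleteSpace E := FiniteDimensional.complete ℝ E
  have h := contMDiffWithinAt_mpullbackWithin_extChartAt_symm (n := ∞) (m := ∞) (I := 𝓘(ℝ, E))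
    (s := Set.univ) (hY p).contMDiffWithinAt (uniqueMDiffOn_univ) (Set.mem_univ p) (by simp)
  have h2 := contMDiffWithinAt_vectorSpace_iff_contDiffWithinAt.1 h
  refine (h2.contDiffAt ?_).differentiableAt (by simp)
  simpa using extChartAt_target_mem_nhds (I := 𝓘(ℝ, E)) p

end Induced

/-! ### The derivative of pullbacks along a group action is the Lie bracket. -/

section PullDeriv

open VectorField Filter Topology

lemma fderiv_comp_extChartAt_symm {E : Type*} [NormedAddCommGroup E] [NormedSpace ℝ E]
    {M : Type*} [TopologicalSpace M] [ChartedSpace E M] {E' : Type*} [NormedAddCommGroup E']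
    [NormedSpace ℝ E'] {f : M → E'} {p : M} (hf : MDifferentiableAt 𝓘(ℝ, E) 𝓘(ℝ, E') f p) (v : E) :
    fderiv ℝ (fun x => f ((extChartAt 𝓘(ℝ, E) p).symm x)) (extChartAt 𝓘(ℝ, E) p p) v =
      (mfderiv 𝓘(ℝ, E) 𝓘(ℝ, E') f p : E →L[ℝ] E') v := by
  have h2 : writtenInExtChartAt 𝓘(ℝ, E) 𝓘(ℝ, E') p f =
      fun x => f ((extChartAt 𝓘(ℝ, E) p).symm x) := by
    funext s
    simp only [writtenInExtChartAt, Function.comp_apply, extChartAt_model_space_eq_id,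
      PartialEquiv.refl_coe, id_eq]
  have h3 : HasFDerivWithinAt (fun x => f ((extChartAt 𝓘(ℝ, E) p).symm x))
      (mfderiv 𝓘(ℝ, E) 𝓘(ℝ, E') f p : E →L[ℝ] E') (Set.range 𝓘(ℝ, E))
      (extChartAt 𝓘(ℝ, E) p p) := h2 ▸ hf.hasMFDerivAt.2
  exact (h3.apply_eq_fderiv (by simp) v).symm

lemma _root_.ContinuousLinearMap.inverse_comp_apply_apply {E : Type*} [NormedAddCommGroup E]
    [NormedSpace ℝ E] {A B : E →L[ℝ] E} (hA : A.IsInvertible) (hB : B.IsInvertible) (v : E) :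
    (A.comp B).inverse (A v) = B.inverse v := by
  obtain ⟨c, rfl⟩ := hA
  obtain ⟨d, rfl⟩ := hB
  have : ContinuousLinearMap.comp (c : E →L[ℝ] E) (d : E →L[ℝ] E) = (d.trans c : E ≃L[ℝ] E) := rfl
  rw [this, ContinuousLinearMap.inverse_equiv, ContinuousLinearMap.inverse_equiv]
  simp

variable {E : Type*} [NormedAddCommGroup E] [NormedSpace ℝ E] [FiniteDimensional ℝ E]
  {M : Type*} [TopologicalSpace M] [ChartedSpace E M] [IsManifold 𝓘(ℝ, E) ∞ M]
  {F : Type*} [NormedAddCommGroup F] [NormedSpace ℝ F]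
  {G : Type*} [TopologicalSpace G] [ChartedSpace F G] [Group G] [LieGroup 𝓘(ℝ, F) ∞ G]
  [MulAction G M] [ContMDiffSMul 𝓘(ℝ, F) 𝓘(ℝ, E) ∞ G M]

local notation "⟦" X "," Y "⟧" => mlieBracket 𝓘(ℝ, E) X Y

lemma mdifferentiableAt_extChartAt_self {p q : M} (hq : q ∈ (extChartAt 𝓘(ℝ, E) p).source) :
    MDifferentiableAt 𝓘(ℝ, E) 𝓘(ℝ, E) (extChartAt 𝓘(ℝ, E) p) q :=
  mdifferentiableAt_extChartAt (by simpa using hq)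

lemma eventually_smul_mem (E : Type*) [NormedAddCommGroup E] [NormedSpace ℝ E]
    {M : Type*} [TopologicalSpace M] [ChartedSpace E M] [IsManifold 𝓘(ℝ, E) ∞ M]
    {F : Type*} [NormedAddCommGroup F] [NormedSpace ℝ F]
    {G : Type*} [TopologicalSpace G] [ChartedSpace F G] [Group G] [LieGroup 𝓘(ℝ, F) ∞ G]
    [MulAction G M] [ContMDiffSMul 𝓘(ℝ, F) 𝓘(ℝ, E) ∞ G M] (p : M) {U : Set M} (hU : U ∈ 𝓝 p) :
    ∀ᶠ s in 𝓝 (extChartAt 𝓘(ℝ, F) (1 : G) 1),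
      (extChartAt 𝓘(ℝ, F) (1 : G)).symm s • p ∈ U := by
  have h : ContinuousAt (fun s => (extChartAt 𝓘(ℝ, F) (1 : G)).symm s • p)
      (extChartAt 𝓘(ℝ, F) (1 : G) 1) :=
    ContinuousAt.comp (g := fun g : G => g • p)
      (contMDiff_orbit (F := F) (E := E) p).continuous.continuousAt (continuousAt_extChartAt_symm _)
  refine h.preimage_mem_nhds ?_
  rwa [extChartAt_to_inv, one_smul]

lemma fderiv_actInCharts_left {p : M} {x : E} (hx : x ∈ (extChartAt 𝓘(ℝ, E) p).target)
    (w : GroupLieAlgebra 𝓘(ℝ, F) G) :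
    fderiv ℝ (fun s => actInCharts E F G p (s, x)) (extChartAt 𝓘(ℝ, F) (1 : G) 1) w =
      inChart p (inducedField w) x := by
  obtain ⟨q, hq, rfl⟩ : ∃ q ∈ (extChartAt 𝓘(ℝ, E) p).source, extChartAt 𝓘(ℝ, E) p q = x :=
    ⟨_, (extChartAt 𝓘(ℝ, E) p).map_target hx, (extChartAt 𝓘(ℝ, E) p).right_inv hx⟩
  have hq1 : (1 : G) • q ∈ (extChartAt 𝓘(ℝ, E) p).source := by rwa [one_smul]
  have hχ := mdifferentiableAt_extChartAt_self hq1
  have ho : MDifferentiableAt 𝓘(ℝ, F) 𝓘(ℝ, E) (fun g : G => g • q) 1 :=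
    (contMDiff_orbit q).mdifferentiableAt (by simp)
  rw [inChart_apply _ hq]
  have h1 := fderiv_comp_extChartAt_symm (hχ.comp 1 ho) w
  have h2 := congrArg (fun L : F →L[ℝ] E => L w) (mfderiv_comp 1 hχ ho)
  have h3 : ∀ q', q' = q → (mfderiv 𝓘(ℝ, E) 𝓘(ℝ, E) (extChartAt 𝓘(ℝ, E) p) q' : E →L[ℝ] E) =
      mfderiv 𝓘(ℝ, E) 𝓘(ℝ, E) (extChartAt 𝓘(ℝ, E) p) q := by rintro _ rfl; rfl
  have h4 : (fun s => actInCharts E F G p (s, extChartAt 𝓘(ℝ, E) p q)) =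
      fun s => (extChartAt 𝓘(ℝ, E) p ∘ fun g : G => g • q)
        ((extChartAt 𝓘(ℝ, F) (1 : G)).symm s) := by
    funext s
    simp only [actInCharts, Function.comp_apply]
    rw [(extChartAt 𝓘(ℝ, E) p).left_inv hq]
  rw [h4, ← h3 _ (one_smul G q)]
  exact h1.trans h2

lemma inverse_fderiv_actInCharts_apply {p : M} {s : F} (Y : VField E M)
    (hs : (extChartAt 𝓘(ℝ, F) (1 : G)).symm s • p ∈ (extChartAt 𝓘(ℝ, E) p).source) :
    (fderiv ℝ (fun x => actInCharts E F G p (s, x)) (extChartAt 𝓘(ℝ, E) p p)).inverse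
      (inChart p Y (actInCharts E F G p (s, extChartAt 𝓘(ℝ, E) p p))) =
      pull ((extChartAt 𝓘(ℝ, F) (1 : G)).symm s) Y p := by
  have := smoothConstSMul_of_contMDiffSMul E M F G
  set g := (extChartAt 𝓘(ℝ, F) (1 : G)).symm s with hg
  have h0 : actInCharts E F G p (s, extChartAt 𝓘(ℝ, E) p p) = extChartAt 𝓘(ℝ, E) p (g • p) := by
    simp only [actInCharts, extChartAt_to_inv, ← hg]
  rw [h0, inChart_apply _ hs, pull_apply]
  have h1 : fderiv ℝ (fun x => actInCharts E F G p (s, x)) (extChartAt 𝓘(ℝ, E) p p) =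
      ContinuousLinearMap.comp
        (mfderiv 𝓘(ℝ, E) 𝓘(ℝ, E) (extChartAt 𝓘(ℝ, E) p) (g • p) : E →L[ℝ] E) (dsmul E g p) := by
    ext v
    have hχ := mdifferentiableAt_extChartAt_self hs
    have h1 := fderiv_comp_extChartAt_symm (hχ.comp p (mdifferentiableAt_smul_left g p)) v
    exact h1.trans (congrArg (fun L : E →L[ℝ] E => L v)
      (mfderiv_comp p hχ (mdifferentiableAt_smul_left g p)))
  rw [h1]
  have hA : (mfderiv 𝓘(ℝ, E) 𝓘(ℝ, E) (extChartAt 𝓘(ℝ, E) p) (g • p) : E →L[ℝ] E).IsInvertible :=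
    isInvertible_mfderiv_extChartAt hs
  have hB : (dsmul E g p : E →L[ℝ] E).IsInvertible := isInvertible_dsmul g p
  exact ContinuousLinearMap.inverse_comp_apply_apply (E := E) hA hB _

/-- The derivative of the pullbacks of a vector field under a Lie group action is the Lie bracket
with the induced field. -/
theorem hasFDerivAt_pull {Y : VField E M} (hY : IsSmoothField Y) (p : M) :
    ∃ L : F →L[ℝ] E, HasFDerivAt
      (fun s => (pull ((extChartAt 𝓘(ℝ, F) (1 : G)).symm s) Y p : E)) L
      (extChartAt 𝓘(ℝ, F) (1 : G) 1) ∧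
      ∀ w : F, L w = ⟦inducedField (F := F) (G := G) w, Y⟧ p := by
  have : CompleteSpace E := FiniteDimensional.complete ℝ E
  have ht := extChartAt_target_mem_nhds (I := 𝓘(ℝ, E)) p
  obtain ⟨L, hL, hLw⟩ := hasFDerivAt_inverse_fderiv_apply
    (contDiffAt_actInCharts (F := F) (G := G) p)
    (by filter_upwards [ht] with x hx
        simp only [actInCharts]
        rw [extChartAt_to_inv, one_smul, (extChartAt 𝓘(ℝ, E) p).right_inv hx])
    (differentiableAt_inChart hY p)
  refine ⟨L, hL.congr_of_eventuallyEq ?_, fun w => ?_⟩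
  · filter_upwards [eventually_smul_mem E p (extChartAt_source_mem_nhds (I := 𝓘(ℝ, E)) p)] with s hs
    exact (inverse_fderiv_actInCharts_apply Y hs).symm
  · rw [hLw, mlieBracket_eq_lieBracket_inChart]
    refine Filter.EventuallyEq.lieBracket_vectorField_eq ?_ EventuallyEq.rfl
    filter_upwards [ht] with x hx
    exact fderiv_actInCharts_left hx w

end PullDeriv

/-! ### The Killing equation, and closure of `𝒦^G(M)` under brackets. -/

section Killing

open VectorField Filter Topology

lemma _root_.HasFDerivAt.apply_mem_of_eventually_mem {F E : Type*} [NormedAddCommGroup F]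
    [NormedSpace ℝ F] [NormedAddCommGroup E] [NormedSpace ℝ E] [FiniteDimensional ℝ E] {f : F → E}
    {L : F →L[ℝ] E} {x : F} (h : HasFDerivAt f L x) {S : Submodule ℝ E} (hS : ∀ᶠ s in 𝓝 x, f s ∈ S)
    (w : F) : L w ∈ S := by
  obtain ⟨pr, hpr⟩ : ∃ pr : E →L[ℝ] S, ∀ x : S, pr x = x :=
    Submodule.ClosedComplemented.of_finiteDimensional S
  have h1 := (S.subtypeL.comp pr).hasFDerivAt.comp x h
  have h2 : (S.subtypeL.comp pr) ∘ f =ᶠ[𝓝 x] f := by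
    filter_upwards [hS] with s hs
    simp [hpr ⟨f s, hs⟩]
  have h3 := congrArg (fun L : F →L[ℝ] E => L w) ((h1.congr_of_eventuallyEq h2.symm).unique h)
  simp only [ContinuousLinearMap.comp_apply] at h3
  rw [← h3]
  exact (pr (L w)).2

lemma _root_.HasFDerivAt.fderiv_bilin_apply {F E : Type*} [NormedAddCommGroup F]
    [NormedSpace ℝ F] [NormedAddCommGroup E] [NormedSpace ℝ E] {f g : F → E} {f' g' : F →L[ℝ] E}
    {x : F} (hf : HasFDerivAt f f' x) (hg : HasFDerivAt g g' x) (B : E →L[ℝ] E →L[ℝ] ℝ) (w : F) :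
    fderiv ℝ (fun s => B (f s) (g s)) x w = B (f' w) (g x) + B (f x) (g' w) := by
  rw [(B.hasFDerivAt_of_bilinear hf hg).fderiv, add_comm]
  rfl

variable {E : Type*} [NormedAddCommGroup E] [NormedSpace ℝ E] [FiniteDimensional ℝ E]
  {M : Type*} [TopologicalSpace M] [ChartedSpace E M] [IsManifold 𝓘(ℝ, E) ∞ M]
  {F : Type*} [NormedAddCommGroup F] [NormedSpace ℝ F]
  {G : Type*} [TopologicalSpace G] [ChartedSpace F G] [Group G] [LieGroup 𝓘(ℝ, F) ∞ G]
  [MulAction G M] [ContMDiffSMul 𝓘(ℝ, F) 𝓘(ℝ, E) ∞ G M]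
  {X Y Z W : VField E M}

local notation "⟦" X "," Y "⟧" => mlieBracket 𝓘(ℝ, E) X Y

lemma hasFDerivAt_orbit {f : M → ℝ} (hf : ContMDiff 𝓘(ℝ, E) 𝓘(ℝ, ℝ) ∞ f) (p : M) (w : F) :
    fderiv ℝ (fun s => f ((extChartAt 𝓘(ℝ, F) (1 : G)).symm s • p))
      (extChartAt 𝓘(ℝ, F) (1 : G) 1) w =
      der (inducedField (F := F) (G := G) w : VField E M) f p := by
  have hf1 : MDifferentiableAt 𝓘(ℝ, E) 𝓘(ℝ, ℝ) f ((1 : G) • p) := hf.mdifferentiableAt (by simp)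
  have ho : MDifferentiableAt 𝓘(ℝ, F) 𝓘(ℝ, E) (fun g : G => g • p) 1 :=
    (contMDiff_orbit p).mdifferentiableAt (by simp)
  have h1 := fderiv_comp_extChartAt_symm (hf1.comp 1 ho) w
  have h2 := congrArg (fun L : F →L[ℝ] ℝ => L w) (mfderiv_comp 1 hf1 ho)
  have h3 : ∀ q', q' = p → (mfderiv 𝓘(ℝ, E) 𝓘(ℝ, ℝ) f q' : E →L[ℝ] ℝ) =
      mfderiv 𝓘(ℝ, E) 𝓘(ℝ, ℝ) f p := by rintro _ rfl; rfl
  refine (h1.trans h2).trans ?_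
  exact congrArg (fun L : E →L[ℝ] ℝ => L (inducedField (F := F) (G := G) w p))
    (h3 _ (one_smul G p))

section Metric

variable [T2Space M] [RiemannianBundle (fun p : M => TangentSpace 𝓘(ℝ, E) p)]
  [IsContMDiffRiemannianBundle 𝓘(ℝ, E) ∞ E (fun p : M => TangentSpace 𝓘(ℝ, E) p)]
  {D : CovariantDerivative 𝓘(ℝ, E) E (fun p : M => TangentSpace 𝓘(ℝ, E) p)}

/-- The inner product on a tangent space as a bilinear form on the model space. -/
lemma exists_inner_eq (p : M) : ∃ B : E →L[ℝ] E →L[ℝ] ℝ,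
    ∀ v w : TangentSpace 𝓘(ℝ, E) p, inner ℝ v w = B v w := by
  obtain ⟨g, -, hg⟩ := IsContMDiffRiemannianBundle.exists_contMDiff (IB := 𝓘(ℝ, E)) (n := ∞)
    (F := E) (E := fun p : M => TangentSpace 𝓘(ℝ, E) p)
  exact ⟨g p, fun v w => hg p v w⟩

/-- The fields induced by a group of isometries satisfy the Killing equation. -/
lemma ActsByIsometries.der_inducedField_inn (hG : ActsByIsometries E M G) (hY : IsSmoothField Y)
    (hZ : IsSmoothField Z) (w : GroupLieAlgebra 𝓘(ℝ, F) G) :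
    der (inducedField w : VField E M) (inn Y Z) =
      inn ⟦inducedField w, Y⟧ Z + inn Y ⟦inducedField w, Z⟧ := by
  have := smoothConstSMul_of_contMDiffSMul E M F G
  funext p
  obtain ⟨B, hB⟩ := exists_inner_eq (E := E) p
  obtain ⟨L₁, h₁, hL₁⟩ := hasFDerivAt_pull (F := F) (G := G) hY p
  obtain ⟨L₂, h₂, hL₂⟩ := hasFDerivAt_pull (F := F) (G := G) hZ p
  have h6 := HasFDerivAt.fderiv_bilin_apply (E := E) h₁ h₂ B w
  have h4 : (fun s => B (pull ((extChartAt 𝓘(ℝ, F) (1 : G)).symm s) Y p)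
      (pull ((extChartAt 𝓘(ℝ, F) (1 : G)).symm s) Z p)) =
      fun s => inn Y Z ((extChartAt 𝓘(ℝ, F) (1 : G)).symm s • p) := by
    funext s
    rw [← hB]
    exact hG.inn_pull _ Y Z p
  have h5 := hasFDerivAt_orbit (F := F) (G := G) (contMDiff_inn hY hZ) p w
  rw [h4] at h6
  rw [← h5]
  refine h6.trans ?_
  have e1 : (pull ((extChartAt 𝓘(ℝ, F) (1 : G)).symm (extChartAt 𝓘(ℝ, F) (1 : G) 1)) Y) = Y := by
    rw [extChartAt_to_inv, pull_one]
  have e2 : (pull ((extChartAt 𝓘(ℝ, F) (1 : G)).symm (extChartAt 𝓘(ℝ, F) (1 : G) 1)) Z) = Z := by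
    rw [extChartAt_to_inv, pull_one]
  have h7 : ∀ v v' u u' : E, v = v' → u = u' → B v (Z p) + B (Y p) u = B v' (Z p) + B (Y p) u' := by
    rintro v _ u _ rfl rfl; rfl
  rw [e1, e2]
  refine (h7 _ _ _ _ (hL₁ w) (hL₂ w)).trans ?_
  exact (congrArg₂ (· + ·) (hB _ _) (hB _ _)).symm

/-- The Killing equation with brackets rewritten by vanishing torsion; metric compatibility cancels
the derivatives along `W`. -/
lemma ActsByIsometries.nabla_skew (hG : ActsByIsometries E M G) (hD : IsLeviCivita D)
    (hW : W ∈ killingG E M F G) (hY : IsSmoothField Y) (hZ : IsSmoothField Z) :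
    inn (nabla D Y W) Z + inn Y (nabla D Z W) = 0 := by
  have hWs := isSmoothField_of_mem_killingG hW
  obtain ⟨w, rfl⟩ := hW
  have h := hG.der_inducedField_inn hY hZ w
  rw [hD.der_inn hY hZ, ← hD.nabla_sub_nabla hWs hY, ← hD.nabla_sub_nabla hWs hZ] at h
  rw [inn_comm Y, inn_comm Y, inn_sub_left, inn_sub_left] at h
  rw [inn_comm Y]
  linear_combination (norm := module) h

variable (D) in
/-- The nullity as a submodule. -/
def nullitySubmodule (hD : IsLeviCivita D) (p : M) : Submodule ℝ (TangentSpace 𝓘(ℝ, E) p) where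
  carrier := nullity D p
  zero_mem' := (hD.mem_nullity_iff isSmoothField_zero p).2 fun X Y hX hY => by
    have h := hD.curvature_const_smul hX hY (isSmoothField_zero (E := E) (M := M)) 0
    rw [smul_zero, zero_smul] at h
    rw [h]; rfl
  add_mem' := by
    intro v w hv hw
    obtain ⟨V, hV, rfl⟩ := exists_isSmoothField_eq p v
    obtain ⟨W, hW, rfl⟩ := exists_isSmoothField_eq p w
    refine (hD.mem_nullity_iff (hV.add hW) p).2 fun X Y hX hY => ?_
    rw [hD.curvature_add hX hY hV hW]
    refine (congrArg₂ (· + ·) ((hD.mem_nullity_iff hV p).1 hv X Y hX hY)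
      ((hD.mem_nullity_iff hW p).1 hw X Y hX hY)).trans (add_zero _)
  smul_mem' := by
    intro c v hv
    obtain ⟨V, hV, rfl⟩ := exists_isSmoothField_eq p v
    refine (hD.mem_nullity_iff (hV.const_smul c) p).2 fun X Y hX hY => ?_
    rw [hD.curvature_const_smul hX hY hV]
    exact (congrArg (c • ·) ((hD.mem_nullity_iff hV p).1 hv X Y hX hY)).trans (smul_zero _)

/-- The bracket is a derivative of pullbacks of `Y` by isometries, all of which take values in the
linear subspace of nullity vectors at `p`. -/
lemma ActsByIsometries.mlieBracket_mem_nullity (hG : ActsByIsometries E M G) (hD : IsLeviCivita D)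
    (hW : W ∈ killingG E M F G) (hY : IsSmoothField Y) (hYν : ∀ q, Y q ∈ nullity D q) (p : M) :
    ⟦W, Y⟧ p ∈ nullity D p := by
  have := smoothConstSMul_of_contMDiffSMul E M F G
  obtain ⟨w, rfl⟩ := hW
  obtain ⟨L, h, hL⟩ := hasFDerivAt_pull (F := F) (G := G) hY p
  let S : Submodule ℝ E := nullitySubmodule D hD p
  have h1 : L w ∈ S := HasFDerivAt.apply_mem_of_eventually_mem (E := E) (S := S) h
    (Eventually.of_forall fun s => hG.pull_mem_nullity hD hY _ (hYν _)) w
  have h2 : ∀ v : E, v = ⟦inducedField w, Y⟧ p → v ∈ S → ⟦inducedField w, Y⟧ p ∈ nullity D p := by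
    rintro _ rfl h
    exact h
  exact h2 _ (hL w) h1

end Metric

section Bracket

variable [FiniteDimensional ℝ F]

/-- The witness is `Ad (g⁻¹) u`, the differential of conjugation: `x • (g • p) = g • ((g⁻¹ * x * g)
• p)`. -/
lemma pull_inducedField (g : G) (u : GroupLieAlgebra 𝓘(ℝ, F) G) :
    ∃ u' : GroupLieAlgebra 𝓘(ℝ, F) G, pull g (inducedField u : VField E M) = inducedField u' := by
  have := smoothConstSMul_of_contMDiffSMul E M F G
  let cj : G → G := fun x => g⁻¹ * x * g
  have hcj : MDifferentiableAt 𝓘(ℝ, F) 𝓘(ℝ, F) cj 1 := by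
    have : ContMDiff 𝓘(ℝ, F) 𝓘(ℝ, F) ∞ cj :=
      (contMDiff_mul_right (I := 𝓘(ℝ, F)) (n := ∞) (a := g)).comp
        (contMDiff_mul_left (I := 𝓘(ℝ, F)) (n := ∞) (a := g⁻¹))
    exact this.mdifferentiableAt (by simp)
  have hc1 : cj 1 = 1 := by simp [cj]
  refine ⟨(mfderiv 𝓘(ℝ, F) 𝓘(ℝ, F) cj 1 : F →L[ℝ] F) u, ?_⟩
  funext p
  rw [pull_eq_iff]
  have ho : ∀ (q : M) (x : G), MDifferentiableAt 𝓘(ℝ, F) 𝓘(ℝ, E) (fun g : G => g • q) x :=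
    fun q x => (contMDiff_orbit q).mdifferentiableAt (by simp)
  have h1 : (fun x : G => x • (g • p)) = (fun q : M => g • q) ∘ ((fun x : G => x • p) ∘ cj) := by
    funext x
    simp only [Function.comp_apply, cj]
    rw [smul_smul, smul_smul]
    congr 1
    group
  have h2 := mfderiv_comp (I := 𝓘(ℝ, F)) (I' := 𝓘(ℝ, E)) (I'' := 𝓘(ℝ, E)) (1 : G)
    (mdifferentiableAt_smul_left g (cj 1 • p)) ((ho p (cj 1)).comp 1 hcj)
  have h3 := mfderiv_comp (I := 𝓘(ℝ, F)) (I' := 𝓘(ℝ, F)) (I'' := 𝓘(ℝ, E)) (1 : G) (ho p (cj 1)) hcj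
  have h4 : ∀ x : G, x = 1 → ∀ v : F,
      (mfderiv 𝓘(ℝ, E) 𝓘(ℝ, E) (fun q : M => g • q) (x • p) : E →L[ℝ] E)
        ((mfderiv 𝓘(ℝ, F) 𝓘(ℝ, E) (fun g : G => g • p) x : F →L[ℝ] E) v) =
      (mfderiv 𝓘(ℝ, E) 𝓘(ℝ, E) (fun q : M => g • q) p : E →L[ℝ] E)
        ((mfderiv 𝓘(ℝ, F) 𝓘(ℝ, E) (fun g : G => g • p) 1 : F →L[ℝ] E) v) := by
    rintro _ rfl v
    have : ∀ q', q' = p → (mfderiv 𝓘(ℝ, E) 𝓘(ℝ, E) (fun q : M => g • q) q' : E →L[ℝ] E) =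
      mfderiv 𝓘(ℝ, E) 𝓘(ℝ, E) (fun q : M => g • q) p := by rintro _ rfl; rfl
    rw [this _ (one_smul G p)]
    rfl
  refine Eq.trans ?_ (h4 _ hc1 _)
  have h5 : (inducedField u (g • p) : E) = (mfderiv 𝓘(ℝ, F) 𝓘(ℝ, E)
      ((fun q : M => g • q) ∘ ((fun x : G => x • p) ∘ cj)) 1 : F →L[ℝ] E) u := by
    rw [← h1]; rfl
  rw [h5]
  refine (congrArg (fun L : F →L[ℝ] E => L u) h2).trans ?_
  exact congrArg (mfderiv 𝓘(ℝ, E) 𝓘(ℝ, E) (fun q : M => g • q) (cj 1 • p) : E →L[ℝ] E)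
    (congrArg (fun L : F →L[ℝ] E => L u) h3)

lemma pull_mem_killingG (g : G) (hX : X ∈ killingG E M F G) : pull g X ∈ killingG E M F G := by
  obtain ⟨u, rfl⟩ := hX
  obtain ⟨u', h⟩ := pull_inducedField (E := E) (M := M) g u
  exact ⟨u', h.symm⟩

/-- The linear map sending an element of the Lie algebra to the field it induces. -/
def inducedFieldₗ (E : Type*) [NormedAddCommGroup E] [NormedSpace ℝ E]
    (M : Type*) [TopologicalSpace M] [ChartedSpace E M] (F : Type*) [NormedAddCommGroup F]
    [NormedSpace ℝ F] (G : Type*) [TopologicalSpace G] [ChartedSpace F G] [Group G]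
    [MulAction G M] : F →ₗ[ℝ] VField E M where
  toFun w := inducedField (F := F) (G := G) w
  map_add' u w := by funext p; exact map_add _ _ _
  map_smul' c u := by funext p; exact map_smul _ _ _

instance finiteDimensional_killingG : FiniteDimensional ℝ (killingG E M F G) := by
  have : killingG E M F G = LinearMap.range (inducedFieldₗ E M F G) := by
    ext X; rfl
  rw [this]
  infer_instance

/-- The bracket is a pointwise limit of difference quotients of pullbacks, which lie in `𝒦^G(M)`. A
finite-dimensional subspace is closed for pointwise convergence. -/
lemma mlieBracket_mem_killingG (hW : W ∈ killingG E M F G) (hZ : Z ∈ killingG E M F G) :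
    ⟦W, Z⟧ ∈ killingG E M F G := by
  have := smoothConstSMul_of_contMDiffSMul E M F G
  have hZs := isSmoothField_of_mem_killingG hZ
  obtain ⟨w, rfl⟩ : ∃ w : F, inducedField (F := F) (G := G) w = W := hW
  let K : Submodule ℝ (M → E) := killingG E M F G
  have hKf : FiniteDimensional ℝ K := finiteDimensional_killingG (E := E) (M := M) (F := F) (G := G)
  have hK : IsClosed (K : Set (M → E)) := K.closed_of_finiteDimensional
  let c : ℝ → (M → E) := fun t => t⁻¹ • ((fun p => pull ((extChartAt 𝓘(ℝ, F) (1 : G)).symm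
    (extChartAt 𝓘(ℝ, F) (1 : G) 1 + t • w)) Z p : M → E) - fun p => Z p)
  have hc : Tendsto c (𝓝[≠] 0) (𝓝 (fun p => ⟦inducedField (F := F) (G := G) w, Z⟧ p : M → E)) := by
    refine tendsto_pi_nhds.2 fun p => ?_
    obtain ⟨L, h, hL⟩ := hasFDerivAt_pull (F := F) (G := G) hZs p
    have h1 := (HasFDerivAt.hasLineDerivAt (E := F) (F := E) h w).tendsto_slope_zero
    have h2 : ∀ v v' : E, v = v' → ∀ f : ℝ → E, Tendsto f (𝓝[≠] 0) (𝓝 v) →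
      Tendsto f (𝓝[≠] 0) (𝓝 v') := by rintro v _ rfl f h; exact h
    refine (h2 _ _ (hL w) _ h1).congr fun t => ?_
    have e1 : (pull ((extChartAt 𝓘(ℝ, F) (1 : G)).symm (extChartAt 𝓘(ℝ, F) (1 : G) 1)) Z) = Z := by
      rw [extChartAt_to_inv, pull_one]
    rw [e1]
    rfl
  refine hK.mem_of_tendsto hc (Eventually.of_forall fun t => ?_)
  exact K.smul_mem _ (K.sub_mem (pull_mem_killingG _ hZ) hZ)

end Bracket
end Killing

/-! ### Ideals of `𝒦^G(M)` under the group, and constancy of equivariant families. -/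

section Adjoint

open VectorField Filter Topology Set

variable {E : Type*} [NormedAddCommGroup E] [NormedSpace ℝ E] [FiniteDimensional ℝ E]
  {M : Type*} [TopologicalSpace M] [ChartedSpace E M] [IsManifold 𝓘(ℝ, E) ∞ M]
  {F : Type*} [NormedAddCommGroup F] [NormedSpace ℝ F] [FiniteDimensional ℝ F]
  {G : Type*} [TopologicalSpace G] [ChartedSpace F G] [Group G] [LieGroup 𝓘(ℝ, F) ∞ G]
  [MulAction G M] [ContMDiffSMul 𝓘(ℝ, F) 𝓘(ℝ, E) ∞ G M]
  {X Y Z W : VField E M}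

local notation "⟦" X "," Y "⟧" => mlieBracket 𝓘(ℝ, E) X Y

variable (E M F G) in
/-- The bracket of an induced field with an element of `𝒦^G(M)`, as a bilinear map. -/
def adK : F →ₗ[ℝ] killingG E M F G →ₗ[ℝ] killingG E M F G :=
  LinearMap.mk₂ ℝ (fun w Z => ⟨⟦inducedField (F := F) (G := G) w, Z.1⟧,
      mlieBracket_mem_killingG ⟨w, rfl⟩ Z.2⟩)
    (fun w w' Z => by
      refine Subtype.ext (funext fun p => ?_)
      have : CompleteSpace E := FiniteDimensional.complete ℝ E
      have h : (inducedField (F := F) (G := G) (w + w') : VField E M) =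
        inducedField (F := F) (G := G) w + inducedField (F := F) (G := G) w' :=
        map_add (inducedFieldₗ E M F G) w w'
      dsimp only
      rw [h]
      exact mlieBracket_add_left ((isSmoothField_inducedField w).mdifferentiableAt p)
        ((isSmoothField_inducedField w').mdifferentiableAt p))
    (fun c w Z => by
      refine Subtype.ext (funext fun p => ?_)
      have : CompleteSpace E := FiniteDimensional.complete ℝ E
      have h : (inducedField (F := F) (G := G) (c • w) : VField E M) =
        c • inducedField (F := F) (G := G) w :=
        map_smul (inducedFieldₗ E M F G) c w
      dsimp only
      rw [h]
      exact mlieBracket_const_smul_left ((isSmoothField_inducedField w).mdifferentiableAt p))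
    (fun w Z Z' => Subtype.ext (mlieBracket_add (isSmoothField_of_mem_killingG Z.2)
      (isSmoothField_of_mem_killingG Z'.2)))
    (fun c w Z => by
      have : CompleteSpace E := FiniteDimensional.complete ℝ E
      exact Subtype.ext (funext fun p => mlieBracket_const_smul_right
        ((isSmoothField_of_mem_killingG Z.2).mdifferentiableAt p)))

variable (E M F) in
/-- The pullback of elements of `𝒦^G(M)`. -/
def pullK (g : G) : killingG E M F G →ₗ[ℝ] killingG E M F G where
  toFun Z := ⟨pull g Z.1, pull_mem_killingG g Z.2⟩
  map_add' Z Z' := haveI := smoothConstSMul_of_contMDiffSMul E M F G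
    Subtype.ext (pull_add g Z.1 Z'.1)
  map_smul' c Z := haveI := smoothConstSMul_of_contMDiffSMul E M F G
    Subtype.ext (pull_smul g c Z.1)

/-- For functionals factoring through the value at a point this is `hasFDerivAt_pull`. These
separate fields, so in finite dimension they span the dual, and the claim is linear in `ℓ`. -/
lemma hasFDerivAt_functional_pullK (ℓ : killingG E M F G →ₗ[ℝ] ℝ) (Z : killingG E M F G) :
    ∃ L : F →L[ℝ] ℝ, HasFDerivAt (fun s => ℓ (pullK E M F ((extChartAt 𝓘(ℝ, F) (1 : G)).symm s) Z))
      L (extChartAt 𝓘(ℝ, F) (1 : G) 1) ∧ ∀ w, L w = ℓ (adK E M F G w Z) := by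
  let S : Submodule ℝ (Module.Dual ℝ (killingG E M F G)) :=
    { carrier := {ℓ | ∃ L : F →L[ℝ] ℝ,
        HasFDerivAt (fun s => ℓ (pullK E M F ((extChartAt 𝓘(ℝ, F) (1 : G)).symm s) Z))
        L (extChartAt 𝓘(ℝ, F) (1 : G) 1) ∧ ∀ w, L w = ℓ (adK E M F G w Z)}
      zero_mem' := ⟨0, hasFDerivAt_const _ _, fun w => rfl⟩
      add_mem' := by
        rintro ℓ ℓ' ⟨L, h, hL⟩ ⟨L', h', hL'⟩
        exact ⟨L + L', h.add h', fun w => by simp [hL, hL']⟩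
      smul_mem' := by
        rintro c ℓ ⟨L, h, hL⟩
        exact ⟨c • L, h.const_smul c, fun w => by simp [hL]⟩ }
  have hev : ∀ (p : M) (m : E →L[ℝ] ℝ), ∀ ℓ : Module.Dual ℝ (killingG E M F G),
      (∀ Z : killingG E M F G, ℓ Z = m (Z.1 p)) → ℓ ∈ S := by
    intro p m ℓ hℓ
    have := smoothConstSMul_of_contMDiffSMul E M F G
    obtain ⟨L, h, hL⟩ := hasFDerivAt_pull (F := F) (G := G) (isSmoothField_of_mem_killingG Z.2) p
    refine ⟨m.comp L, ?_, fun w => ?_⟩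
    · have h1 := m.hasFDerivAt.comp (extChartAt 𝓘(ℝ, F) (1 : G) 1) h
      refine h1.congr_of_eventuallyEq (Eventually.of_forall fun s => ?_)
      exact hℓ _
    · rw [hℓ]
      exact congrArg m (hL w)
  suffices S = ⊤ by
    have h : ℓ ∈ S := by rw [this]; exact Submodule.mem_top
    exact h
  have hS : S.dualCoannihilator = ⊥ := by
    rw [eq_bot_iff]
    intro V hV
    rw [Submodule.mem_dualCoannihilator] at hV
    refine (Submodule.mem_bot ℝ).2 (Subtype.ext (funext fun p => ?_))
    by_contra hne
    obtain ⟨m, hm⟩ := SeparatingDual.exists_ne_zero (R := ℝ) (V := E) (x := V.1 p) hne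
    refine hm (hV _ (hev p m (m.toLinearMap.comp ((LinearMap.proj (R := ℝ)
      (φ := fun _ : M => E) p).comp (Submodule.subtype (killingG E M F G)))) fun Z => rfl))
  rw [← Subspace.dualCoannihilator_dualAnnihilator_eq (W := S), hS, Submodule.dualAnnihilator_bot]

lemma hasFDerivAt_pullK {m : ℕ} (Q : killingG E M F G →ₗ[ℝ] (Fin m → ℝ)) (Z : killingG E M F G) :
    ∃ L : F →L[ℝ] (Fin m → ℝ),
      HasFDerivAt (fun s => Q (pullK E M F ((extChartAt 𝓘(ℝ, F) (1 : G)).symm s) Z))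
      L (extChartAt 𝓘(ℝ, F) (1 : G) 1) ∧ ∀ w, L w = Q (adK E M F G w Z) := by
  choose L h hL using fun i : Fin m =>
    hasFDerivAt_functional_pullK ((LinearMap.proj i).comp Q) Z
  refine ⟨ContinuousLinearMap.pi L, hasFDerivAt_pi.2 h, fun w => ?_⟩
  ext i
  simp [hL]

/-- Translating a point near `1` back to `1` reduces derivatives of pullbacks there to derivatives
at `1`. The uniform bound, a Lipschitz constant of the joint map, is what the Grönwall argument
needs. -/
lemma exists_bound_fderiv_inv_mul (F : Type*) [NormedAddCommGroup F] [NormedSpace ℝ F]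
    (G : Type*) [TopologicalSpace G] [ChartedSpace F G] [Group G] [LieGroup 𝓘(ℝ, F) ∞ G] :
    ∃ C : ℝ, ∀ᶠ s' in 𝓝 (extChartAt 𝓘(ℝ, F) (1 : G) 1),
      ∃ Λ : F →L[ℝ] F, ‖Λ‖ ≤ C ∧
        HasFDerivAt (fun s => extChartAt 𝓘(ℝ, F) (1 : G)
          (((extChartAt 𝓘(ℝ, F) (1 : G)).symm s')⁻¹ * (extChartAt 𝓘(ℝ, F) (1 : G)).symm s)) Λ s' ∧
        ∀ᶠ s in 𝓝 s', ((extChartAt 𝓘(ℝ, F) (1 : G)).symm s')⁻¹ *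
          (extChartAt 𝓘(ℝ, F) (1 : G)).symm s ∈ (extChartAt 𝓘(ℝ, F) (1 : G)).source := by
  have := topologicalGroup_of_lieGroup 𝓘(ℝ, F) (G := G) ∞
  set φ := extChartAt 𝓘(ℝ, F) (1 : G) with hφ
  let Ψ : F × F → F := fun z => φ ((φ.symm z.1)⁻¹ * φ.symm z.2)
  have hΨ : ContDiffAt ℝ ∞ Ψ (φ 1, φ 1) := by
    rw [← contMDiffAt_iff_contDiffAt]
    have h0 : ContMDiffAt 𝓘(ℝ, F) 𝓘(ℝ, F) ∞ φ.symm (φ 1) :=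
      (contMDiffOn_extChartAt_symm (1 : G)).contMDiffAt
        ((isOpen_extChartAt_target _).mem_nhds (mem_extChartAt_target _))
    have h1 : ContMDiffAt 𝓘(ℝ, F × F) 𝓘(ℝ, F) ∞ (fun z : F × F => φ.symm z.1) (φ 1, φ 1) :=
      ContMDiffAt.comp (I' := 𝓘(ℝ, F)) (g := φ.symm) _ h0 contDiff_fst.contMDiff.contMDiffAt
    have h2 : ContMDiffAt 𝓘(ℝ, F × F) 𝓘(ℝ, F) ∞ (fun z : F × F => φ.symm z.2) (φ 1, φ 1) :=
      ContMDiffAt.comp (I' := 𝓘(ℝ, F)) (g := φ.symm) _ h0 contDiff_snd.contMDiff.contMDiffAt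
    refine (contMDiffAt_extChartAt' ?_).comp _ (h1.inv.mul h2)
    simp [φ]
  have hΨ1 : ContDiffAt ℝ 1 Ψ (φ 1, φ 1) := hΨ.of_le (by simp)
  obtain ⟨C, t, ht, hC⟩ := hΨ1.exists_lipschitzOnWith
  have hdiag : Tendsto (fun s : F => (s, s)) (𝓝 (φ 1)) (𝓝 (φ 1, φ 1)) :=
    (continuous_id.prodMk continuous_id).tendsto _
  refine ⟨C, ?_⟩
  filter_upwards [hdiag.eventually (hΨ1.eventually (by simp)),
    hdiag.eventually (eventually_mem_nhds_iff.2 ht), extChartAt_target_mem_nhds (1 : G)]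
    with s' h1 h2 h3
  have h4 : HasFDerivAt (fun s : F => Ψ (s', s))
      ((fderiv ℝ Ψ (s', s')).comp (ContinuousLinearMap.inr ℝ F F)) s' :=
    (h1.differentiableAt one_ne_zero).hasFDerivAt.comp s' (hasFDerivAt_prodMk_right s' s')
  refine ⟨_, ?_, h4, ?_⟩
  · refine (ContinuousLinearMap.opNorm_comp_le _ _).trans ?_
    refine (mul_le_mul (norm_fderiv_le_of_lipschitzOn ℝ h2 hC)
      (ContinuousLinearMap.norm_inr_le_one ℝ F F) (norm_nonneg _) C.coe_nonneg).trans (by simp)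
  · have h5 : ContinuousAt (fun s => (φ.symm s')⁻¹ * φ.symm s) s' :=
      continuousAt_const.mul (continuousAt_extChartAt_symm'' h3)
    refine h5.preimage_mem_nhds ?_
    rw [inv_mul_cancel]
    exact extChartAt_source_mem_nhds _

/-- An ideal of `𝒦^G(M)` is preserved by the group elements near the identity. -/
lemma IsIdealOf.eventually_pull_mem {I : Submodule ℝ (VField E M)}
    (hI : IsIdealOf I (killingG E M F G)) :
    ∀ᶠ g in 𝓝 (1 : G), ∀ Z ∈ I, pull g Z ∈ I := by
  have := smoothConstSMul_of_contMDiffSMul E M F G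
  let I' : Submodule ℝ (killingG E M F G) := I.comap (killingG E M F G).subtype
  let e := (Module.finBasis ℝ (killingG E M F G ⧸ I')).equivFun
  let Q := e.toLinearMap.comp I'.mkQ
  have hQ : ∀ Z : killingG E M F G, Q Z = 0 ↔ Z.1 ∈ I := fun Z => by
    simp only [Q, LinearMap.comp_apply, LinearEquiv.coe_coe, LinearEquiv.map_eq_zero_iff,
      Submodule.mkQ_apply, Submodule.Quotient.mk_eq_zero]
    rfl
  obtain ⟨r, hr⟩ := Q.exists_rightInverse_of_surjective
    (LinearMap.range_eq_top.2 (e.surjective.comp I'.mkQ_surjective))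
  have hQr : ∀ y, Q (r y) = y := fun y => LinearMap.congr_fun hr y
  -- Since `I` is an ideal, the bracket descends to `𝒦^G(M) / I`; `β` is this action in coordinates.
  let β : F →L[ℝ] (Fin _ → ℝ) →L[ℝ] (Fin _ → ℝ) := LinearMap.toContinuousLinearMap
    (LinearMap.toContinuousLinearMap.toLinearMap.comp
      ((adK E M F G).compr₂ Q |>.compl₁₂ LinearMap.id r))
  have hβ : ∀ w Z, Q (adK E M F G w Z) = β w (Q Z) := fun w Z => by
    have h1 : β w (Q Z) = Q (adK E M F G w (r (Q Z))) := rfl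
    have h2 : (Z - r (Q Z)).1 ∈ I := (hQ _).1 (by rw [map_sub, hQr, sub_self])
    have h3 : Q (adK E M F G w (Z - r (Q Z))) = 0 :=
      (hQ _).2 (hI.bracket_mem _ ⟨w, rfl⟩ _ h2)
    rw [map_sub, map_sub, sub_eq_zero] at h3
    rw [h1, h3]
  obtain ⟨C, hC⟩ := exists_bound_fderiv_inv_mul F G
  set φ := extChartAt 𝓘(ℝ, F) (1 : G) with hφ
  obtain ⟨ε, hε, hball⟩ := Metric.eventually_nhds_iff_ball.1 hC
  have key : ∀ s ∈ Metric.ball (φ 1) ε, ∀ Z : killingG E M F G, Z.1 ∈ I →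
      pull (φ.symm s) Z.1 ∈ I := by
    intro s hs Z hZ
    let γ : ℝ → F := fun t => φ 1 + t • (s - φ 1)
    have hγ : ∀ t, HasDerivAt γ (s - φ 1) t := fun t => by
      have h := ((hasDerivAt_id t).smul_const (s - φ 1)).const_add (φ 1)
      rwa [one_smul] at h
    have hγ0 : γ 0 = φ 1 := by simp [γ]
    have hγ1 : γ 1 = s := by simp [γ]
    have hγb : ∀ t ∈ Icc (0 : ℝ) 1, γ t ∈ Metric.ball (φ 1) ε := by
      intro t ht
      have := (convex_ball (φ 1) ε).add_smul_sub_mem (Metric.mem_ball_self hε) hs ht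
      exact this
    let y : ℝ → (Fin _ → ℝ) := fun t => Q (pullK E M F (φ.symm (γ t)) Z)
    -- The class of the pulled-back field modulo `I` satisfies a linear differential equation along
    -- the segment. It starts at zero, so by Grönwall it stays zero.
    have hy : ∀ t ∈ Icc (0 : ℝ) 1, ∃ y' : Fin _ → ℝ, HasDerivAt y y' t ∧
        ‖y'‖ ≤ ‖β‖ * (C * ‖s - φ 1‖) * ‖y t‖ := by
      intro t ht
      obtain ⟨Λ, hΛC, hΛ, hsrc⟩ := hball _ (hγb t ht)
      obtain ⟨L, hL, hLw⟩ := hasFDerivAt_pullK Q (pullK E M F (φ.symm (γ t)) Z)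
      have hpt : φ ((φ.symm (γ t))⁻¹ * φ.symm (γ t)) = φ 1 := by rw [inv_mul_cancel]
      rw [← hφ, ← hpt] at hL
      have h1 := hL.comp (γ t) hΛ
      have h2 : (fun s' => Q (pullK E M F (φ.symm s') Z)) =ᶠ[𝓝 (γ t)]
          (fun s' => Q (pullK E M F (φ.symm s') (pullK E M F (φ.symm (γ t)) Z))) ∘
          fun s' => φ ((φ.symm (γ t))⁻¹ * φ.symm s') := by
        filter_upwards [hsrc] with s' hs'
        simp only [Function.comp_apply]
        congr 1
        refine Subtype.ext ?_
        change pull _ _ = pull _ (pull _ _)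
        rw [pull_pull, φ.left_inv hs', mul_inv_cancel_left]
      have h3 := (h1.congr_of_eventuallyEq h2).comp_hasDerivAt t (hγ t)
      refine ⟨_, h3, ?_⟩
      have h4 : (L.comp Λ) (s - φ 1) = β (Λ (s - φ 1)) (y t) := by
        rw [ContinuousLinearMap.comp_apply, hLw, hβ]
      rw [h4]
      refine (β.le_opNorm₂ _ _).trans ?_
      gcongr
      exact (Λ.le_opNorm _).trans (by gcongr)
    choose! y' hy' hbd using hy
    have hy0 : y 0 = 0 := by
      refine (hQ _).2 ?_
      change pull (φ.symm (γ 0)) Z.1 ∈ I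
      rw [hγ0, hφ, extChartAt_to_inv, pull_one]
      exact hZ
    have h1 := eq_zero_of_abs_deriv_le_mul_abs_self_of_eq_zero_right
      (fun t ht => (hy' t ht).continuousAt.continuousWithinAt)
      (fun t ht => (hy' t (Ico_subset_Icc_self ht)).hasDerivWithinAt) hy0
      (fun t ht => hbd t (Ico_subset_Icc_self ht)) 1 (right_mem_Icc.2 zero_le_one)
    have h2 := (hQ _).1 h1
    rw [hγ1] at h2
    exact h2
  have hcont : Tendsto φ (𝓝 (1 : G)) (𝓝 (φ 1)) := continuousAt_extChartAt (1 : G)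
  filter_upwards [hcont.eventually (Metric.ball_mem_nhds _ hε),
    extChartAt_source_mem_nhds (I := 𝓘(ℝ, F)) (1 : G)]
    with g hg hg' Z hZ
  have := key _ hg ⟨Z, hI.le hZ⟩ hZ
  rwa [φ.left_inv hg'] at this

/-- An equivariant family of ideals of `𝒦^G(M)` is constant. -/
theorem ideal_eq_of_equivariant [T2Space M] [ConnectedSpace M] [SecondCountableTopology G]
    [MulAction.IsPretransitive G M] {I : M → Submodule ℝ (VField E M)}
    (hI : ∀ p, IsIdealOf (I p) (killingG E M F G))
    (hpull : ∀ (g : G) (p : M), ∀ Z ∈ I (g • p), pull g Z ∈ I p) (p q : M) : I p = I q := by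
  have := smoothConstSMul_of_contMDiffSMul E M F G
  have := topologicalGroup_of_lieGroup 𝓘(ℝ, F) (G := G) ∞
  have : LocallyCompactSpace G := ChartedSpace.locallyCompactSpace F G
  have : LocallyCompactSpace M := ChartedSpace.locallyCompactSpace E M
  have : ContinuousSMul G M :=
    ⟨(ContMDiffSMul.contMDiff_smul (I := 𝓘(ℝ, F)) (I' := 𝓘(ℝ, E)) (n := ∞)).continuous⟩
  refine IsLocallyConstant.apply_eq_of_preconnectedSpace
    ((IsLocallyConstant.iff_eventually_eq I).2 fun p => ?_) p q
  have h1 := (hI p).eventually_pull_mem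
  have h2 : ∀ᶠ g in 𝓝 (1 : G), ∀ Z ∈ I p, pull g⁻¹ Z ∈ I p := by
    have : Tendsto (fun g : G => g⁻¹) (𝓝 1) (𝓝 1) := by
      simpa using (continuous_inv (G := G)).tendsto 1
    exact this.eventually h1
  -- The orbit map is open, so every point near `p` is `g • p` with both `g` and `g⁻¹` preserving `I
  -- p`; equivariance then gives both inclusions.
  have h3 := (isOpenMap_smul_of_sigmaCompact (G := G) p).image_mem_nhds (h1.and h2)
  rw [one_smul] at h3
  filter_upwards [h3]
  rintro _ ⟨g, ⟨hg, hg'⟩, rfl⟩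
  refine le_antisymm (fun Z hZ => ?_) (fun Z hZ => ?_)
  · have := hg' _ (hpull g p Z hZ)
    rwa [pull_inv_pull] at this
  · have h4 := hpull g⁻¹ (g • p) (pull g Z) (by rw [inv_smul_smul]; exact hg Z hZ)
    rwa [pull_inv_pull] at h4

end Adjoint

/-! ### Local sections of orbit maps, and the osculating space through Killing fields. -/

section LocalSection

open VectorField Filter Topology Set

/-- A smooth map whose differential at a point is surjective has a smooth local section. -/
lemma exists_contDiffOn_section {E F : Type*} [NormedAddCommGroup E] [NormedSpace ℝ E]
    [FiniteDimensional ℝ E] [NormedAddCommGroup F] [NormedSpace ℝ F] {f : F → E} {O : Set F}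
    (hO : IsOpen O) {s₀ : F} (hs₀ : s₀ ∈ O) (hf : ∀ s ∈ O, ContDiffAt ℝ ∞ f s)
    (hsurj : Function.Surjective (fderiv ℝ f s₀)) :
    ∃ (τ : E → F) (U : Set E), IsOpen U ∧ f s₀ ∈ U ∧ ContDiffOn ℝ ∞ τ U ∧ τ (f s₀) = s₀ ∧
      MapsTo τ U O ∧ ∀ e ∈ U, f (τ e) = e := by
  have : CompleteSpace E := FiniteDimensional.complete ℝ E
  obtain ⟨r, hr⟩ := (fderiv ℝ f s₀).toLinearMap.exists_rightInverse_of_surjective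
    (LinearMap.range_eq_top.2 hsurj)
  let ρ : E →L[ℝ] F := LinearMap.toContinuousLinearMap r
  have hρ : (fderiv ℝ f s₀).comp ρ = ContinuousLinearMap.id ℝ E := by
    ext e; exact LinearMap.congr_fun hr e
  -- On an affine slice through `s₀` along a right inverse of the differential, `f` becomes a local
  -- diffeomorphism; its inverse is the section.
  let j : E → F := fun e => s₀ + ρ e
  have hj : ContDiff ℝ ∞ j := contDiff_const.add ρ.contDiff
  have hj' : ∀ e, HasFDerivAt j ρ e := fun e => ρ.hasFDerivAt.const_add s₀
  have hj0 : j 0 = s₀ := by simp [j]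
  let h : E → E := f ∘ j
  have hh : ∀ e, j e ∈ O → ContDiffAt ℝ ∞ h e := fun e he => (hf _ he).comp e hj.contDiffAt
  have hh0 : ContDiffAt ℝ ∞ h 0 := hh 0 (by rwa [hj0])
  have hd : HasFDerivAt h ((ContinuousLinearEquiv.refl ℝ E : E ≃L[ℝ] E) : E →L[ℝ] E) 0 := by
    have h1 : HasFDerivAt f (fderiv ℝ f s₀) (j 0) := by
      rw [hj0]; exact ((hf s₀ hs₀).differentiableAt (by simp)).hasFDerivAt
    have h2 := h1.comp 0 (hj' 0)
    rw [hρ] at h2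
    exact h2
  let P := hh0.toOpenPartialHomeomorph h hd (by simp)
  have hPh : (P : E → E) = h := hh0.toOpenPartialHomeomorph_coe hd (by simp)
  have h0s : (0 : E) ∈ P.source := hh0.mem_toOpenPartialHomeomorph_source hd (by simp)
  let V : Set E := {x | j x ∈ O ∧
    fderiv ℝ h x ∈ range ((↑) : (E ≃L[ℝ] E) → E →L[ℝ] E)}
  have hV : V ∈ 𝓝 (0 : E) := by
    have h1 : range ((↑) : (E ≃L[ℝ] E) → E →L[ℝ] E) ∈ 𝓝 (fderiv ℝ h 0) := by
      rw [hd.fderiv]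
      exact ContinuousLinearEquiv.nhds _
    exact inter_mem (hj.continuous.continuousAt.preimage_mem_nhds
      (hO.mem_nhds (by rwa [hj0]))) ((hh0.continuousAt_fderiv (by simp)).preimage_mem_nhds h1)
  have hfh : h 0 = f s₀ := by simp only [h, Function.comp_apply, hj0]
  have hP0 : P.symm (f s₀) = 0 := by
    rw [← hfh, ← hPh]; exact P.left_inv h0s
  refine ⟨fun e => j (P.symm e), P.target ∩ P.symm ⁻¹' interior V,
    P.symm.isOpen_inter_preimage isOpen_interior, ⟨?_, ?_⟩, fun e he => ?_, ?_, fun e he => ?_,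
    fun e he => ?_⟩
  · rw [← hfh, ← hPh]; exact P.map_source h0s
  · rw [mem_preimage, hP0]; exact mem_interior_iff_mem_nhds.2 hV
  · obtain ⟨h1, A, hA⟩ := interior_subset he.2
    refine (hj.contDiffAt.comp e (P.contDiffAt_symm (f₀' := A) he.1 ?_ ?_)).contDiffWithinAt
    · rw [hA, hPh]
      exact ((hh _ h1).differentiableAt (by simp)).hasFDerivAt
    · rw [hPh]; exact hh _ h1
  · simp only [hP0, hj0]
  · exact (interior_subset he.2).1
  · have := P.right_inv he.1
    rw [hPh] at this
    exact this

variable {E : Type*} [NormedAddCommGroup E] [NormedSpace ℝ E] [FiniteDimensional ℝ E]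
  {M : Type*} [TopologicalSpace M] [T2Space M] [ChartedSpace E M] [IsManifold 𝓘(ℝ, E) ∞ M]
  {F : Type*} [NormedAddCommGroup F] [NormedSpace ℝ F] [FiniteDimensional ℝ F]
  {G : Type*} [TopologicalSpace G] [SecondCountableTopology G] [ChartedSpace F G] [Group G]
  [LieGroup 𝓘(ℝ, F) ∞ G] [MulAction G M] [ContMDiffSMul 𝓘(ℝ, F) 𝓘(ℝ, E) ∞ G M]
  [MulAction.IsPretransitive G M]
  {X Y Z W : VField E M}

local notation "⟦" X "," Y "⟧" => mlieBracket 𝓘(ℝ, E) X Y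

variable (E F G) in
/-- The orbit map of a transitive action has smooth local sections. -/
lemma exists_contMDiffOn_section_orbit (p : M) : ∃ (σ : M → G) (U : Set M), U ∈ 𝓝 p ∧
    ContMDiffOn 𝓘(ℝ, E) 𝓘(ℝ, F) ∞ σ U ∧ σ p = 1 ∧ ∀ q ∈ U, σ q • p = q := by
  obtain ⟨τ, U, hU, hpU, hτ, hτp, hτO, hfτ⟩ := exists_contDiffOn_section
    (f := orbitInCharts E F G p) (isOpen_orbitDomain p) (mem_orbitDomain p)
    (fun s hs => contDiffAt_orbitInCharts hs) (fun v => by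
      obtain ⟨u, hu⟩ := inducedField_surjective (F := F) (G := G) p v
      exact ⟨u, (inducedField_eq_fderiv u p).symm.trans hu⟩)
  rw [orbitInCharts_one] at hpU hτp
  set χ := extChartAt 𝓘(ℝ, E) p with hχ
  refine ⟨fun q => (extChartAt 𝓘(ℝ, F) (1 : G)).symm (τ (χ q)), χ.source ∩ χ ⁻¹' U, ?_, ?_, ?_, ?_⟩
  · exact inter_mem (extChartAt_source_mem_nhds p)
      ((continuousAt_extChartAt p).preimage_mem_nhds (hU.mem_nhds hpU))
  · refine (contMDiffOn_extChartAt_symm (1 : G)).comp (t := (extChartAt 𝓘(ℝ, F) (1 : G)).target)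
      ((hτ.contMDiffOn.comp (t := U) ((contMDiffOn_extChartAt (x := p)).mono fun q hq => by
        simpa [hχ] using hq.1) fun q hq => hq.2)) fun q hq => (hτO hq.2).1
  · simp only [hτp, extChartAt_to_inv]
  · intro q hq
    have h1 := hfτ _ hq.2
    simp only [orbitInCharts] at h1
    exact χ.injOn (hτO hq.2).2 hq.1 h1

variable [RiemannianBundle (fun p : M => TangentSpace 𝓘(ℝ, E) p)]
  [IsContMDiffRiemannianBundle 𝓘(ℝ, E) ∞ E (fun p : M => TangentSpace 𝓘(ℝ, E) p)]
  {D : CovariantDerivative 𝓘(ℝ, E) E (fun p : M => TangentSpace 𝓘(ℝ, E) p)}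

/-- By means of a local section of the orbit map of `p`, every nullity vector at `p` extends to a
smooth field of nullity vectors. -/
lemma ActsByIsometries.exists_isSmoothField_mem_nullity (hG : ActsByIsometries E M G)
    (hD : IsLeviCivita D) {p : M} {σ : M → G} {U : Set M} (hU : U ∈ 𝓝 p)
    (hσ : ContMDiffOn 𝓘(ℝ, E) 𝓘(ℝ, F) ∞ σ U) (hσp : σ p = 1) (hσq : ∀ q ∈ U, σ q • p = q)
    {a : TangentSpace 𝓘(ℝ, E) p} (ha : a ∈ nullity D p) :
    ∃ Y : VField E M, IsSmoothField Y ∧ (∀ q, Y q ∈ nullity D q) ∧ Y p = a := by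
  have := smoothConstSMul_of_contMDiffSMul E M F G
  -- The vector is spread by the isometries `σ q`, which map `p` to `q` and nullity vectors to
  -- nullity vectors. A bump function then makes the field global.
  let Y₀ : VField E M := fun q => (dsmul E (σ q) p a : E)
  have hα : ContMDiffOn 𝓘(ℝ, E) 𝓘(ℝ, F).tangent ∞
      (fun q : M => (⟨σ q, 0⟩ : TangentBundle 𝓘(ℝ, F) G)) U :=
    (contMDiff_zeroSection ℝ (fun g : G => TangentSpace 𝓘(ℝ, F) g)).comp_contMDiffOn hσ
  have hβ : ContMDiffOn 𝓘(ℝ, E) 𝓘(ℝ, E).tangent ∞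
      (fun _ : M => (⟨p, a⟩ : TangentBundle 𝓘(ℝ, E) M)) U := contMDiffOn_const
  have hY₀ : ContMDiffOn 𝓘(ℝ, E) 𝓘(ℝ, E).tangent ∞
      (fun q => (⟨q, Y₀ q⟩ : TangentBundle 𝓘(ℝ, E) M)) U := by
    refine (contMDiffOn_mfderiv_smul_add hα hβ).congr fun q hq => ?_
    rw [map_zero, zero_add]
    exact (totalSpace_mk_congr (E := E) (hσq q hq) (Y₀ q)).symm
  have hν : ∀ q ∈ U, Y₀ q ∈ nullity D q := by
    intro q hq
    have h1 : ∀ (q q' : M) (v : E), q = q' → (v : TangentSpace 𝓘(ℝ, E) q) ∈ nullity D q →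
      (v : TangentSpace 𝓘(ℝ, E) q') ∈ nullity D q' := by rintro q _ v rfl h; exact h
    exact h1 _ _ _ (hσq q hq) (hG.dsmul_mem_nullity hD (σ q) ha)
  obtain ⟨Y, hY, hYp, hYc⟩ := exists_isSmoothField_eventuallyEq hU hY₀
  refine ⟨Y, hY, fun q => ?_, ?_⟩
  · obtain ⟨c, hc, hcU⟩ := hYc q
    rw [hc]
    rcases eq_or_ne c 0 with rfl | h0
    · rw [zero_smul]; exact (nullitySubmodule D hD q).zero_mem
    · exact (nullitySubmodule D hD q).smul_mem c (hν q (hcU h0))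
  · rw [hYp.self_of_nhds]
    have h1 : ∀ g : G, g = 1 → (dsmul E g p a : E) = a := by
      rintro _ rfl
      exact congrArg (fun L : E →L[ℝ] E => L a) (dsmul_one p)
    exact h1 _ hσp

variable (F) in
/-- On a homogeneous space, the osculating distribution of the nullity is spanned by the nullity and
its image under the covariant derivatives of the induced fields. -/
theorem ActsByIsometries.osculating_nullity_eq (hG : ActsByIsometries E M G) (hD : IsLeviCivita D)
    (p : M) : osculating D (nullity D) p = nullitySubmodule D hD p ⊔
      Submodule.span ℝ {v | ∃ K ∈ killingG E M F G, ∃ a ∈ nullity D p, D K p a = v} := by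
  refine le_antisymm (sup_le ?_ ?_) (sup_le ?_ ?_)
  · exact le_sup_of_le_left (Submodule.span_le.2 fun v hv => hv)
  · refine Submodule.span_le.2 ?_
    rintro _ ⟨X, w, hX, hXν, rfl⟩
    obtain ⟨u, hu⟩ := inducedField_surjective (F := F) (G := G) p w
    have hW : inducedField u ∈ killingG E M F G := ⟨u, rfl⟩
    have h1 := congrFun (hD.nabla_sub_nabla (isSmoothField_of_mem_killingG hW) hX) p
    -- Vanishing torsion exchanges the derivative of `X` for that of a Killing field with value `w`,
    -- up to a bracket that stays in the nullity. The reverse inclusion reads the same identity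
    -- backwards.
    have h2 : D X p w = ⟦inducedField u, X⟧ p + D (inducedField u) p (X p) := by
      have h3 : D X p w = nabla D (inducedField u) X p := congrArg (D X p) hu.symm
      rw [h3, ← h1]
      exact (sub_add_cancel _ _).symm
    rw [h2]
    exact Submodule.add_mem_sup (hG.mlieBracket_mem_nullity hD hW hX hXν p)
      (Submodule.subset_span ⟨_, hW, _, hXν p, rfl⟩)
  · exact le_sup_of_le_left fun v hv => Submodule.subset_span hv
  · refine Submodule.span_le.2 ?_
    rintro _ ⟨K, hK, a, ha, rfl⟩
    obtain ⟨σ, U, hU, hσ, hσp, hσq⟩ := exists_contMDiffOn_section_orbit E F G p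
    obtain ⟨Y, hY, hYν, rfl⟩ := hG.exists_isSmoothField_mem_nullity hD hU hσ hσp hσq ha
    have h1 := congrFun (hD.nabla_sub_nabla (isSmoothField_of_mem_killingG hK) hY) p
    have h2 : D K p (Y p) = D Y p (K p) - ⟦K, Y⟧ p := by
      rw [← h1]
      exact (sub_sub_cancel _ _).symm
    rw [h2]
    exact Submodule.sub_mem _
      (Submodule.mem_sup_right (Submodule.subset_span ⟨Y, K p, hY, hYν, rfl⟩))
      (Submodule.mem_sup_left (Submodule.subset_span (hG.mlieBracket_mem_nullity hD hK hY hYν p)))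

end LocalSection

/-! ### The model at a point, and the passage from first order to global statements. -/

section Model

open VectorField Filter Topology Set

variable {E : Type*} [NormedAddCommGroup E] [NormedSpace ℝ E] [FiniteDimensional ℝ E]
  {M : Type*} [TopologicalSpace M] [T2Space M] [ChartedSpace E M] [IsManifold 𝓘(ℝ, E) ∞ M]
  {F : Type*} [NormedAddCommGroup F] [NormedSpace ℝ F] [FiniteDimensional ℝ F]
  {G : Type*} [TopologicalSpace G] [SecondCountableTopology G] [ChartedSpace F G] [Group G]
  [LieGroup 𝓘(ℝ, F) ∞ G] [MulAction G M] [ContMDiffSMul 𝓘(ℝ, F) 𝓘(ℝ, E) ∞ G M]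
  [MulAction.IsPretransitive G M]
  [RiemannianBundle (fun p : M => TangentSpace 𝓘(ℝ, E) p)]
  [IsContMDiffRiemannianBundle 𝓘(ℝ, E) ∞ E (fun p : M => TangentSpace 𝓘(ℝ, E) p)]
  {D : CovariantDerivative 𝓘(ℝ, E) E (fun p : M => TangentSpace 𝓘(ℝ, E) p)}
  {X Y Z W : VField E M}

local notation "⟦" X "," Y "⟧" => mlieBracket 𝓘(ℝ, E) X Y

/-- A smooth vector field with a given value at a point. -/
def extend (p : M) (v : TangentSpace 𝓘(ℝ, E) p) : VField E M :=
  (exists_isSmoothField_eq p v).choose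

lemma isSmoothField_extend (p : M) (v : TangentSpace 𝓘(ℝ, E) p) : IsSmoothField (extend p v) :=
  (exists_isSmoothField_eq p v).choose_spec.1

lemma extend_self (p : M) (v : TangentSpace 𝓘(ℝ, E) p) : extend p v p = v :=
  (exists_isSmoothField_eq p v).choose_spec.2

variable (D) in
/-- The curvature tensor at a point. -/
def curvatureAt (p : M) (x y v : TangentSpace 𝓘(ℝ, E) p) : TangentSpace 𝓘(ℝ, E) p :=
  curvature D (extend p x) (extend p y) (extend p v) p

lemma IsLeviCivita.curvatureAt_apply (hD : IsLeviCivita D) (hX : IsSmoothField X)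
    (hY : IsSmoothField Y) (hZ : IsSmoothField Z) (p : M) :
    curvatureAt D p (X p) (Y p) (Z p) = curvature D X Y Z p :=
  hD.curvature_congr (isSmoothField_extend p _) (isSmoothField_extend p _)
    (isSmoothField_extend p _) hX hY hZ (extend_self p _) (extend_self p _) (extend_self p _)

/-- The covariant derivative of the bracket of two Killing fields. -/
lemma ActsByIsometries.nabla_mlieBracket (hG : ActsByIsometries E M G) (hD : IsLeviCivita D)
    (hX : X ∈ killingG E M F G) (hY : Y ∈ killingG E M F G) (hZ : IsSmoothField Z) :
    nabla D Z ⟦X, Y⟧ =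
      curvature D X Y Z - nabla D (nabla D Z Y) X + nabla D (nabla D Z X) Y := by
  have hXs := isSmoothField_of_mem_killingG hX
  have hYs := isSmoothField_of_mem_killingG hY
  have h1 := hD.nabla_nabla_of_skew hZ hXs hYs (hG.nabla_skew hD hY)
  have h2 := hD.nabla_nabla_of_skew hZ hYs hXs (hG.nabla_skew hD hX)
  have h3 := hD.curvature_bianchi hZ hYs hXs
  have h4 := curvature_swap (D := D) Z X Y
  have h5 := curvature_swap (D := D) Y X Z
  rw [← hD.nabla_sub_nabla hXs hYs, nabla_sub Z (hD.isSmoothField_nabla hXs hYs)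
    (hD.isSmoothField_nabla hYs hXs)]
  linear_combination (norm := module) h1 - h2 + h3 - h4 - h5

instance finiteDimensional_tangentSpace (p : M) : FiniteDimensional ℝ (TangentSpace 𝓘(ℝ, E) p) :=
  inferInstanceAs (FiniteDimensional ℝ E)

/-- The infinitesimal model of a homogeneous Riemannian manifold at a point. -/
def killingModel (hG : ActsByIsometries E M G) (hD : IsLeviCivita D) (p : M) :
    KillingModel (TangentSpace 𝓘(ℝ, E) p) (killingG E M F G) where
  R := curvatureAt D p
  ev :=
    { toFun := fun X => X.1 p
      map_add' := fun X Y => rfl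
      map_smul' := fun c X => rfl }
  A :=
    LinearMap.mk₂ ℝ (fun X v => D X.1 p v)
      (fun X Y v => by
        have h := congrFun (nabla_add (D := D) (extend p v) (isSmoothField_of_mem_killingG X.2)
          (isSmoothField_of_mem_killingG Y.2)) p
        simp only [nabla, Pi.add_apply, extend_self] at h
        exact h)
      (fun c X v => by
        have h := congrFun (nabla_const_smul (D := D) (extend p v)
          (isSmoothField_of_mem_killingG X.2) c) p
        simp only [nabla, Pi.smul_apply, extend_self] at h
        exact h)
      (fun X v w => map_add _ _ _)
      (fun c X v => map_smul _ _ _)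
  br X Y := ⟨⟦X.1, Y.1⟧, mlieBracket_mem_killingG X.2 Y.2⟩
  ev_surjective v := by
    obtain ⟨u, hu⟩ := inducedField_surjective (F := F) (G := G) p v
    exact ⟨⟨inducedField u, u, rfl⟩, hu⟩
  R_add x y v w := by
    have h := congrFun (hD.curvature_add (isSmoothField_extend p x) (isSmoothField_extend p y)
      (isSmoothField_extend p v) (isSmoothField_extend p w)) p
    rw [← hD.curvatureAt_apply (isSmoothField_extend p x) (isSmoothField_extend p y)
      ((isSmoothField_extend p v).add (isSmoothField_extend p w))] at h
    simp only [Pi.add_apply, extend_self] at h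
    exact h
  R_smul x y c v := by
    have h := congrFun (hD.curvature_const_smul (isSmoothField_extend p x)
      (isSmoothField_extend p y) (isSmoothField_extend p v) c) p
    rw [← hD.curvatureAt_apply (isSmoothField_extend p x) (isSmoothField_extend p y)
      ((isSmoothField_extend p v).const_smul c)] at h
    simp only [Pi.smul_apply, extend_self] at h
    exact h
  R_swap x y v := congrFun (curvature_swap (D := D) _ _ _) p
  R_skew x y v w := by
    have h := congrFun (hD.inn_curvature_skew (isSmoothField_extend p x) (isSmoothField_extend p y)
      (isSmoothField_extend p v) (isSmoothField_extend p w)) p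
    simp only [inn, Pi.neg_apply, extend_self] at h
    exact h
  R_bianchi x y z := congrFun (hD.curvature_bianchi (isSmoothField_extend p x)
    (isSmoothField_extend p y) (isSmoothField_extend p z)) p
  A_skew X v w := by
    have h := congrFun (hG.nabla_skew hD X.2 (isSmoothField_extend p v)
      (isSmoothField_extend p w)) p
    simp only [inn, nabla, Pi.add_apply, extend_self] at h
    exact eq_neg_of_add_eq_zero_left h
  ev_br X Y := (congrFun (hD.nabla_sub_nabla (isSmoothField_of_mem_killingG X.2)
    (isSmoothField_of_mem_killingG Y.2)) p).symm
  A_br X Y v := by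
    have h := congrFun (hG.nabla_mlieBracket hD X.2 Y.2 (isSmoothField_extend p v)) p
    simp only [Pi.add_apply, Pi.sub_apply] at h
    rw [← hD.curvatureAt_apply (isSmoothField_of_mem_killingG X.2)
      (isSmoothField_of_mem_killingG Y.2) (isSmoothField_extend p v)] at h
    simp only [nabla, extend_self] at h
    exact h
  A_jacobi X Y Z := by
    have hX := isSmoothField_of_mem_killingG X.2
    have hY := isSmoothField_of_mem_killingG Y.2
    have hZ := isSmoothField_of_mem_killingG Z.2
    rw [← map_add, ← map_add]
    refine (congrArg _ (Subtype.ext ?_)).trans (map_zero _)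
    change ⟦⟦X.1, Y.1⟧, Z.1⟧ + ⟦⟦Y.1, Z.1⟧, X.1⟧ + ⟦⟦Z.1, X.1⟧, Y.1⟧ = 0
    have h1 := mlieBracket_leibniz hX hY hZ
    rw [mlieBracket_swap (V := ⟦Y.1, Z.1⟧), h1, mlieBracket_swap (V := ⟦Z.1, X.1⟧)]
    have h2 : ⟦Y.1, ⟦Z.1, X.1⟧⟧ = -⟦Y.1, ⟦X.1, Z.1⟧⟧ := by
      have : CompleteSpace E := FiniteDimensional.complete ℝ E
      rw [mlieBracket_swap (V := Z.1), ← neg_one_smul ℝ ⟦X.1, Z.1⟧, ← neg_one_smul ℝ ⟦Y.1, _⟧]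
      funext q
      exact mlieBracket_const_smul_right ((hX.mlieBracket hZ).mdifferentiableAt q)
    rw [h2]
    abel

lemma nul_killingModel (hG : ActsByIsometries E M G) (hD : IsLeviCivita D) (p : M) :
    (killingModel (F := F) hG hD p).nul = nullitySubmodule D hD p := by
  ext v
  have h1 := hD.mem_nullity_iff (isSmoothField_extend p v) p
  rw [extend_self] at h1
  refine Iff.trans ?_ h1.symm
  refine ⟨fun h X Y hX hY => ?_, fun h x y => ?_⟩
  · rw [← hD.curvatureAt_apply hX hY (isSmoothField_extend p v), extend_self]
    exact h _ _
  · exact h _ _ (isSmoothField_extend p x) (isSmoothField_extend p y)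

lemma osc_killingModel (hG : ActsByIsometries E M G) (hD : IsLeviCivita D) (p : M) :
    (killingModel (F := F) hG hD p).osc = osculating D (nullity D) p := by
  rw [hG.osculating_nullity_eq (F := F) hD p, KillingModel.osc, nul_killingModel]
  congr 2
  ext v
  exact ⟨fun ⟨X, a, ha, h⟩ => ⟨X.1, X.2, a, ha, h⟩, fun ⟨X, hX, a, ha, h⟩ => ⟨⟨X, hX⟩, a, ha, h⟩⟩

variable (F) in
/-- The fields in `𝒦^G(M)` whose covariant derivative at `p` vanishes on the first osculating space
of the nullity. -/
def u00Submodule (hG : ActsByIsometries E M G) (hD : IsLeviCivita D) (p : M) :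
    Submodule ℝ (VField E M) where
  carrier := u00 F G D p
  zero_mem' := ⟨Submodule.zero_mem _, fun v _ => congrArg (fun L => L v)
    (map_zero (killingModel (F := F) hG hD p).A)⟩
  add_mem' {X Y} hX hY := ⟨Submodule.add_mem _ hX.1 hY.1, fun v hv => by
    have h := congrArg (fun L => L v)
      (map_add (killingModel (F := F) hG hD p).A ⟨X, hX.1⟩ ⟨Y, hY.1⟩)
    refine h.trans ?_
    exact (congrArg₂ (· + ·) (hX.2 v hv) (hY.2 v hv)).trans (add_zero _)⟩
  smul_mem' c X hX := ⟨Submodule.smul_mem _ c hX.1, fun v hv => by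
    have h := congrArg (fun L => L v) (map_smul (killingModel (F := F) hG hD p).A c ⟨X, hX.1⟩)
    exact h.trans ((congrArg (c • ·) (hX.2 v hv)).trans (smul_zero _))⟩

lemma isIdealOf_u00Submodule (hG : ActsByIsometries E M G) (hD : IsLeviCivita D) (p : M) :
    IsIdealOf (u00Submodule F hG hD p) (killingG E M F G) where
  le _ h := h.1
  bracket_mem X hX Z hZ := ⟨mlieBracket_mem_killingG hX hZ.1, by
    have h := KillingModel.br_mem_of_A_osc (K := killingModel (F := F) hG hD p) (Z := ⟨Z, hZ.1⟩)
    rw [osc_killingModel] at h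
    exact h hZ.2 ⟨X, hX⟩⟩

variable (F) in
/-- The fields in `𝒦^G(M)` that vanish to first order at `p`. -/
def isotropyKernel (hG : ActsByIsometries E M G) (hD : IsLeviCivita D) (p : M) :
    Submodule ℝ (VField E M) :=
  (LinearMap.ker (killingModel (F := F) hG hD p).ev ⊓
    LinearMap.ker (killingModel (F := F) hG hD p).A).map (killingG E M F G).subtype

lemma mem_isotropyKernel (hG : ActsByIsometries E M G) (hD : IsLeviCivita D) {p : M}
    (hX : X ∈ killingG E M F G) :
    X ∈ isotropyKernel F hG hD p ↔ X p = 0 ∧ ∀ v, D X p v = 0 := by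
  constructor
  · rintro ⟨Y, ⟨h1, h2⟩, rfl⟩
    exact ⟨h1, fun v => LinearMap.congr_fun h2 v⟩
  · rintro ⟨h1, h2⟩
    exact ⟨⟨X, hX⟩, ⟨h1, LinearMap.ext h2⟩, rfl⟩

/-- Value and derivative of a bracket at `p` depend only on the values and derivatives of the two
fields there, so first-order vanishing is inherited. -/
lemma isIdealOf_isotropyKernel (hG : ActsByIsometries E M G) (hD : IsLeviCivita D) (p : M) :
    IsIdealOf (isotropyKernel F hG hD p) (killingG E M F G) where
  le := Submodule.map_subtype_le _ _
  bracket_mem X hX := by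
    rintro _ ⟨Z, ⟨h1, h2⟩, rfl⟩
    set K := killingModel (F := F) hG hD p with hK
    refine ⟨K.br ⟨X, hX⟩ Z, ⟨?_, ?_⟩, rfl⟩
    · refine (K.ev_br _ _).trans ?_
      rw [LinearMap.mem_ker.1 h1, LinearMap.mem_ker.1 h2, map_zero, LinearMap.zero_apply, sub_zero]
    · refine LinearMap.ext fun v => (K.A_br _ _ v).trans ?_
      rw [LinearMap.mem_ker.1 h1, LinearMap.mem_ker.1 h2,
        KillingModel.R_nul_right K.nul.zero_mem, LinearMap.zero_apply, LinearMap.zero_apply,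
        map_zero, sub_zero, add_zero]

lemma dsmul_injective [SmoothConstSMul E M G] (g : G) (p : M) :
    Function.Injective (dsmul E g p) := by
  obtain ⟨e, he⟩ := isInvertible_dsmul (E := E) g p
  rw [← he]
  exact e.injective

lemma pull_mem_u00Submodule (hG : ActsByIsometries E M G) (hD : IsLeviCivita D) (g : G) (p : M) :
    ∀ Z ∈ u00Submodule F hG hD (g • p), pull g Z ∈ u00Submodule F hG hD p := by
  have := smoothConstSMul_of_contMDiffSMul E M F G
  refine fun Z hZ => ⟨pull_mem_killingG g hZ.1, fun v hv => dsmul_injective g p ?_⟩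
  rw [hG.dsmul_pull_nabla hD (isSmoothField_of_mem_killingG hZ.1), map_zero]
  exact hZ.2 _ (hG.dsmul_mem_osculating hD g hv)

lemma pull_mem_isotropyKernel (hG : ActsByIsometries E M G) (hD : IsLeviCivita D) (g : G)
    (p : M) : ∀ Z ∈ isotropyKernel F hG hD (g • p), pull g Z ∈ isotropyKernel F hG hD p := by
  have := smoothConstSMul_of_contMDiffSMul E M F G
  intro Z hZ
  have hZK := (isIdealOf_isotropyKernel hG hD _).le hZ
  rw [mem_isotropyKernel hG hD hZK] at hZ
  rw [mem_isotropyKernel hG hD (pull_mem_killingG g hZK)]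
  refine ⟨?_, fun v => dsmul_injective g p ?_⟩
  · rw [pull_eq_iff, map_zero]
    exact hZ.1
  · rw [hG.dsmul_pull_nabla hD (isSmoothField_of_mem_killingG hZK), map_zero]
    exact hZ.2 _

/-- A field in `𝒦^G(M)` that vanishes to first order at a point vanishes. -/
lemma eq_zero_of_mem_isotropyKernel [ConnectedSpace M] (hG : ActsByIsometries E M G)
    (hD : IsLeviCivita D) {p : M} (hX : X ∈ isotropyKernel F hG hD p) : X = 0 := by
  funext q
  -- First-order vanishing at `p` is thus first-order vanishing at every `q`, and in particular the
  -- value at `q` is zero.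
  rw [ideal_eq_of_equivariant (isIdealOf_isotropyKernel hG hD) (pull_mem_isotropyKernel hG hD) p q]
    at hX
  exact ((mem_isotropyKernel hG hD ((isIdealOf_isotropyKernel hG hD _).le hX)).1 hX).1

/-- The pointwise result only gives brackets that vanish to first order at `p`;
`eq_zero_of_mem_isotropyKernel` upgrades this to vanishing on `M`. -/
lemma transvections_subset_center [ConnectedSpace M] (hG : ActsByIsometries E M G)
    (hD : IsLeviCivita D) (p : M) :
    transvections F G D p ⊆ center (u00Submodule F hG hD p) := by
  rintro X ⟨hX, hXA, hXo⟩
  refine ⟨⟨hX, fun v _ => hXA v⟩, fun U hU =>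
    eq_zero_of_mem_isotropyKernel (F := F) hG hD (p := p) ?_⟩
  have h := KillingModel.br_transvection (K := killingModel (F := F) hG hD p) (X := ⟨X, hX⟩)
    (Z := ⟨U, hU.1⟩) (LinearMap.ext hXA)
  rw [osc_killingModel] at h
  obtain ⟨h1, h2⟩ := h hXo hU.2
  exact ⟨_, ⟨h1, h2⟩, rfl⟩

end Model

end HomNullity

end

theorem theorem3p2
    {E : Type*} [NormedAddCommGroup E] [NormedSpace ℝ E] [FiniteDimensional ℝ E]
    {M : Type*} [TopologicalSpace M] [T2Space M] [SecondCountableTopology M]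
    [ChartedSpace E M] [IsManifold 𝓘(ℝ, E) ∞ M]
    [RiemannianBundle (fun p : M => TangentSpace 𝓘(ℝ, E) p)]
    [IsContMDiffRiemannianBundle 𝓘(ℝ, E) ∞ E (fun p : M => TangentSpace 𝓘(ℝ, E) p)]
    [SimplyConnectedSpace M]
    {F : Type*} [NormedAddCommGroup F] [NormedSpace ℝ F] [FiniteDimensional ℝ F]
    {G : Type*} [TopologicalSpace G] [T2Space G] [SecondCountableTopology G]
    [ChartedSpace F G] [Group G] [LieGroup 𝓘(ℝ, F) ∞ G]
    [MulAction G M] [ContMDiffSMul 𝓘(ℝ, F) 𝓘(ℝ, E) ∞ G M] [MulAction.IsPretransitive G M]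
    (hG : HomNullity.ActsByIsometries E M G)
    (D : CovariantDerivative 𝓘(ℝ, E) E (fun p : M => TangentSpace 𝓘(ℝ, E) p))
    (hD : HomNullity.IsLeviCivita D)
    (hM : ¬ HomNullity.HasEuclideanFactor E M)
    (hν : HomNullity.HasNontrivialNullity D) :
    ∃ 𝔲 : Submodule ℝ (HomNullity.VField E M),
      (∀ p : M, HomNullity.u00 F G D p = 𝔲) ∧
      HomNullity.IsIdealOf 𝔲 (HomNullity.killingG E M F G) ∧
      ∀ p : M, HomNullity.transvections F G D p ⊆ HomNullity.center 𝔲 := by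
  have : PathConnectedSpace M := inferInstance
  obtain ⟨p₀⟩ : Nonempty M := inferInstance
  have h : ∀ p, HomNullity.u00Submodule F hG hD p = HomNullity.u00Submodule F hG hD p₀ := fun p =>
    HomNullity.ideal_eq_of_equivariant (HomNullity.isIdealOf_u00Submodule hG hD)
      (HomNullity.pull_mem_u00Submodule hG hD) p p₀
  refine ⟨HomNullity.u00Submodule F hG hD p₀, fun p => ?_,
    HomNullity.isIdealOf_u00Submodule hG hD p₀, fun p => ?_⟩
  · rw [← h p]; rfl
  · rw [← h p]; exact HomNullity.transvections_subset_center hG hD p
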